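/- **Setting.** Let $d\ge 1$, $k\ge 0$, and write points of $\mathbb{R}^d$ as $(u,v)$ with $u\in\mathbb{R}^{d-1}$, $v\in\mathbb{R}$; put $\mathbf e_d=(0,1)$. Let $D\subset\mathbb{R}^d$ be a rotund set, i.e. an open, bounded, strictly convex set (no segment in its boundary) containing $0$, whose gauge function $\gamma$ is $C^2$ outside the origin, with the Hessian of $\gamma^2$ positive definite outside the origin. Let $\zeta_D(u)=\sup_{x\in D}\langle x,u\rangle$ and, for $\theta\in S^{d-1}$, $H(\theta)=\{x:\langle\theta,x\rangle\ge\zeta_D(\theta)\}$. An *initial transformation* of $D$ at $\theta$ is an invertible linear map $A$ of $\mathbb{R}^d$ with $A(\mathbf e_d)=\nabla\zeta_D(\theta)$, $A(\{v\ge1\})=H(\theta)$ and $\gamma(A(u,1))-\gamma(A(\mathbf e_d))\sim\|u\|^2/2$ as $u\to0$; put $z_D(\theta)=|\det A|$. Let $f(x)=g(\gamma(x))$ be a probability density on $\mathbb{R}^d$ with $g(s)=Ce^{-\psi(s)}$ on $[0,\infty)$, $C>0$, where $\psi$ is continuous on $[0,\infty)$ and $C^2$ on $(0,\infty)$, $\psi'>0$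 on $(0,\infty)$, $\psi(s)\to\infty$ and $(1/\psi')'(s)\to0$ as $s\to\infty$. Put $a=1/\psi'$, $b(s)=\sqrt{a(s)s}$. Let $t_n\to\infty$, $q_n=(a(t_n)t_n)^{(d-1)/2}a(t_n)$ and $\lambda_n=n\,g(t_n)\,q_n$. Let $h_s:(\mathbb{R}^d)^{k+1}\to[0,\infty)$, $s\ge0$, be symmetric, measurable, bounded and translation invariant functions with $h_s(cx_0,\dots,cx_k)=h_{s/c}(x_0,\dots,x_k)$ for all $c>0$, and such that for some $\kappa$, $h_1(x_0,\dots,x_k)>0$ implies $\mathrm{diam}\{x_0,\dots,x_k\}\le\kappa$. Let $r_n>0$, $r_n\to r\in(0,\infty)$. Let $\mathcal P_n$ be a Poisson process with intensity $nf$ and $$S_{k,n}(\theta)=\frac1{(k+1)!}\sum h_{r_n}(x_0,\dots,x_k),$$ the sum being over all $(k+1)$-tuples of pairwise distinct points of $\mathcal P_n\cap t_nH(\theta)$. **Proposition.** Suppose that $b(t_n)\to\beta\in[0,\infty)$. Then $\mathbb E[S_{k,n}(\theta)^2]<\infty$ for all $n$ and $\theta \in S^{d-1}$, and the following hold. (a)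 Let $\theta\in S^{d-1}$ and let $A$ be an initial transformation of $D$ at $\theta$. Assume that $h_r$ is continuous at the point $(A(\beta u_0,0),\dots,A(\beta u_k,0))$ for Lebesgue-almost every $(u_0,\dots,u_k)\in(\mathbb{R}^{d-1})^{k+1}$ (that is, at almost every point of $(\theta^\perp)^{k+1}$ if $\beta>0$, and at the origin if $\beta=0$). If $\beta>0$, then $$\lim_{n\to\infty}\frac{\mathbb E[S_{k,n}(\theta)]}{\lambda_n^{k+1}}=\frac{z_D(\theta)^{k+1}}{(k+1)!}\int_{(\mathbb{R}^{d-1})^{k+1}}h_r\big(A(\beta u_0,0),\dots,A(\beta u_k,0)\big)\prod_{i=0}^ke^{-\|u_i\|^2/2}\,du_i,$$ and if $\beta=0$, then, with $c_k^0=h_1(0,\dots,0)$, $$\lim_{n\to\infty}\frac{\mathbb E[S_{k,n}(\theta)]}{\lambda_n^{k+1}}=\frac{c^0_k\,[z_D(\theta)(2\pi)^{(d-1)/2}]^{k+1}}{(k+1)!}.$$ For $1\le\ell\le k+1$ let $$\mathcal I_{k,\ell}=z_D(\theta)^{2k+2-\ell}\int_{(\mathbb{R}^{d-1})^{2k+2-\ell}}h_r(w_0,\dots,w_k)\,h_r(w_0,\dots,w_{\ell-1},w_{k+1},\dots,w_{2k+1-\ell})\prod_{i=0}^{2k+1-\ell}e^{-\|u_i\|^2/2}\,du_i,\qquad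 w_i=A(\beta u_i,0).$$ Then $$\begin{cases}\lambda_n^{-(k+1)}\,\mathrm{Var}(S_{k,n}(\theta))\to\dfrac{\mathcal I_{k,k+1}}{(k+1)!}&\text{if }\lambda_n\to0,\\[2mm] \mathrm{Var}(S_{k,n}(\theta))\to\displaystyle\sum_{\ell=1}^{k+1}\frac{\chi^{2k+2-\ell}\,\mathcal I_{k,\ell}}{\ell!\,((k+1-\ell)!)^2}&\text{if }\lambda_n\to\chi\in(0,\infty),\\[2mm] \lambda_n^{-(2k+1)}\,\mathrm{Var}(S_{k,n}(\theta))\to\dfrac{\mathcal I_{k,1}}{(k!)^2}&\text{if }\lambda_n\to\infty.\end{cases}$$ (b) Let $\tau_n=\lambda_n^{k+1}$, $1$, $\lambda_n^{2k+1}$ according as $\lambda_n\to0$, $\lambda_n\to\chi\in(0,\infty)$, $\lambda_n\to\infty$. In each of these three cases, if $\theta_1,\theta_2\in S^{d-1}$ and $\theta_1\ne\pm\theta_2$, then $\tau_n^{-1}\,\mathrm{Cov}(S_{k,n}(\theta_1),S_{k,n}(\theta_2))\to0$. (c) If $\theta_1,\theta_2\in S^{d-1}$ and $\theta_1=-\theta_2$,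 then $\mathrm{Cov}(S_{k,n}(\theta_1),S_{k,n}(\theta_2))=0$ for all $n$. -/

import Mathlib

open MeasureTheory ProbabilityTheory Filter Topology
open scoped NNReal ENNReal Pointwise

noncomputable section

/-- Horizontal space `ℝ^{d-1}`, where `d = m + 1`. -/
abbrev HorSpace (m : ℕ) : Type := EuclideanSpace ℝ (Fin m)

/-- The ambient Euclidean space `ℝ^d`, where `d = m + 1`. -/
abbrev ESpace (m : ℕ) : Type := EuclideanSpace ℝ (Fin (m + 1))

/-- The point `(u, v)` of `ℝ^d` with horizontal part `u` and vertical (last) coordinate `v`. -/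
def pt {m : ℕ} (u : HorSpace m) (v : ℝ) : ESpace m :=
  WithLp.toLp 2 (Fin.snoc (α := fun _ => ℝ) (fun i => u i) v)

/-- The support function `ζ_D(u) = sup {⟨x, u⟩ : x ∈ D}`. -/
def supportFunction {m : ℕ} (D : Set (ESpace m)) (u : ESpace m) : ℝ :=
  sSup ((fun x => inner ℝ x u) '' D)

/-- The outer support halfspace of `D` at angle `θ`. -/
def supportHalfspace {m : ℕ} (D : Set (ESpace m)) (θ : ESpace m) : Set (ESpace m) :=
  {x | supportFunction D θ ≤ inner ℝ θ x}

/-- Rotund sets: open, bounded, strictly convex, containing the origin, with a gauge function that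
is `C²` off the origin and whose square has positive definite Hessian off the origin. Strict
convexity of the open convex set `D` (no segments in its boundary) is strict convexity of the
closure in the sense of Mathlib. -/
structure IsRotund {m : ℕ} (D : Set (ESpace m)) : Prop where
  isOpen : IsOpen D
  isBounded : Bornology.IsBounded D
  convex : Convex ℝ D
  strictConvex_closure : StrictConvex ℝ (closure D)
  zero_mem : (0 : ESpace m) ∈ D
  contDiffOn_gauge : ContDiffOn ℝ 2 (gauge D) {0}ᶜ
  hessian_pos : ∀ x : ESpace m, x ≠ 0 → ∀ w : ESpace m, w ≠ 0 →
    0 < iteratedFDeriv ℝ 2 (fun y => gauge D y ^ 2) x ![w, w]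

/-- `A` is an initial transformation of `D` at the angle `θ`. -/
structure IsInitialTransformation {m : ℕ} (D : Set (ESpace m)) (θ : ESpace m)
    (A : ESpace m ≃ₗ[ℝ] ESpace m) : Prop where
  /-- `A e_d = ∇ζ_D(θ)` -/
  gradient : HasGradientAt (supportFunction D) (A (pt 0 1)) θ
  /-- `A` maps `{v ≥ 1}` onto the outer support halfspace. -/
  image_halfspace : A '' {x | 1 ≤ x (Fin.last m)} = supportHalfspace D θ
  /-- `A⁻¹ D` is in correct initial position. -/
  correct_position : Asymptotics.IsEquivalent (𝓝 (0 : HorSpace m))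
    (fun u => gauge D (A (pt u 1)) - gauge D (A (pt 0 1))) (fun u => ‖u‖ ^ 2 / 2)

/-- The constant `z_D(θ) = |det A|`, for an initial transformation `A` of `D` at `θ`. -/
def zConst {m : ℕ} (A : ESpace m ≃ₗ[ℝ] ESpace m) : ℝ :=
  |LinearMap.det (A : ESpace m →ₗ[ℝ] ESpace m)|

/-- Von Mises functions on `[0, ∞)`. -/
structure IsVonMises (ψ : ℝ → ℝ) : Prop where
  continuousOn : ContinuousOn ψ (Set.Ici 0)
  contDiffOn : ContDiffOn ℝ 2 ψ (Set.Ioi 0)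
  deriv_pos : ∀ s : ℝ, 0 < s → 0 < deriv ψ s
  tendsto_atTop : Tendsto ψ atTop atTop
  tendsto_deriv : Tendsto (deriv fun s => 1 / deriv ψ s) atTop (𝓝 0)

/-- The density generator `g(s) = C exp(-ψ(s))`. -/
def generator (C : ℝ) (ψ : ℝ → ℝ) (s : ℝ) : ℝ := C * Real.exp (-ψ s)

/-- The density `f(x) = g(γ_D(x))`. -/
def density {m : ℕ} (D : Set (ESpace m)) (C : ℝ) (ψ : ℝ → ℝ) (x : ESpace m) : ℝ :=
  generator C ψ (gauge D x)

/-- `a(s) = 1/ψ'(s)` -/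
def aFun (ψ : ℝ → ℝ) (s : ℝ) : ℝ := 1 / deriv ψ s

/-- `b(s) = √(a(s) s)` -/
def bFun (ψ : ℝ → ℝ) (s : ℝ) : ℝ := Real.sqrt (aFun ψ s * s)

/-- `q(s) = (a(s) s)^{(d-1)/2} a(s)` with `d - 1 = m`, so that `q_n = q(t_n)`. -/
def qFun (m : ℕ) (ψ : ℝ → ℝ) (s : ℝ) : ℝ := (aFun ψ s * s) ^ ((m : ℝ) / 2) * aFun ψ s

/-- The sequence `n g(t_n) q_n`. -/
def rate (m : ℕ) (C : ℝ) (ψ : ℝ → ℝ) (t : ℕ → ℝ) (n : ℕ) : ℝ :=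
  n * generator C ψ (t n) * qFun m ψ (t n)

/-- Conditions on the family of kernels `h_s`, `s ≥ 0`, of order `k` on `ℝ^d`. -/
structure IsKernelFamily {m : ℕ} (k : ℕ) (h : ℝ → (Fin (k + 1) → ESpace m) → ℝ) : Prop where
  measurable : ∀ s : ℝ, 0 ≤ s → Measurable (h s)
  nonneg : ∀ s : ℝ, 0 ≤ s → ∀ x, 0 ≤ h s x
  symmetric : ∀ s : ℝ, 0 ≤ s → ∀ (σ : Equiv.Perm (Fin (k + 1))) (x), h s (x ∘ σ) = h s x
  translation : ∀ s : ℝ, 0 ≤ s → ∀ (y : ESpace m) (x), h s (fun i => x i + y) = h s x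
  local_determined : ∃ κ : ℝ, ∀ x, 0 < h 1 x → ∀ i j, ‖x i - x j‖ ≤ κ
  scaling : ∀ s : ℝ, 0 ≤ s → ∀ c : ℝ, 0 < c → ∀ x, h s (fun i => c • x i) = h (s / c) x
  bounded : ∀ s : ℝ, 0 ≤ s → ∃ M : ℝ, ∀ x, h s x ≤ M

/-- The `U`-statistic `(1/(k+1)!) ∑ h(x_0, …, x_k)`, summed over the `(k+1)`-tuples of pairwise
distinct points of `X`; it is a finite sum whenever `X` is finite. -/
def uStat {m : ℕ} (k : ℕ) (h : (Fin (k + 1) → ESpace m) → ℝ) (X : Set (ESpace m)) : ℝ :=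
  (1 / ((k + 1).factorial : ℝ)) *
    ∑' x : {x : Fin (k + 1) → ESpace m // Function.Injective x ∧ ∀ i, x i ∈ X}, h x

/-- `N` is a Poisson process with the (diffuse) intensity measure `μ`, given as a random set of
points: the numbers of points in measurable sets are Poisson distributed random variables,
independent for disjoint sets. -/
structure IsPoissonProcess {E : Type*} [MeasurableSpace E] {Ω : Type*} [MeasurableSpace Ω]
    (μ : Measure E) (P : Measure Ω) (N : Ω → Set E) : Prop where
  measurable_count : ∀ B : Set E, MeasurableSet B → Measurable fun ω => (N ω ∩ B).encard
  law : ∀ B : Set E, MeasurableSet B → μ B ≠ ∞ →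
    P.map (fun ω => (N ω ∩ B).encard) =
      (poissonMeasure (μ B).toNNReal).map (fun j : ℕ => (j : ℕ∞))
  law_top : ∀ B : Set E, MeasurableSet B → μ B = ∞ → ∀ᵐ ω ∂P, (N ω ∩ B).encard = ⊤
  indep : ∀ (l : ℕ) (B : Fin l → Set E), (∀ i, MeasurableSet (B i)) →
    Pairwise (Function.onFun Disjoint B) → iIndepFun (fun i ω => (N ω ∩ B i).encard) P

/-- The intensity measure `n f(x) dx`. -/
def intensity {m : ℕ} (D : Set (ESpace m)) (C : ℝ) (ψ : ℝ → ℝ) (n : ℕ) : Measure (ESpace m) :=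
  volume.withDensity fun x => ENNReal.ofReal (n * density D C ψ x)

/-- `S_{k,n}(θ) = S_k(𝒫_n ∩ t_n H(θ), r_n)`. -/
def SStat {m : ℕ} {Ω : Type*} (k : ℕ) (h : ℝ → (Fin (k + 1) → ESpace m) → ℝ)
    (D : Set (ESpace m)) (N : ℕ → Ω → Set (ESpace m)) (t rs : ℕ → ℝ) (n : ℕ) (θ : ESpace m)
    (ω : Ω) : ℝ :=
  uStat k (h (rs n)) (N n ω ∩ t n • supportHalfspace D θ)

/-- The integral of `h(A(β u_0, 0), …, A(β u_k, 0)) ∏ exp(-‖u_i‖²/2)` over `(ℝ^{d-1})^{k+1}`. -/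
def meanIntegral {m : ℕ} (k : ℕ) (h : (Fin (k + 1) → ESpace m) → ℝ)
    (A : ESpace m ≃ₗ[ℝ] ESpace m) (β : ℝ) : ℝ :=
  ∫ u : Fin (k + 1) → HorSpace m,
    h (fun i => A (pt (β • u i) 0)) * ∏ i, Real.exp (-‖u i‖ ^ 2 / 2)

/-- From `u = (u_0, …, u_k)` and `w = (u_{k+1}, …, u_{2k+1-l})` form
`(u_0, …, u_{l-1}, u_{k+1}, …, u_{2k+1-l})`. -/
def splice {V : Type*} (k l : ℕ) (u : Fin (k + 1) → V) (w : Fin (k + 1 - l) → V)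
    (i : Fin (k + 1)) : V :=
  if hi : (i : ℕ) < l then u i else w ⟨(i : ℕ) - l, by omega⟩

/-- The integral `I_{k,l}` over `(ℝ^{d-1})^{2k+2-l}`. The variables `u_0, …, u_k` are collected in
the first component and `u_{k+1}, …, u_{2k+1-l}` in the second one. -/
def varIntegral {m : ℕ} (k : ℕ) (h : (Fin (k + 1) → ESpace m) → ℝ)
    (A : ESpace m ≃ₗ[ℝ] ESpace m) (β : ℝ) (l : ℕ) : ℝ :=
  zConst A ^ (2 * k + 2 - l) *
    ∫ p : (Fin (k + 1) → HorSpace m) × (Fin (k + 1 - l) → HorSpace m),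
      h (fun i => A (pt (β • p.1 i) 0)) *
        h (fun i => A (pt (β • splice k l p.1 p.2 i) 0)) *
        ((∏ i, Real.exp (-‖p.1 i‖ ^ 2 / 2)) * ∏ j, Real.exp (-‖p.2 j‖ ^ 2 / 2))

end

/-! Moments of a Poisson `U`-statistic are integrals against powers of the intensity, by the
multivariate Mecke formula (`IsPoissonProcess.bind_tupleMeasure`). In the product of two
`U`-statistics, sort the pairs of tuples by the number `l` of common points: the term `l = 0` is the
product of the means, so the covariance is the sum over `1 ≤ l ≤ k + 1` of an integral in `2k + 2 -
l` variables with weight `1 / (l! ((k + 1 - l)!)²)` (`IsPoissonProcess.covariance_uStat`). It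
remains to find the size of these integrals.

For one angle substitute `x = A(b u, t + a v)` with `a = a(t)`, `b = b(t)`, `t = t_n`. The halfspace
`t H(θ)` becomes `{v ≥ 0}` and the Jacobian is `q_n z_D(θ)`, so the intensity becomes `λ_n z_D(θ)`
times a profile `exp(-(ψ(γ) - ψ(t)))`. The initial transformation gives `γ = t + a (v + ‖u‖²/2 +
o(1))`, and `a' → 0` makes `ψ(t + a s) - ψ(t)` tend to `s`; hence the profile tends to `exp(-v -
‖u‖²/2)`. It is dominated by an integrable power: `(γ - t)/a` grows at least linearly in `(u, v)` by
convexity (`IsAdapted.exists_linear_le`), and `ψ` grows at least like `p log` for every `p` on the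
scale `a` (`IsVonMises.exists_log_le`). Translation invariance and scaling turn the kernel at radius
`r_n` into `h_r` at points converging to `A(β u_i, 0)`, because `a = b²/t → 0`. Dominated
convergence (`IsInitialTransformation.tendsto_integral_pi`) gives an integral in `j` variables the
order `λ_n^j`, with a Gaussian integral as constant since each `v_i` integrates to one. The regimes
come from comparing powers of `λ_n` (`tendsto_regimes`).

For two angles every covariance term carries a factor `μ(t H(θ₁) ∩ t H(θ₂))^l` with `l ≥ 1`. The
mass of `t H(θ₁)` concentrates near `t` times the contact point of `H(θ₁)` with the closure of `D`,
which lies outside `H(θ₂)` because the gauge is differentiable there; so the intersection has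
measure `o(λ_n)`, while each halfspace has measure `O(λ_n)`. Opposite halfspaces are disjoint. Here
no initial transformation is given, so domination is proved for the weaker `IsAdapted`, which is
constructed at every angle from the Hessian of `γ²`. -/

/-! ### Counting measures of finite sets and their factorial powers. -/

section PointMeasures

variable {E : Type*} [MeasurableSpace E]

open scoped Classical in
/-- The counting measure of a finite set of points (and `0` for an infinite set). -/
noncomputable def pointMeasure (X : Set E) : Measure E :=
  if h : X.Finite then ∑ x ∈ h.toFinset, Measure.dirac x else 0

instance (X : Set E) : IsFiniteMeasure (pointMeasure X) := by
  unfold pointMeasure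
  split_ifs
  · infer_instance
  · infer_instance

theorem pointMeasure_apply {X : Set E} (hX : X.Finite) {B : Set E} (hB : MeasurableSet B) :
    pointMeasure X B = ((X ∩ B).encard : ℝ≥0∞) := by
  classical
  have h1 : X ∩ B = ↑(hX.toFinset.filter (· ∈ B)) := by ext; simp
  rw [pointMeasure, dif_pos hX, h1, Set.encard_coe_eq_coe_finsetCard, Measure.finsetSum_apply]
  simp [hB, Set.indicator_apply]

theorem pointMeasure_of_infinite {X : Set E} (hX : ¬ X.Finite) : pointMeasure X = 0 := by
  rw [pointMeasure, dif_neg hX]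

/-- The set of tuples of pairwise distinct points. -/
def distinctTuples (ι E : Type*) : Set (ι → E) := {z | Function.Injective z}

open scoped Classical in
/-- The finite set of tuples of pairwise distinct points of a finite set. -/
noncomputable def tupleFinset (ι : Type*) [Fintype ι] (X : Finset E) : Finset (ι → E) :=
  (Fintype.piFinset fun _ : ι => X).filter Function.Injective

omit [MeasurableSpace E] in
theorem mem_tupleFinset {ι : Type*} [Fintype ι] {X : Finset E} {z : ι → E} :
    z ∈ tupleFinset ι X ↔ (∀ i, z i ∈ X) ∧ Function.Injective z := by
  classical
  simp [tupleFinset]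

/-- The factorial power of the counting measure of a set of points. -/
noncomputable def tupleMeasure (ι : Type*) [Fintype ι] (X : Set E) : Measure (ι → E) :=
  (Measure.pi fun _ : ι => pointMeasure X).restrict (distinctTuples ι E)

open scoped Classical in
-- On boxes, this is the expansion of a product of sums into a sum of products.
theorem pi_pointMeasure {ι : Type*} [Fintype ι] {X : Set E} (hX : X.Finite) :
    (Measure.pi fun _ : ι => pointMeasure X) =
      ∑ z ∈ Fintype.piFinset fun _ : ι => hX.toFinset, Measure.dirac z := by
  refine Measure.pi_eq fun s hs => ?_
  rw [Measure.finsetSum_apply]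
  simp_rw [Measure.dirac_apply' _ (MeasurableSet.univ_pi hs)]
  simp_rw [pointMeasure, dif_pos hX, Measure.finsetSum_apply]
  rw [Finset.prod_univ_sum]
  refine Finset.sum_congr rfl fun z _ => ?_
  simp_rw [Measure.dirac_apply' _ (hs _)]
  by_cases hz : z ∈ Set.univ.pi s
  · rw [Set.indicator_of_mem hz]
    rw [Finset.prod_eq_one]; · rfl
    intro i _
    rw [Set.indicator_of_mem (hz i trivial)]; rfl
  · rw [Set.indicator_of_notMem hz]
    simp only [Set.mem_pi, Set.mem_univ, true_imp_iff, not_forall] at hz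
    obtain ⟨i, hi⟩ := hz
    rw [Finset.prod_eq_zero (Finset.mem_univ i)]
    rw [Set.indicator_of_notMem hi]

/-- Links two views of a factorial power: a measure, whose dependence on the random set is
measurable, and a finite sum, on which the combinatorics takes place. -/
theorem lintegral_tupleMeasure {ι : Type*} [Fintype ι]
    (hm : MeasurableSet (distinctTuples ι E)) {X : Set E} (hX : X.Finite)
    {f : (ι → E) → ℝ≥0∞} (hf : Measurable f) :
    ∫⁻ z, f z ∂(tupleMeasure ι X) = ∑ z ∈ tupleFinset ι hX.toFinset, f z := by
  classical
  rw [tupleMeasure, ← lintegral_indicator hm, pi_pointMeasure hX,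
    lintegral_finsetSum_measure]
  simp_rw [lintegral_dirac' _ (hf.indicator hm)]
  rw [tupleFinset, Finset.sum_filter]
  refine Finset.sum_congr rfl fun z _ => ?_
  simp [Set.indicator_apply, distinctTuples]

end PointMeasures

/-! ### Measurability and first moments of Poisson counts. -/

section Poisson

/-- The factor `j` cancels in `j r^j / j! = r · r^(j-1) / (j-1)!`; after the index shift the total
mass `1` remains. -/
theorem lintegral_natCast_poissonMeasure (r : ℝ≥0) :
    ∫⁻ j : ℕ, (j : ℝ≥0∞) ∂(poissonMeasure r) = r := by
  rw [poissonMeasure, lintegral_sum_measure]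
  simp_rw [lintegral_smul_measure, lintegral_dirac, smul_eq_mul]
  rw [tsum_eq_zero_add' ENNReal.summable]
  simp only [Nat.cast_zero, mul_zero, zero_add]
  have h1 : ∀ n : ℕ, ENNReal.ofReal (Real.exp (-r) * r ^ (n + 1) / (n + 1).factorial) *
      ((n + 1 : ℕ) : ℝ≥0∞) = r * ENNReal.ofReal (Real.exp (-r) * r ^ n / n.factorial) := by
    intro n
    rw [← ENNReal.ofReal_natCast, ← ENNReal.ofReal_mul (by positivity),
      ← ENNReal.ofReal_coe_nnreal (p := r), ← ENNReal.ofReal_mul (by positivity)]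
    congr 1
    rw [Nat.factorial_succ]
    push_cast
    field_simp
    ring
  simp_rw [h1]
  rw [ENNReal.tsum_mul_left, ← ENNReal.ofReal_tsum_of_nonneg (fun n => by positivity)
    (hasSum_one_poissonMeasure r).summable, (hasSum_one_poissonMeasure r).tsum_eq]
  simp

variable {E : Type*} [MeasurableSpace E] {Ω : Type*} [MeasurableSpace Ω]
  {μ : Measure E} {P : Measure Ω} {N : Ω → Set E}

theorem IsPoissonProcess.lintegral_encard (hN : IsPoissonProcess μ P N) {B : Set E}
    (hB : MeasurableSet B) (hμ : μ B ≠ ∞) :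
    ∫⁻ ω, ((N ω ∩ B).encard : ℝ≥0∞) ∂P = μ B := by
  have h1 : Measurable (fun j : ℕ∞ => (j : ℝ≥0∞)) := .of_discrete
  rw [← lintegral_map (f := fun j : ℕ∞ => (j : ℝ≥0∞)) h1 (hN.measurable_count B hB), hN.law B hB hμ,
    lintegral_map h1 .of_discrete]
  simp [lintegral_natCast_poissonMeasure, ENNReal.coe_toNNReal hμ]

theorem IsPoissonProcess.ae_finite [IsFiniteMeasure μ] (hN : IsPoissonProcess μ P N) :
    ∀ᵐ ω ∂P, (N ω).Finite := by
  have h := hN.lintegral_encard MeasurableSet.univ (measure_ne_top μ _)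
  have hm : Measurable fun ω => ((N ω ∩ Set.univ).encard : ℝ≥0∞) :=
    (Measurable.of_discrete (f := fun j : ℕ∞ => (j : ℝ≥0∞))).comp
      (hN.measurable_count _ MeasurableSet.univ)
  filter_upwards [ae_lt_top hm (h ▸ measure_ne_top μ _)] with ω hω
  simpa [Set.encard_lt_top_iff] using hω

theorem IsPoissonProcess.measurable_pointMeasure (hN : IsPoissonProcess μ P N) :
    Measurable fun ω => pointMeasure (N ω) := by
  refine Measure.measurable_of_measurable_coe _ fun B hB => ?_
  have hfin : MeasurableSet {ω | (N ω).Finite} := by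
    have : {ω | (N ω).Finite} = (fun ω => (N ω ∩ Set.univ).encard) ⁻¹' {⊤}ᶜ := by
      ext ω; simp
    rw [this]
    exact hN.measurable_count _ MeasurableSet.univ (MeasurableSet.of_discrete)
  classical
  have : (fun ω => pointMeasure (N ω) B) =
      fun ω => if (N ω).Finite then ((N ω ∩ B).encard : ℝ≥0∞) else 0 := by
    ext ω
    split_ifs with h
    · exact pointMeasure_apply h hB
    · simp [pointMeasure_of_infinite h]
  rw [this]
  exact Measurable.ite hfin ((Measurable.of_discrete (f := fun j : ℕ∞ => (j : ℝ≥0∞))).comp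
      (hN.measurable_count _ hB)) measurable_const

variable {ι : Type*} [Fintype ι]

/-- Boxes form a generating π-system, and on a box the product measure is a finite product of
measurable functions of `ω`. -/
theorem IsPoissonProcess.measurable_tupleMeasure (hN : IsPoissonProcess μ P N) 
    (hm : MeasurableSet (distinctTuples ι E)) :
    Measurable fun ω => tupleMeasure ι (N ω) := by
  have h1 : Measurable fun ω => (Measure.pi fun _ : ι => pointMeasure (N ω)) := by
    have h2 : ∀ s : ι → Set E, (∀ i, MeasurableSet (s i)) →
        Measurable fun ω => (Measure.pi fun _ : ι => pointMeasure (N ω)) (Set.univ.pi s) := by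
      intro s hs
      simp_rw [Measure.pi_pi]
      exact Finset.measurable_prod _ fun i _ =>
        (Measure.measurable_coe (hs i)).comp hN.measurable_pointMeasure
    refine Measurable.measure_of_isPiSystem generateFrom_pi.symm isPiSystem_pi ?_ ?_
    · rintro _ ⟨s, hs, rfl⟩
      exact h2 s fun i => hs i trivial
    · have := h2 (fun _ => Set.univ) fun _ => MeasurableSet.univ
      rwa [Set.pi_univ] at this
  refine Measure.measurable_of_measurable_coe _ fun s hs => ?_
  simp_rw [tupleMeasure, Measure.restrict_apply hs]
  exact (Measure.measurable_coe (hs.inter hm)).comp h1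

/-- The point where independence of the counts enters: for disjoint sets the mean of the product is
the product of the means. -/
theorem IsPoissonProcess.lintegral_prod_encard (hN : IsPoissonProcess μ P N) (s : ι → Set E)
    (hs : ∀ i, MeasurableSet (s i)) (hμ : ∀ i, μ (s i) ≠ ∞)
    (hd : Pairwise (Function.onFun Disjoint s)) :
    ∫⁻ ω, ∏ i, ((N ω ∩ s i).encard : ℝ≥0∞) ∂P = ∏ i, μ (s i) := by
  let e := Fintype.equivFin ι
  have h1 : Measurable (fun j : ℕ∞ => (j : ℝ≥0∞)) := .of_discrete
  have h2 := hN.indep _ (fun j => s (e.symm j)) (fun j => hs _)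
    (fun i j hij => hd (fun h => hij (e.symm.injective h)))
  have h3 := h2.comp (fun _ (j : ℕ∞) => (j : ℝ≥0∞)) fun _ => h1
  have h4 := lintegral_prod_eq_prod_lintegral_of_indepFun Finset.univ _ h3
    fun i => h1.comp (hN.measurable_count _ (hs _))
  simp only [Function.comp_def] at h4
  have h5 : ∀ ω, ∏ i, ((N ω ∩ s i).encard : ℝ≥0∞) =
      ∏ j, ((N ω ∩ s (e.symm j)).encard : ℝ≥0∞) := fun ω =>
    (Equiv.prod_comp e.symm fun i => ((N ω ∩ s i).encard : ℝ≥0∞)).symm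
  simp_rw [h5]
  rw [h4]
  simp_rw [hN.lintegral_encard (hs _) (hμ _)]
  exact Equiv.prod_comp e.symm fun i => μ (s i)

end Poisson

/-! ### The set of tuples of pairwise distinct points. -/

section Diagonal

variable {E : Type*} [TopologicalSpace E] [T2Space E] [SecondCountableTopology E]
  [MeasurableSpace E] [BorelSpace E] {ι : Type*} [Fintype ι]

omit [SecondCountableTopology E] [MeasurableSpace E] [BorelSpace E] in
theorem isOpen_distinctTuples : IsOpen (distinctTuples ι E) := by
  have : distinctTuples ι E = ⋂ i : ι, ⋂ j : ι, {z | i ≠ j → z i ≠ z j} := by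
    ext z
    simp only [distinctTuples, Set.mem_ofPred_eq, Set.mem_iInter, Function.Injective]
    exact forall₂_congr fun i j => ⟨fun h hij he => hij (h he), fun h he => by
      by_contra hij; exact h hij he⟩
  rw [this]
  refine isOpen_iInter_of_finite fun i => isOpen_iInter_of_finite fun j => ?_
  by_cases hij : i = j
  · simp [hij]
  · simpa [hij] using isOpen_ne_fun (continuous_apply i) (continuous_apply j)

theorem measurableSet_distinctTuples : MeasurableSet (distinctTuples ι E) :=
  isOpen_distinctTuples.measurableSet

/-- Split off the coordinate `i`: for fixed remaining coordinates, `z i = z j` prescribes a single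
value of `z i`, which a diffuse measure does not charge. -/
theorem ae_distinctTuples (μ : Measure E) [IsFiniteMeasure μ] [NullSingletonClass μ] :
    ∀ᵐ z ∂(Measure.pi fun _ : ι => μ), z ∈ distinctTuples ι E := by
  classical
  have key : ∀ i j : ι, i ≠ j → ∀ᵐ z ∂(Measure.pi fun _ : ι => μ), z i ≠ z j := by
    intro i j hij
    have hmp := measurePreserving_piEquivPiSubtypeProd (fun _ : ι => μ) (fun l => l = i)
    let S : Set (({l // l = i} → E) × ({l // ¬ l = i} → E)) :=
      {p | p.1 ⟨i, rfl⟩ = p.2 ⟨j, fun h => hij h.symm⟩}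
    have hS : MeasurableSet S := measurableSet_eq_fun (by fun_prop) (by fun_prop)
    have hS0 : ((Measure.pi fun _ : {l // l = i} => μ).prod
        (Measure.pi fun _ : {l // ¬ l = i} => μ)) S = 0 := by
      rw [Measure.prod_apply_symm hS]
      simp only [lintegral_eq_zero_iff' (measurable_measure_prodMk_right hS).aemeasurable]
      refine Eventually.of_forall fun y => ?_
      exact Measure.pi_hyperplane (μ := fun _ : {l // l = i} => μ) ⟨i, rfl⟩ _
    have := hmp.measure_preimage hS.nullMeasurableSet
    have h0 : (Measure.pi fun _ : ι => μ)
        (MeasurableEquiv.piEquivPiSubtypeProd (fun _ => E) (fun l => l = i) ⁻¹' S) = 0 :=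
      this.trans (by convert hS0)
    rw [ae_iff]
    refine measure_mono_null ?_ h0
    intro z hz
    simpa [S, MeasurableEquiv.piEquivPiSubtypeProd, Equiv.piEquivPiSubtypeProd] using hz
  have h2 : ∀ᵐ z ∂(Measure.pi fun _ : ι => μ), ∀ i j : ι, i ≠ j → z i ≠ z j := by
    simp only [ae_all_iff]
    exact key
  filter_upwards [h2] with z hz i j h
  by_contra hij
  exact hz i j hij h

/-- In a Hausdorff space, distinct points have pairwise disjoint neighbourhoods taken from a
countable basis, and only countably many finite families can be formed from it. -/
theorem exists_disjoint_cover : ∃ R : ℕ → ι → Set E, (∀ n i, MeasurableSet (R n i)) ∧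
    (∀ n, Pairwise (Function.onFun Disjoint (R n))) ∧
    distinctTuples ι E = ⋃ n, Set.univ.pi (R n) := by
  classical
  let b := TopologicalSpace.countableBasis E
  have hb := TopologicalSpace.isBasis_countableBasis E
  have : Countable b := (TopologicalSpace.countable_countableBasis E).to_subtype
  let T := {c : ι → b // Pairwise (Function.onFun Disjoint fun i => (c i : Set E))}
  -- `none` stands for a box with empty sides; it makes the index type nonempty, as an enumeration
  -- by `ℕ` requires.
  let R0 : Option T → ι → Set E := fun o => o.elim (fun _ => ∅) fun c i => (c.1 i : Set E)
  obtain ⟨en, hen⟩ := exists_surjective_nat (Option T)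
  refine ⟨fun n => R0 (en n), fun n i => ?_, fun n => ?_, ?_⟩
  · dsimp only
    cases h : en n with
    | none => simp [R0]
    | some c => exact (TopologicalSpace.isOpen_of_mem_countableBasis (c.1 i).2).measurableSet
  · dsimp only
    cases h : en n with
    | none => intro i j _; simp [R0, Function.onFun]
    | some c => exact c.2
  -- For empty `ι` every box, the dummy one included, is the whole one-point space.
  · by_cases hι : IsEmpty ι
    · ext z
      simp [distinctTuples, Function.injective_of_subsingleton]
    rw [not_isEmpty_iff] at hι
    apply Set.Subset.antisymm
    · intro z hz
      have hz' : Function.Injective z := hz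
      obtain ⟨U, hU, hUd⟩ := (Set.toFinite (Set.range z)).t2_separation
      have : ∀ i, ∃ c ∈ b, z i ∈ c ∧ c ⊆ U (z i) := fun i =>
        hb.exists_subset_of_mem_open (hU (z i)).1 (hU (z i)).2
      choose c hcb hcz hcU using this
      have hc : Pairwise (Function.onFun Disjoint c) := fun i j hij =>
        (hUd ⟨i, rfl⟩ ⟨j, rfl⟩ (hz'.ne hij)).mono (hcU i) (hcU j)
      obtain ⟨n, hn⟩ := hen (some ⟨fun i => ⟨c i, hcb i⟩, hc⟩)
      refine Set.mem_iUnion.2 ⟨n, ?_⟩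
      dsimp only
      rw [hn]
      exact fun i _ => hcz i
    · refine Set.iUnion_subset fun n z hz => ?_
      dsimp only at hz
      cases h : en n with
      | none =>
        rw [h] at hz
        exact (hz hι.some trivial).elim
      | some c =>
        rw [h] at hz
        intro i j hij
        by_contra hne
        exact Set.disjoint_left.1 (c.2 hne) (hz i trivial) (by rw [hij]; exact hz j trivial)

end Diagonal

/-! ### The multivariate Mecke formula. -/

section Mecke

variable {E : Type*} [TopologicalSpace E] [T2Space E] [SecondCountableTopology E]
  [MeasurableSpace E] [BorelSpace E] {ι : Type*} [Fintype ι] {Ω : Type*} [MeasurableSpace Ω]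
  {μ : Measure E} [IsFiniteMeasure μ] [NullSingletonClass μ] {P : Measure Ω} {N : Ω → Set E}

/-- Both measures agree on boxes with disjoint sides, by independence. Countably many such boxes
cover the distinct tuples, and intersecting them with any box keeps the sides disjoint, so the
measures agree on distinct tuples. Neither charges the rest: one by construction, the other because
`μ` is diffuse. -/
theorem IsPoissonProcess.bind_tupleMeasure (hN : IsPoissonProcess μ P N) :
    P.bind (fun ω => tupleMeasure ι (N ω)) = Measure.pi fun _ : ι => μ := by
  obtain ⟨R, hRm, hRd, hR⟩ := exists_disjoint_cover (E := E) (ι := ι)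
  have hmeas := hN.measurable_tupleMeasure (ι := ι) measurableSet_distinctTuples
  have hrect : ∀ s : ι → Set E, (∀ i, MeasurableSet (s i)) →
      Pairwise (Function.onFun Disjoint s) → Set.univ.pi s ⊆ distinctTuples ι E →
      P.bind (fun ω => tupleMeasure ι (N ω)) (Set.univ.pi s) = ∏ i, μ (s i) := by
    intro s hs hd hsub
    rw [Measure.bind_apply (MeasurableSet.univ_pi hs) hmeas.aemeasurable,
      ← hN.lintegral_prod_encard s hs (fun i => measure_ne_top _ _) hd]
    refine lintegral_congr_ae ?_
    filter_upwards [hN.ae_finite] with ω hω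
    rw [tupleMeasure, Measure.restrict_apply (MeasurableSet.univ_pi hs),
      Set.inter_eq_left.2 hsub, Measure.pi_pi]
    exact Finset.prod_congr rfl fun i _ => pointMeasure_apply hω (hs i)
  have hon : (P.bind (fun ω => tupleMeasure ι (N ω))).restrict (distinctTuples ι E) =
      (Measure.pi fun _ : ι => μ).restrict (distinctTuples ι E) := by
    rw [hR, Measure.restrict_iUnion_congr]
    intro n
    rw [Measure.restrict_pi_pi]
    refine (Measure.pi_eq fun s hs => ?_).symm
    rw [Measure.restrict_apply (MeasurableSet.univ_pi hs), ← Set.pi_inter_distrib,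
      hrect _ (fun i => (hs i).inter (hRm n i))
      (fun i j hij => (hRd n hij).mono Set.inter_subset_right Set.inter_subset_right)]
    · exact Finset.prod_congr rfl fun i _ => (Measure.restrict_apply (hs i)).symm
    · rw [hR]
      exact (Set.pi_mono fun i _ => Set.inter_subset_right).trans
        (Set.subset_iUnion (fun n => Set.univ.pi (R n)) n)
  have h1 : (P.bind (fun ω => tupleMeasure ι (N ω))).restrict (distinctTuples ι E) =
      P.bind (fun ω => tupleMeasure ι (N ω)) := by
    refine Measure.restrict_eq_self_of_ae_mem ?_
    have hc := (measurableSet_distinctTuples (ι := ι) (E := E)).compl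
    rw [ae_iff]
    change P.bind _ (distinctTuples ι E)ᶜ = 0
    rw [Measure.bind_apply hc hmeas.aemeasurable]
    simp [tupleMeasure, Measure.restrict_apply hc]
  rw [← h1, hon]
  exact Measure.restrict_eq_self_of_ae_mem (ae_distinctTuples μ)

/-- The multivariate Mecke formula. -/
theorem IsPoissonProcess.lintegral_lintegral_tupleMeasure (hN : IsPoissonProcess μ P N)
    {f : (ι → E) → ℝ≥0∞} (hf : Measurable f) :
    ∫⁻ ω, ∫⁻ z, f z ∂(tupleMeasure ι (N ω)) ∂P = ∫⁻ z, f z ∂(Measure.pi fun _ : ι => μ) := by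
  rw [← hN.bind_tupleMeasure, Measure.lintegral_bind
    (hN.measurable_tupleMeasure measurableSet_distinctTuples).aemeasurable hf.aemeasurable]

end Mecke

/-! ### Combinatorics of the product of two `U`-statistics. -/

section Tuples

variable {E : Type*} {ι κ : Type*} [Fintype ι] [Fintype κ]

open scoped Classical in
-- Every `n`-element set has `n!` enumerations.
theorem sum_tupleFinset_image (n : ℕ) (X : Finset E) (φ : Finset E → ℝ≥0∞) :
    ∑ p ∈ tupleFinset (Fin n) X, φ (Finset.univ.image p) =
      n.factorial * ∑ S ∈ X.powersetCard n, φ S := by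
  have hmaps : ∀ p ∈ tupleFinset (Fin n) X, Finset.univ.image p ∈ X.powersetCard n := by
    intro p hp
    rw [mem_tupleFinset] at hp
    rw [Finset.mem_powersetCard]
    refine ⟨fun y hy => ?_, ?_⟩
    · obtain ⟨i, -, rfl⟩ := Finset.mem_image.1 hy
      exact hp.1 i
    · rw [Finset.card_image_of_injective _ hp.2, Finset.card_univ, Fintype.card_fin]
  rw [← Finset.sum_fiberwise_of_maps_to hmaps, Finset.mul_sum]
  refine Finset.sum_congr rfl fun S hS => ?_
  rw [Finset.mem_powersetCard] at hS
  rw [Finset.sum_congr rfl (g := fun _ => φ S) fun p hp => by rw [(Finset.mem_filter.1 hp).2],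
    Finset.sum_const, nsmul_eq_mul]
  congr 2
  have hcard : Fintype.card (Fin n ↪ S) = n.factorial := by
    rw [Fintype.card_embedding_eq, Fintype.card_coe, hS.2, Fintype.card_fin, Nat.descFactorial_self]
  rw [← hcard, ← Finset.card_univ]
  symm
  refine Finset.card_bij (fun e _ i => (e i : E)) ?_ ?_ ?_
  · intro e _
    have hinj : Function.Injective fun i => (e i : E) :=
      Subtype.val_injective.comp e.injective
    rw [Finset.mem_filter, mem_tupleFinset]
    refine ⟨⟨fun i => hS.1 (e i).2, hinj⟩, ?_⟩
    refine Finset.eq_of_subset_of_card_le (fun y hy => ?_) ?_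
    · obtain ⟨i, -, rfl⟩ := Finset.mem_image.1 hy
      exact (e i).2
    · rw [Finset.card_image_of_injective _ hinj, Finset.card_univ, Fintype.card_fin, hS.2]
  · intro e _ e' _ h
    ext i
    exact congrFun h i
  · intro p hp
    rw [Finset.mem_filter, mem_tupleFinset] at hp
    have hmem : ∀ i, p i ∈ S := fun i => by
      rw [← hp.2]; exact Finset.mem_image_of_mem _ (Finset.mem_univ i)
    exact ⟨⟨fun i => ⟨p i, hmem i⟩, fun i j h => hp.1.2 (congrArg Subtype.val h)⟩,
      Finset.mem_univ _, rfl⟩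

theorem sum_tupleFinset_comp_equiv (e : ι ≃ κ) (X : Finset E) (g : (κ → E) → ℝ≥0∞) :
    ∑ z ∈ tupleFinset κ X, g z = ∑ z ∈ tupleFinset ι X, g (z ∘ e.symm) := by
  refine Finset.sum_nbij' (fun z => z ∘ e) (fun z => z ∘ e.symm) ?_ ?_ ?_ ?_ ?_
  · intro z hz
    rw [mem_tupleFinset] at hz ⊢
    exact ⟨fun i => hz.1 _, hz.2.comp e.injective⟩
  · intro z hz
    rw [mem_tupleFinset] at hz ⊢
    exact ⟨fun i => hz.1 _, hz.2.comp e.symm.injective⟩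
  · intro z _; ext; simp
  · intro z _; ext; simp
  · intro z _; congr 1; ext; simp

open scoped Classical in
-- A tuple on `ι ⊕ κ` is injective exactly when both halves are and their ranges are disjoint.
theorem sum_tupleFinset_sum (X : Finset E) (g : (ι → E) → (κ → E) → ℝ≥0∞) :
    ∑ z ∈ tupleFinset (ι ⊕ κ) X, g (z ∘ Sum.inl) (z ∘ Sum.inr) =
      ∑ x ∈ tupleFinset ι X, ∑ w ∈ tupleFinset κ X,
        if Disjoint (Finset.univ.image x) (Finset.univ.image w) then g x w else 0 := by
  rw [← Finset.sum_product', ← Finset.sum_filter]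
  refine Finset.sum_nbij' (fun z => (z ∘ Sum.inl, z ∘ Sum.inr)) (fun p => Sum.elim p.1 p.2)
    ?_ ?_ ?_ ?_ ?_
  · intro z hz
    rw [mem_tupleFinset] at hz
    rw [Finset.mem_filter, Finset.mem_product, mem_tupleFinset, mem_tupleFinset]
    refine ⟨⟨⟨fun i => hz.1 _, hz.2.comp Sum.inl_injective⟩, fun i => hz.1 _,
      hz.2.comp Sum.inr_injective⟩, ?_⟩
    rw [Finset.disjoint_left]
    intro y hy hy'
    obtain ⟨i, -, rfl⟩ := Finset.mem_image.1 hy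
    obtain ⟨j, -, hj⟩ := Finset.mem_image.1 hy'
    exact Sum.inr_ne_inl (hz.2 hj)
  · rintro ⟨x, w⟩ hp
    rw [Finset.mem_filter, Finset.mem_product, mem_tupleFinset, mem_tupleFinset] at hp
    obtain ⟨⟨hx, hw⟩, hd⟩ := hp
    rw [mem_tupleFinset]
    refine ⟨fun i => ?_, ?_⟩
    · cases i
      · exact hx.1 _
      · exact hw.1 _
    · refine hx.2.sumElim hw.2 fun a b hab => ?_
      exact Finset.disjoint_left.1 hd (Finset.mem_image_of_mem _ (Finset.mem_univ a))
        (hab ▸ Finset.mem_image_of_mem _ (Finset.mem_univ b))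
  · intro z _; ext i; cases i <;> rfl
  · rintro ⟨x, w⟩ _; rfl
  · intro z _; rfl

open scoped Classical in
-- Two injective enumerations of the same set differ by a permutation. This lets symmetric kernels
-- be treated as functions of finite sets, where overlaps are easy to count.
theorem exists_finset_function {n : ℕ} (f : (Fin n → E) → ℝ≥0∞)
    (hf : ∀ (σ : Equiv.Perm (Fin n)) x, f (x ∘ σ) = f x) :
    ∃ F : Finset E → ℝ≥0∞, ∀ x, Function.Injective x → F (Finset.univ.image x) = f x := by
  refine ⟨fun S => if h : ∃ x : Fin n → E, Function.Injective x ∧ Finset.univ.image x = S then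
    f h.choose else 0, fun x hx => ?_⟩
  have hex : ∃ y : Fin n → E, Function.Injective y ∧ Finset.univ.image y = Finset.univ.image x :=
    ⟨x, hx, rfl⟩
  dsimp only
  rw [dif_pos hex]
  obtain ⟨hy, hyx⟩ := hex.choose_spec
  set y := hex.choose
  have hr : Set.range y = Set.range x := by
    have := congrArg (fun S : Finset E => (S : Set E)) hyx
    simpa using this
  let σ : Equiv.Perm (Fin n) :=
    ((Equiv.ofInjective y hy).trans (Equiv.setCongr hr)).trans (Equiv.ofInjective x hx).symm
  have hσ : x ∘ σ = y := by
    ext i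
    simp [σ, Equiv.apply_ofInjective_symm]
  rw [← hσ, hf]

/-- The identification of the indices below `l` and from `l` on. -/
def splitEquiv {n l : ℕ} (hl : l ≤ n) : Fin l ⊕ Fin (n - l) ≃ Fin n :=
  finSumFinEquiv.trans (finCongr (by omega))

theorem splitEquiv_inl {n l : ℕ} (hl : l ≤ n) (i : Fin l) :
    (splitEquiv hl (Sum.inl i) : ℕ) = i := by
  simp [splitEquiv]

theorem splitEquiv_inr {n l : ℕ} (hl : l ≤ n) (i : Fin (n - l)) :
    (splitEquiv hl (Sum.inr i) : ℕ) = l + i := by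
  simp [splitEquiv]

theorem splice_splitEquiv {k l : ℕ} (hl : l ≤ k + 1) (x : Fin (k + 1) → E)
    (w : Fin (k + 1 - l) → E) :
    splice k l x w ∘ splitEquiv hl = Sum.elim (x ∘ splitEquiv hl ∘ Sum.inl) w := by
  ext i
  rcases i with i | i
  · simp [splice, splitEquiv_inl]
  · simp [splice, splitEquiv_inr]

open scoped Classical in
theorem image_univ_sum (x : ι ⊕ κ → E) : Finset.univ.image x =
    Finset.univ.image (x ∘ Sum.inl) ∪ Finset.univ.image (x ∘ Sum.inr) := by
  ext y
  simp

open scoped Classical in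
theorem image_univ_comp_equiv (e : ι ≃ κ) (x : κ → E) :
    Finset.univ.image (x ∘ e) = Finset.univ.image x := by
  ext y
  simp only [Finset.mem_image, Finset.mem_univ, true_and, Function.comp_apply]
  exact e.exists_congr_left.trans (by simp)

open scoped Classical in
-- The bijection is `(S, Q, R) ↦ (S ∪ Q, S ∪ R)`, with inverse `(A, B) ↦ (A ∩ B, A \ B, B \ A)`.
theorem sum_triples_eq_sum_pairs {n l : ℕ} (hl : l ≤ n) (X : Finset E) (F G : Finset E → ℝ≥0∞) :
    ∑ S ∈ X.powersetCard l, ∑ Q ∈ X.powersetCard (n - l), ∑ R ∈ X.powersetCard (n - l),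
      (if Disjoint S Q ∧ Disjoint (S ∪ Q) R then F (S ∪ Q) * G (S ∪ R) else 0) =
    ∑ p ∈ (X.powersetCard n ×ˢ X.powersetCard n).filter (fun p => (p.1 ∩ p.2).card = l),
      F p.1 * G p.2 := by
  simp_rw [← Finset.sum_product']
  rw [← Finset.sum_filter]
  refine Finset.sum_nbij' (fun t => (t.1 ∪ t.2.1, t.1 ∪ t.2.2))
    (fun p => (p.1 ∩ p.2, p.1 \ p.2, p.2 \ p.1)) ?_ ?_ ?_ ?_ ?_
  · rintro ⟨S, Q, R⟩ h
    simp only [Finset.mem_filter, Finset.mem_product, Finset.mem_powersetCard,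
      Finset.disjoint_union_left] at h ⊢
    obtain ⟨⟨⟨hS, hSc⟩, ⟨hQ, hQc⟩, hR, hRc⟩, h1, h2, h3⟩ := h
    have hi : (S ∪ Q) ∩ (S ∪ R) = S := by
      rw [← Finset.union_inter_distrib_left, Finset.disjoint_iff_inter_eq_empty.1 h3,
        Finset.union_empty]
    refine ⟨⟨⟨Finset.union_subset hS hQ, ?_⟩, Finset.union_subset hS hR, ?_⟩, by rw [hi, hSc]⟩
    · rw [Finset.card_union_of_disjoint h1]; omega
    · rw [Finset.card_union_of_disjoint h2]; omega
  · rintro ⟨A, B⟩ h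
    simp only [Finset.mem_filter, Finset.mem_product, Finset.mem_powersetCard] at h ⊢
    obtain ⟨⟨⟨hA, hAc⟩, hB, hBc⟩, hl'⟩ := h
    have h1 := Finset.card_inter_add_card_sdiff A B
    have h2 := Finset.card_inter_add_card_sdiff B A
    rw [Finset.inter_comm] at h2
    refine ⟨⟨⟨Finset.inter_subset_left.trans hA, hl'⟩,
      ⟨Finset.sdiff_subset.trans hA, by omega⟩, Finset.sdiff_subset.trans hB, by omega⟩, ?_, ?_⟩
    · rw [Finset.disjoint_left]; intro y hy hy'; simp_all
    · rw [Finset.disjoint_left]; intro y hy hy'; simp_all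
  · rintro ⟨S, Q, R⟩ h
    simp only [Finset.mem_filter, Finset.disjoint_union_left] at h
    obtain ⟨_, h1, h2, h3⟩ := h
    rw [Finset.disjoint_left] at h1 h2 h3
    ext y <;> simp <;> grind
  · rintro ⟨A, B⟩ h
    ext y <;> simp <;> grind
  · rintro ⟨S, Q, R⟩ _; rfl

open scoped Classical in
-- The constant counts the orderings of the common part (`l!`) and of the two remainders (`(k + 1 -
-- l)!` each).
theorem sum_tupleFinset_splice {k l : ℕ} (hl : l ≤ k + 1) (X : Finset E)
    {f g : (Fin (k + 1) → E) → ℝ≥0∞} {F G : Finset E → ℝ≥0∞}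
    (hF : ∀ x, Function.Injective x → F (Finset.univ.image x) = f x)
    (hG : ∀ x, Function.Injective x → G (Finset.univ.image x) = g x) :
    ∑ z ∈ tupleFinset (Fin (k + 1) ⊕ Fin (k + 1 - l)) X,
      f (z ∘ Sum.inl) * g (splice k l (z ∘ Sum.inl) (z ∘ Sum.inr)) =
    (l.factorial * (k + 1 - l).factorial ^ 2 : ℝ≥0∞) *
      ∑ p ∈ (X.powersetCard (k + 1) ×ˢ X.powersetCard (k + 1)).filter
        (fun p => (p.1 ∩ p.2).card = l), F p.1 * G p.2 := by
  let j := k + 1 - l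
  let σ := splitEquiv hl
  -- Splitting `Fin (k + 1)` at `l` makes the common arguments a block of their own; the three
  -- blocks then become the sets `S`, `Q`, `R`.
  rw [sum_tupleFinset_comp_equiv (Equiv.sumCongr σ (Equiv.refl (Fin j)))]
  have h1 : ∀ z ∈ tupleFinset ((Fin l ⊕ Fin j) ⊕ Fin j) X,
      f ((z ∘ (Equiv.sumCongr σ (Equiv.refl (Fin j))).symm) ∘ Sum.inl) *
        g (splice k l ((z ∘ (Equiv.sumCongr σ (Equiv.refl (Fin j))).symm) ∘ Sum.inl)
          ((z ∘ (Equiv.sumCongr σ (Equiv.refl (Fin j))).symm) ∘ Sum.inr)) =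
      F (Finset.univ.image ((z ∘ Sum.inl) ∘ Sum.inl) ∪ Finset.univ.image ((z ∘ Sum.inl) ∘ Sum.inr))
        * G (Finset.univ.image ((z ∘ Sum.inl) ∘ Sum.inl) ∪ Finset.univ.image (z ∘ Sum.inr)) := by
    intro z hz
    rw [mem_tupleFinset] at hz
    have e1 : (z ∘ (Equiv.sumCongr σ (Equiv.refl (Fin j))).symm) ∘ Sum.inl =
        (z ∘ Sum.inl) ∘ σ.symm := by ext; simp
    have e2 : (z ∘ (Equiv.sumCongr σ (Equiv.refl (Fin j))).symm) ∘ Sum.inr = z ∘ Sum.inr := by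
      ext; simp
    rw [e1, e2]
    have e3 : splice k l ((z ∘ Sum.inl) ∘ σ.symm) (z ∘ Sum.inr) =
        Sum.elim ((z ∘ Sum.inl) ∘ Sum.inl) (z ∘ Sum.inr) ∘ σ.symm := by
      rw [Equiv.eq_comp_symm, splice_splitEquiv hl]
      congr 1
      ext i
      simp [σ]
    rw [e3, ← hF, ← hG, image_univ_comp_equiv, image_univ_comp_equiv, image_univ_sum,
      image_univ_sum (Sum.elim _ _)]
    · rfl
    · refine Function.Injective.comp ?_ σ.symm.injective
      refine ((hz.2.comp Sum.inl_injective).comp Sum.inl_injective).sumElim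
        (hz.2.comp Sum.inr_injective) fun a b h => ?_
      exact Sum.inl_ne_inr (hz.2 h)
    · exact (hz.2.comp Sum.inl_injective).comp σ.symm.injective
  rw [Finset.sum_congr rfl h1]
  rw [sum_tupleFinset_sum X (fun (x : Fin l ⊕ Fin j → E) (w : Fin j → E) =>
      F (Finset.univ.image (x ∘ Sum.inl) ∪ Finset.univ.image (x ∘ Sum.inr))
        * G (Finset.univ.image (x ∘ Sum.inl) ∪ Finset.univ.image w))]
  simp_rw [image_univ_sum]
  rw [sum_tupleFinset_sum X (fun (p : Fin l → E) (q : Fin j → E) =>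
      ∑ r ∈ tupleFinset (Fin j) X,
      if Disjoint (Finset.univ.image p ∪ Finset.univ.image q) (Finset.univ.image r) then
      F (Finset.univ.image p ∪ Finset.univ.image q)
        * G (Finset.univ.image p ∪ Finset.univ.image r) else 0)]
  have h2 : ∀ S Q : Finset E, (∑ r ∈ tupleFinset (Fin j) X,
      if Disjoint (S ∪ Q) (Finset.univ.image r) then
        F (S ∪ Q) * G (S ∪ Finset.univ.image r) else 0) =
      j.factorial * ∑ R ∈ X.powersetCard j, if Disjoint (S ∪ Q) R then
        F (S ∪ Q) * G (S ∪ R) else 0 := fun S Q =>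
    sum_tupleFinset_image j X fun R => if Disjoint (S ∪ Q) R then F (S ∪ Q) * G (S ∪ R) else 0
  simp_rw [h2]
  have h3 : ∀ S : Finset E, (∑ q ∈ tupleFinset (Fin j) X,
      if Disjoint S (Finset.univ.image q) then
        j.factorial * ∑ R ∈ X.powersetCard j, (if Disjoint (S ∪ Finset.univ.image q) R then
        F (S ∪ Finset.univ.image q) * G (S ∪ R) else 0) else 0) =
      j.factorial * ∑ Q ∈ X.powersetCard j, if Disjoint S Q then
        j.factorial * ∑ R ∈ X.powersetCard j, (if Disjoint (S ∪ Q) R then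
        F (S ∪ Q) * G (S ∪ R) else 0) else 0 := fun S =>
    sum_tupleFinset_image j X fun Q => if Disjoint S Q then
        j.factorial * ∑ R ∈ X.powersetCard j, (if Disjoint (S ∪ Q) R then
        F (S ∪ Q) * G (S ∪ R) else 0) else 0
  simp_rw [h3]
  rw [sum_tupleFinset_image l X fun S => j.factorial * ∑ Q ∈ X.powersetCard j, if Disjoint S Q then
        j.factorial * ∑ R ∈ X.powersetCard j, (if Disjoint (S ∪ Q) R then
        F (S ∪ Q) * G (S ∪ R) else 0) else 0]
  rw [← sum_triples_eq_sum_pairs hl, mul_assoc]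
  congr 1
  rw [Finset.mul_sum]
  refine Finset.sum_congr rfl fun S _ => ?_
  rw [pow_two, mul_assoc]
  congr 1
  rw [Finset.mul_sum]
  refine Finset.sum_congr rfl fun Q _ => ?_
  by_cases hd : Disjoint S Q
  · simp [hd, j]
  · simp [hd]

/-- The product of two `U`-statistics, expanded according to the number of common points. -/
theorem sum_tupleFinset_mul_sum_tupleFinset {k : ℕ} (X : Finset E)
    {f g : (Fin (k + 1) → E) → ℝ≥0∞}
    (hf : ∀ (σ : Equiv.Perm (Fin (k + 1))) x, f (x ∘ σ) = f x)
    (hg : ∀ (σ : Equiv.Perm (Fin (k + 1))) x, g (x ∘ σ) = g x) :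
    (((k + 1).factorial : ℝ≥0∞)⁻¹ * ∑ x ∈ tupleFinset (Fin (k + 1)) X, f x) *
      (((k + 1).factorial : ℝ≥0∞)⁻¹ * ∑ x ∈ tupleFinset (Fin (k + 1)) X, g x) =
    ∑ l ∈ Finset.range (k + 2), ((l.factorial * (k + 1 - l).factorial ^ 2 : ℝ≥0∞))⁻¹ *
      ∑ z ∈ tupleFinset (Fin (k + 1) ⊕ Fin (k + 1 - l)) X,
        f (z ∘ Sum.inl) * g (splice k l (z ∘ Sum.inl) (z ∘ Sum.inr)) := by
  classical
  obtain ⟨F, hF⟩ := exists_finset_function f hf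
  obtain ⟨G, hG⟩ := exists_finset_function g hg
  have h0 : ∀ n : ℕ, (n.factorial : ℝ≥0∞) ≠ 0 := fun n => by
    exact_mod_cast n.factorial_ne_zero
  have hfin : ∀ n : ℕ, (n.factorial : ℝ≥0∞) ≠ ∞ := fun n => ENNReal.natCast_ne_top _
  have hsum : ∀ (f : (Fin (k + 1) → E) → ℝ≥0∞) (F : Finset E → ℝ≥0∞)
      (_ : ∀ x, Function.Injective x → F (Finset.univ.image x) = f x),
      ((k + 1).factorial : ℝ≥0∞)⁻¹ * ∑ x ∈ tupleFinset (Fin (k + 1)) X, f x =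
      ∑ S ∈ X.powersetCard (k + 1), F S := by
    intro f F hF
    rw [Finset.sum_congr rfl fun x hx => (hF x (mem_tupleFinset.1 hx).2).symm,
      sum_tupleFinset_image, ← mul_assoc, ENNReal.inv_mul_cancel (h0 _) (hfin _), one_mul]
  rw [hsum f F hF, hsum g G hG, Finset.sum_mul_sum, ← Finset.sum_product']
  -- Pairs of `(k + 1)`-sets are classified by the size of their intersection, which lies between
  -- `0` and `k + 1`.
  rw [← Finset.sum_fiberwise_of_maps_to (t := Finset.range (k + 2))
    (g := fun p : Finset E × Finset E => (p.1 ∩ p.2).card)]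
  · refine Finset.sum_congr rfl fun l hl => ?_
    rw [Finset.mem_range] at hl
    rw [sum_tupleFinset_splice (by omega) X hF hG, ← mul_assoc, ENNReal.inv_mul_cancel, one_mul]
    · exact mul_ne_zero (h0 _) (pow_ne_zero _ (h0 _))
    · exact ENNReal.mul_ne_top (hfin _) (ENNReal.pow_ne_top (hfin _))
  · rintro ⟨A, B⟩ h
    rw [Finset.mem_product, Finset.mem_powersetCard] at h
    rw [Finset.mem_range]
    have := Finset.card_le_card (Finset.inter_subset_left (s₁ := A) (s₂ := B))
    dsimp only at *
    omega

end Tuples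

/-! ### Means and covariances of Poisson `U`-statistics. -/

section UStatistics

variable {m k : ℕ}

/-- A nonnegative kernel, restricted to the tuples of points of `B`. -/
noncomputable def restrictedKernel (h : (Fin (k + 1) → ESpace m) → ℝ) (B : Set (ESpace m)) :
    (Fin (k + 1) → ESpace m) → ℝ≥0∞ :=
  (Set.univ.pi fun _ => B).indicator fun x => ENNReal.ofReal (h x)

theorem measurable_restrictedKernel {h : (Fin (k + 1) → ESpace m) → ℝ} (hm : Measurable h)
    {B : Set (ESpace m)} (hB : MeasurableSet B) : Measurable (restrictedKernel h B) :=
  hm.ennreal_ofReal.indicator (MeasurableSet.univ_pi fun _ => hB)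

theorem restrictedKernel_comp_perm {h : (Fin (k + 1) → ESpace m) → ℝ}
    (hs : ∀ (σ : Equiv.Perm (Fin (k + 1))) x, h (x ∘ σ) = h x) (B : Set (ESpace m))
    (σ : Equiv.Perm (Fin (k + 1))) (x : Fin (k + 1) → ESpace m) :
    restrictedKernel h B (x ∘ σ) = restrictedKernel h B x := by
  classical
  have : x ∘ σ ∈ (Set.univ.pi fun _ => B) ↔ x ∈ (Set.univ.pi fun _ => B) := by
    simp only [Set.mem_pi, Set.mem_univ, true_imp_iff, Function.comp_apply]
    exact σ.forall_congr_left.trans (by simp)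
  simp only [restrictedKernel, Set.indicator_apply, this, hs]

theorem restrictedKernel_le {h : (Fin (k + 1) → ESpace m) → ℝ} {M : ℝ} (hM : ∀ x, h x ≤ M)
    (B : Set (ESpace m)) (x : Fin (k + 1) → ESpace m) :
    restrictedKernel h B x ≤ ENNReal.ofReal M :=
  (Set.indicator_le_self _ _ x).trans (ENNReal.ofReal_le_ofReal (hM x))

/-- The `U`-statistic of a restricted kernel, with values in `[0, ∞]`. -/
noncomputable def eUStat (f : (Fin (k + 1) → ESpace m) → ℝ≥0∞) (X : Set (ESpace m)) : ℝ≥0∞ :=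
  ((k + 1).factorial : ℝ≥0∞)⁻¹ * ∫⁻ x, f x ∂(tupleMeasure (Fin (k + 1)) X)

/-- The restriction to `B` moves from the point set into the kernel, so that one process serves all
halfspaces at once. -/
theorem uStat_inter_eq {h : (Fin (k + 1) → ESpace m) → ℝ} (hm : Measurable h) (h0 : ∀ x, 0 ≤ h x)
    {B : Set (ESpace m)} (hB : MeasurableSet B) {X : Set (ESpace m)} (hX : X.Finite) :
    uStat k h (X ∩ B) = (eUStat (restrictedKernel h B) X).toReal := by
  classical
  rw [eUStat, lintegral_tupleMeasure measurableSet_distinctTuples hX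
    (measurable_restrictedKernel hm hB), ENNReal.toReal_mul, ENNReal.toReal_inv,
    ENNReal.toReal_natCast, ENNReal.toReal_sum, uStat, one_div]
  swap
  · intro x _
    exact ((Set.indicator_le_self _ _ x).trans_lt ENNReal.ofReal_lt_top).ne
  congr 1
  let T := (tupleFinset (Fin (k + 1)) hX.toFinset).filter fun x => ∀ i, x i ∈ B
  have hT : ∀ x, x ∈ T ↔ Function.Injective x ∧ ∀ i, x i ∈ X ∩ B := by
    intro x
    simp only [T, Finset.mem_filter, mem_tupleFinset, Set.Finite.mem_toFinset, Set.mem_inter_iff,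
      forall_and]
    tauto
  have h1 : ∑' x : {x : Fin (k + 1) → ESpace m // Function.Injective x ∧ ∀ i, x i ∈ X ∩ B}, h x =
      ∑ x ∈ T, h x := by
    rw [← Finset.tsum_subtype T h]
    exact (Equiv.subtypeEquivRight hT).tsum_eq (fun x : {x // Function.Injective x ∧
      ∀ i, x i ∈ X ∩ B} => h x) |>.symm
  rw [h1, Finset.sum_filter]
  refine Finset.sum_congr rfl fun x _ => ?_
  by_cases hx : ∀ i, x i ∈ B
  · rw [if_pos hx, restrictedKernel, Set.indicator_of_mem (show x ∈ Set.univ.pi fun _ => B from fun i _ => hx i),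
      ENNReal.toReal_ofReal (h0 x)]
  · rw [if_neg hx, restrictedKernel, Set.indicator_of_notMem, ENNReal.toReal_zero]
    exact fun h => hx fun i => h i trivial

theorem measurable_splice (l : ℕ) {V : Type*} [MeasurableSpace V] :
    Measurable fun p : (Fin (k + 1) → V) × (Fin (k + 1 - l) → V) => splice k l p.1 p.2 := by
  refine measurable_pi_lambda _ fun i => ?_
  unfold splice
  split_ifs <;> fun_prop

theorem measurable_pairKernel {f g : (Fin (k + 1) → ESpace m) → ℝ≥0∞} (hf : Measurable f)
    (hg : Measurable g) (l : ℕ) :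
    Measurable fun z : Fin (k + 1) ⊕ Fin (k + 1 - l) → ESpace m =>
      f (z ∘ Sum.inl) * g (splice k l (z ∘ Sum.inl) (z ∘ Sum.inr)) := by
  have h1 : Measurable fun z : Fin (k + 1) ⊕ Fin (k + 1 - l) → ESpace m => z ∘ Sum.inl :=
    measurable_pi_lambda _ fun i => measurable_pi_apply _
  have h2 : Measurable fun z : Fin (k + 1) ⊕ Fin (k + 1 - l) → ESpace m => z ∘ Sum.inr :=
    measurable_pi_lambda _ fun i => measurable_pi_apply _
  exact (hf.comp h1).mul (hg.comp ((measurable_splice l).comp (h1.prodMk h2)))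

/-- The integral of the product of two kernels with `l` common arguments. -/
noncomputable def pairIntegral (μ : Measure (ESpace m)) (f g : (Fin (k + 1) → ESpace m) → ℝ≥0∞)
    (l : ℕ) : ℝ≥0∞ :=
  ∫⁻ z : Fin (k + 1) ⊕ Fin (k + 1 - l) → ESpace m,
    f (z ∘ Sum.inl) * g (splice k l (z ∘ Sum.inl) (z ∘ Sum.inr)) ∂(Measure.pi fun _ => μ)

/-- With no common argument, splicing returns the second tuple alone and the integral factorizes.
This is the term that cancels against the product of the means. -/
theorem pairIntegral_zero (μ : Measure (ESpace m)) [IsFiniteMeasure μ]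
    {f g : (Fin (k + 1) → ESpace m) → ℝ≥0∞} (hf : Measurable f) (hg : Measurable g) :
    pairIntegral μ f g 0 = (∫⁻ x, f x ∂(Measure.pi fun _ => μ)) *
      ∫⁻ x, g x ∂(Measure.pi fun _ => μ) := by
  have hmp := measurePreserving_sumPiEquivProdPi (ι := Fin (k + 1)) (ι' := Fin (k + 1 - 0))
    (fun _ => μ)
  have h0 : ∀ u w : Fin (k + 1) → ESpace m, splice k 0 u w = w := by
    intro u w
    ext i
    simp [splice]
  rw [pairIntegral, ← lintegral_prod_mul hf.aemeasurable hg.aemeasurable]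
  refine Eq.trans (lintegral_congr fun z => ?_) (hmp.lintegral_comp_emb
    (MeasurableEquiv.measurableEmbedding _) fun p => f p.1 * g p.2)
  rw [h0]
  rfl

theorem pairIntegral_ne_top (μ : Measure (ESpace m)) [IsFiniteMeasure μ]
    {f g : (Fin (k + 1) → ESpace m) → ℝ≥0∞} {a b : ℝ≥0∞} (ha : a ≠ ∞) (hb : b ≠ ∞)
    (hf : ∀ x, f x ≤ a) (hg : ∀ x, g x ≤ b) (l : ℕ) : pairIntegral μ f g l ≠ ∞ := by
  refine ((lintegral_mono fun z => mul_le_mul' (hf _) (hg _)).trans_lt ?_).ne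
  rw [lintegral_const]
  exact ENNReal.mul_lt_top (ENNReal.mul_lt_top ha.lt_top hb.lt_top) (measure_lt_top _ _)

variable {Ω : Type*} [MeasurableSpace Ω] {P : Measure Ω} {N : Ω → Set (ESpace m)}
  {μ : Measure (ESpace m)} [IsFiniteMeasure μ] [NullSingletonClass μ]

omit [IsFiniteMeasure μ] [NullSingletonClass μ] in
theorem IsPoissonProcess.measurable_eUStat (hN : IsPoissonProcess μ P N)
    {f : (Fin (k + 1) → ESpace m) → ℝ≥0∞} (hf : Measurable f) :
    Measurable fun ω => eUStat f (N ω) :=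
  ((Measure.measurable_lintegral hf).comp
    (hN.measurable_tupleMeasure measurableSet_distinctTuples)).const_mul _

theorem IsPoissonProcess.lintegral_eUStat (hN : IsPoissonProcess μ P N)
    {f : (Fin (k + 1) → ESpace m) → ℝ≥0∞} (hf : Measurable f) :
    ∫⁻ ω, eUStat f (N ω) ∂P =
      ((k + 1).factorial : ℝ≥0∞)⁻¹ * ∫⁻ x, f x ∂(Measure.pi fun _ => μ) := by
  simp_rw [eUStat]
  rw [lintegral_const_mul' _ _ (ENNReal.inv_ne_top.2 (by exact_mod_cast (Nat.factorial_ne_zero _))),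
    hN.lintegral_lintegral_tupleMeasure hf]

/-- The overlap expansion holds for each finite realization; Mecke's formula is then applied to
every overlap term. -/
theorem IsPoissonProcess.lintegral_eUStat_mul (hN : IsPoissonProcess μ P N)
    {f g : (Fin (k + 1) → ESpace m) → ℝ≥0∞} (hf : Measurable f) (hg : Measurable g)
    (hfs : ∀ (σ : Equiv.Perm (Fin (k + 1))) x, f (x ∘ σ) = f x)
    (hgs : ∀ (σ : Equiv.Perm (Fin (k + 1))) x, g (x ∘ σ) = g x) :
    ∫⁻ ω, eUStat f (N ω) * eUStat g (N ω) ∂P =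
      ∑ l ∈ Finset.range (k + 2), ((l.factorial * (k + 1 - l).factorial ^ 2 : ℝ≥0∞))⁻¹ *
        pairIntegral μ f g l := by
  have hpath : (fun ω => eUStat f (N ω) * eUStat g (N ω)) =ᵐ[P] fun ω =>
      ∑ l ∈ Finset.range (k + 2), ((l.factorial * (k + 1 - l).factorial ^ 2 : ℝ≥0∞))⁻¹ *
        ∫⁻ z, f (z ∘ Sum.inl) * g (splice k l (z ∘ Sum.inl) (z ∘ Sum.inr))
          ∂(tupleMeasure (Fin (k + 1) ⊕ Fin (k + 1 - l)) (N ω)) := by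
    filter_upwards [hN.ae_finite] with ω hω
    simp_rw [eUStat, lintegral_tupleMeasure measurableSet_distinctTuples hω hf,
      lintegral_tupleMeasure measurableSet_distinctTuples hω hg,
      lintegral_tupleMeasure measurableSet_distinctTuples hω (measurable_pairKernel hf hg _)]
    exact sum_tupleFinset_mul_sum_tupleFinset _ hfs hgs
  rw [lintegral_congr_ae hpath, lintegral_finsetSum]
  · refine Finset.sum_congr rfl fun l _ => ?_
    rw [lintegral_const_mul, hN.lintegral_lintegral_tupleMeasure (measurable_pairKernel hf hg _),
      pairIntegral]
    exact (Measure.measurable_lintegral (measurable_pairKernel hf hg _)).comp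
      (hN.measurable_tupleMeasure measurableSet_distinctTuples)
  · intro l _
    exact ((Measure.measurable_lintegral (measurable_pairKernel hf hg _)).comp
      (hN.measurable_tupleMeasure measurableSet_distinctTuples)).const_mul _

/-- The real constant in front of the integral with `l` common arguments. -/
noncomputable def overlapConst (k l : ℕ) : ℝ :=
  1 / ((l.factorial : ℝ) * ((k + 1 - l).factorial : ℝ) ^ 2)

theorem overlapConst_eq_toReal (k l : ℕ) : overlapConst k l =
    ((l.factorial * (k + 1 - l).factorial ^ 2 : ℝ≥0∞)⁻¹).toReal := by
  simp [overlapConst, mul_comm]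

theorem ennreal_overlapConst_ne_top (k l : ℕ) :
    ((l.factorial * (k + 1 - l).factorial ^ 2 : ℝ≥0∞))⁻¹ ≠ ∞ := by
  rw [ENNReal.inv_ne_top]
  have : ∀ n : ℕ, (n.factorial : ℝ≥0∞) ≠ 0 := fun n => by exact_mod_cast n.factorial_ne_zero
  exact mul_ne_zero (this _) (pow_ne_zero _ (this _))

/-- Bounded, symmetric, nonnegative, measurable kernels. -/
structure IsBoundedKernel (h : (Fin (k + 1) → ESpace m) → ℝ) (M : ℝ) : Prop where
  measurable : Measurable h
  nonneg : ∀ x, 0 ≤ h x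
  symmetric : ∀ (σ : Equiv.Perm (Fin (k + 1))) (x), h (x ∘ σ) = h x
  le : ∀ x, h x ≤ M

variable {h : (Fin (k + 1) → ESpace m) → ℝ} {M : ℝ} {B B₁ B₂ : Set (ESpace m)}

theorem IsPoissonProcess.lintegral_eUStat_mul_restrictedKernel (hN : IsPoissonProcess μ P N)
    (hh : IsBoundedKernel h M) (hB₁ : MeasurableSet B₁) (hB₂ : MeasurableSet B₂) :
    ∫⁻ ω, eUStat (restrictedKernel h B₁) (N ω) * eUStat (restrictedKernel h B₂) (N ω) ∂P =
      ∑ l ∈ Finset.range (k + 2), ((l.factorial * (k + 1 - l).factorial ^ 2 : ℝ≥0∞))⁻¹ *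
        pairIntegral μ (restrictedKernel h B₁) (restrictedKernel h B₂) l :=
  hN.lintegral_eUStat_mul (measurable_restrictedKernel hh.measurable hB₁)
    (measurable_restrictedKernel hh.measurable hB₂) (restrictedKernel_comp_perm hh.symmetric _)
    (restrictedKernel_comp_perm hh.symmetric _)

omit [NullSingletonClass μ] in
theorem pairIntegral_restrictedKernel_ne_top (hM : ∀ x, h x ≤ M) (l : ℕ) :
    pairIntegral μ (restrictedKernel h B₁) (restrictedKernel h B₂) l ≠ ∞ :=
  pairIntegral_ne_top μ ENNReal.ofReal_ne_top ENNReal.ofReal_ne_top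
    (restrictedKernel_le hM _) (restrictedKernel_le hM _) l

theorem IsPoissonProcess.lintegral_eUStat_mul_ne_top (hN : IsPoissonProcess μ P N)
    (hh : IsBoundedKernel h M) (hB₁ : MeasurableSet B₁) (hB₂ : MeasurableSet B₂) :
    ∫⁻ ω, eUStat (restrictedKernel h B₁) (N ω) * eUStat (restrictedKernel h B₂) (N ω) ∂P ≠ ∞ := by
  rw [hN.lintegral_eUStat_mul_restrictedKernel hh hB₁ hB₂]
  exact ENNReal.sum_ne_top.2 fun l _ => ENNReal.mul_ne_top (ennreal_overlapConst_ne_top k l)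
    (pairIntegral_restrictedKernel_ne_top hh.le l)

omit [NullSingletonClass μ] in
theorem IsPoissonProcess.uStat_ae_eq (hN : IsPoissonProcess μ P N) (hh : IsBoundedKernel h M)
    (hB : MeasurableSet B) :
    (fun ω => uStat k h (N ω ∩ B)) =ᵐ[P]
      fun ω => (eUStat (restrictedKernel h B) (N ω)).toReal := by
  filter_upwards [hN.ae_finite] with ω hω
  exact uStat_inter_eq hh.measurable hh.nonneg hB hω

/-- `U`-statistics of bounded kernels on Poisson processes are square integrable. -/
theorem IsPoissonProcess.memLp_uStat (hN : IsPoissonProcess μ P N) (hh : IsBoundedKernel h M)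
    (hB : MeasurableSet B) : MemLp (fun ω => uStat k h (N ω ∩ B)) 2 P := by
  have hmeas := hN.measurable_eUStat (measurable_restrictedKernel hh.measurable hB)
  refine MemLp.ae_eq (hN.uStat_ae_eq hh hB).symm ?_
  refine ⟨hmeas.ennreal_toReal.aestronglyMeasurable, ?_⟩
  rw [eLpNorm_lt_top_iff_lintegral_rpow_enorm_lt_top (by norm_num) (by norm_num)]
  refine (lintegral_mono fun ω => ?_).trans_lt
    (hN.lintegral_eUStat_mul_ne_top hh hB hB).lt_top
  have : ‖(eUStat (restrictedKernel h B) (N ω)).toReal‖ₑ ≤ eUStat (restrictedKernel h B) (N ω) := by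
    rw [Real.enorm_of_nonneg ENNReal.toReal_nonneg]
    exact ENNReal.ofReal_toReal_le
  calc _ ≤ (eUStat (restrictedKernel h B) (N ω)) ^ (2 : ℝ≥0∞).toReal := by gcongr
    _ = _ := by rw [ENNReal.toReal_ofNat, ENNReal.rpow_ofNat, pow_two]

theorem IsPoissonProcess.integral_uStat' (hN : IsPoissonProcess μ P N) (hh : IsBoundedKernel h M)
    (hB : MeasurableSet B) :
    ∫ ω, uStat k h (N ω ∩ B) ∂P = (((k + 1).factorial : ℝ≥0∞)⁻¹ *
      ∫⁻ x, restrictedKernel h B x ∂(Measure.pi fun _ => μ)).toReal := by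
  have hmeas := measurable_restrictedKernel hh.measurable hB
  rw [integral_congr_ae (hN.uStat_ae_eq hh hB), integral_toReal
    (hN.measurable_eUStat hmeas).aemeasurable, hN.lintegral_eUStat hmeas]
  refine ae_lt_top (hN.measurable_eUStat hmeas) ?_
  rw [hN.lintegral_eUStat hmeas]
  refine ENNReal.mul_ne_top (ENNReal.inv_ne_top.2 (by exact_mod_cast Nat.factorial_ne_zero _)) ?_
  refine ((lintegral_mono fun x => restrictedKernel_le hh.le B x).trans_lt ?_).ne
  rw [lintegral_const]
  exact ENNReal.mul_lt_top ENNReal.ofReal_lt_top (measure_lt_top _ _)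

/-- The mean of a `U`-statistic of a Poisson process. -/
theorem IsPoissonProcess.integral_uStat (hN : IsPoissonProcess μ P N) (hh : IsBoundedKernel h M)
    (hB : MeasurableSet B) :
    ∫ ω, uStat k h (N ω ∩ B) ∂P =
      1 / ((k + 1).factorial : ℝ) * ∫ x, h x ∂(Measure.pi fun _ => μ.restrict B) := by
  rw [hN.integral_uStat' hh hB, ENNReal.toReal_mul, ENNReal.toReal_inv, ENNReal.toReal_natCast,
    one_div, integral_eq_lintegral_of_nonneg_ae (Eventually.of_forall hh.nonneg)
    hh.measurable.aestronglyMeasurable, ← Measure.restrict_pi_pi,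
    ← lintegral_indicator (MeasurableSet.univ_pi fun _ => hB)]
  rfl

/-- The covariance of two `U`-statistics of a Poisson process. -/
theorem IsPoissonProcess.covariance_uStat [IsProbabilityMeasure P] (hN : IsPoissonProcess μ P N)
    (hh : IsBoundedKernel h M) (hB₁ : MeasurableSet B₁) (hB₂ : MeasurableSet B₂) :
    covariance (fun ω => uStat k h (N ω ∩ B₁)) (fun ω => uStat k h (N ω ∩ B₂)) P =
      ∑ l ∈ Finset.Icc 1 (k + 1), overlapConst k l *
        (pairIntegral μ (restrictedKernel h B₁) (restrictedKernel h B₂) l).toReal := by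
  have hm₁ := measurable_restrictedKernel hh.measurable hB₁
  have hm₂ := measurable_restrictedKernel hh.measurable hB₂
  have hU₁ := hN.measurable_eUStat hm₁
  have hU₂ := hN.measurable_eUStat hm₂
  rw [covariance_eq_sub (hN.memLp_uStat hh hB₁) (hN.memLp_uStat hh hB₂)]
  have hprod : ∫ ω, ((fun ω => uStat k h (N ω ∩ B₁)) * fun ω => uStat k h (N ω ∩ B₂)) ω ∂P =
      (∫⁻ ω, eUStat (restrictedKernel h B₁) (N ω) *
        eUStat (restrictedKernel h B₂) (N ω) ∂P).toReal := by
    have hU : Measurable fun ω => eUStat (restrictedKernel h B₁) (N ω) *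
        eUStat (restrictedKernel h B₂) (N ω) := hU₁.mul hU₂
    rw [← integral_toReal hU.aemeasurable (ae_lt_top hU
      (hN.lintegral_eUStat_mul_ne_top hh hB₁ hB₂))]
    refine integral_congr_ae ?_
    filter_upwards [hN.uStat_ae_eq hh hB₁, hN.uStat_ae_eq hh hB₂] with ω h1 h2
    simp only [Pi.mul_apply, ENNReal.toReal_mul] at h1 h2 ⊢
    rw [h1, h2]
  rw [hprod, hN.lintegral_eUStat_mul_restrictedKernel hh hB₁ hB₂,
    ENNReal.toReal_sum fun l _ => ENNReal.mul_ne_top (ennreal_overlapConst_ne_top k l)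
    (pairIntegral_restrictedKernel_ne_top hh.le l), hN.integral_uStat' hh hB₁,
    hN.integral_uStat' hh hB₂]
  simp_rw [ENNReal.toReal_mul, ← overlapConst_eq_toReal]
  -- The term `l = 0` is the product of the two means and drops out of the covariance.
  have hr : Finset.range (k + 2) = insert 0 (Finset.Icc 1 (k + 1)) := by
    ext; simp; omega
  rw [hr, Finset.sum_insert (by simp), pairIntegral_zero μ hm₁ hm₂, ENNReal.toReal_mul]
  simp only [overlapConst, Nat.factorial_zero, Nat.cast_one, one_mul, tsub_zero,
    ENNReal.toReal_inv, ENNReal.toReal_natCast]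
  ring

omit [NullSingletonClass μ] in
-- The two argument tuples together use all `2k + 2 - l` variables, so both lie in `B` exactly when
-- every variable does; the indicators become a restriction of the measure.
theorem toReal_pairIntegral_self (hh : IsBoundedKernel h M) (hB : MeasurableSet B) {l : ℕ}
    (hl : l ≤ k + 1) :
    (pairIntegral μ (restrictedKernel h B) (restrictedKernel h B) l).toReal =
      ∫ z : Fin (k + 1) ⊕ Fin (k + 1 - l) → ESpace m,
        h (z ∘ Sum.inl) * h (splice k l (z ∘ Sum.inl) (z ∘ Sum.inr))
          ∂(Measure.pi fun _ => μ.restrict B) := by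
  classical
  have hm : Measurable fun z : Fin (k + 1) ⊕ Fin (k + 1 - l) → ESpace m =>
      h (z ∘ Sum.inl) * h (splice k l (z ∘ Sum.inl) (z ∘ Sum.inr)) := by
    have h1 : Measurable fun z : Fin (k + 1) ⊕ Fin (k + 1 - l) → ESpace m => z ∘ Sum.inl :=
      measurable_pi_lambda _ fun i => measurable_pi_apply _
    have h2 : Measurable fun z : Fin (k + 1) ⊕ Fin (k + 1 - l) → ESpace m => z ∘ Sum.inr :=
      measurable_pi_lambda _ fun i => measurable_pi_apply _
    exact (hh.measurable.comp h1).mul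
      (hh.measurable.comp ((measurable_splice l).comp (h1.prodMk h2)))
  rw [integral_eq_lintegral_of_nonneg_ae
    (Eventually.of_forall fun z => mul_nonneg (hh.nonneg _) (hh.nonneg _))
    hm.aestronglyMeasurable, ← Measure.restrict_pi_pi,
    ← lintegral_indicator (MeasurableSet.univ_pi fun _ => hB), pairIntegral]
  congr 1
  refine lintegral_congr fun z => ?_
  by_cases hz : z ∈ Set.univ.pi fun _ => B
  · rw [Set.indicator_of_mem hz, restrictedKernel, Set.indicator_of_mem, Set.indicator_of_mem,
      ENNReal.ofReal_mul (hh.nonneg _)]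
    · intro i _
      unfold splice
      split_ifs
      · exact hz _ trivial
      · exact hz _ trivial
    · exact fun i _ => hz _ trivial
  · rw [Set.indicator_of_notMem hz]
    by_contra hne
    have h1 := left_ne_zero_of_mul hne
    have h2 := right_ne_zero_of_mul hne
    have h1' := Set.mem_of_indicator_ne_zero h1
    have h2' := Set.mem_of_indicator_ne_zero h2
    refine hz fun i _ => ?_
    rcases i with i | i
    · exact h1' i trivial
    -- The `i`-th new variable sits at position `l + i` of the spliced tuple.
    · have := h2' ⟨l + i, by omega⟩ trivial
      simpa [splice] using this

omit [NullSingletonClass μ] in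
-- The `l` common arguments lie in both sets, the other arguments of the first kernel in `B₁` and
-- those of the second in `B₂`; the kernels themselves are bounded by `M`.
theorem pairIntegral_le (hM : ∀ x, h x ≤ M) {l : ℕ} (hl : l ≤ k + 1) 
    (hB₁ : MeasurableSet B₁) (hB₂ : MeasurableSet B₂) :
    pairIntegral μ (restrictedKernel h B₁) (restrictedKernel h B₂) l ≤
      ENNReal.ofReal M ^ 2 * (μ (B₁ ∩ B₂) ^ l * μ B₁ ^ (k + 1 - l) * μ B₂ ^ (k + 1 - l)) := by
  classical
  let s : Fin (k + 1) ⊕ Fin (k + 1 - l) → Set (ESpace m) :=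
    Sum.elim (fun i => if (i : ℕ) < l then B₁ ∩ B₂ else B₁) fun _ => B₂
  have hsm : ∀ i, MeasurableSet (s i) := by
    rintro (i | i)
    · simp only [s, Sum.elim_inl]
      split_ifs
      exacts [hB₁.inter hB₂, hB₁]
    · exact hB₂
  have hle : ∀ z : Fin (k + 1) ⊕ Fin (k + 1 - l) → ESpace m,
      restrictedKernel h B₁ (z ∘ Sum.inl) *
        restrictedKernel h B₂ (splice k l (z ∘ Sum.inl) (z ∘ Sum.inr)) ≤
      (Set.univ.pi s).indicator (fun _ => ENNReal.ofReal M ^ 2) z := by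
    intro z
    by_cases hz : z ∈ Set.univ.pi s
    · rw [Set.indicator_of_mem hz, pow_two]
      exact mul_le_mul' (restrictedKernel_le hM _ _) (restrictedKernel_le hM _ _)
    · rw [Set.indicator_of_notMem hz]
      by_contra hne
      have hne := (not_le.1 hne).ne'
      have h1' := Set.mem_of_indicator_ne_zero (left_ne_zero_of_mul hne)
      have h2' := Set.mem_of_indicator_ne_zero (right_ne_zero_of_mul hne)
      refine hz fun i _ => ?_
      rcases i with i | i
      · by_cases hi : (i : ℕ) < l
        · have := h2' i trivial
          simp only [splice, hi, dif_pos] at this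
          simp only [s, Sum.elim_inl, hi, if_true]
          exact ⟨h1' i trivial, this⟩
        · simp only [s, Sum.elim_inl, hi, if_false]
          exact h1' i trivial
      · have := h2' ⟨l + i, by omega⟩ trivial
        simpa [splice, s] using this
  refine (lintegral_mono hle).trans_eq ?_
  rw [lintegral_indicator_const (MeasurableSet.univ_pi hsm), Measure.pi_pi, Fintype.prod_sum_type]
  congr 2
  · simp only [s, Sum.elim_inl, apply_ite μ]
    rw [Finset.prod_ite, Finset.prod_const, Finset.prod_const]
    have h1 : (Finset.univ.filter fun i : Fin (k + 1) => (i : ℕ) < l).card = l := by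
      rw [Fin.card_filter_val_lt]; omega
    have h2 := Finset.card_filter_add_card_filter_not (s := (Finset.univ : Finset (Fin (k + 1))))
      fun i => (i : ℕ) < l
    rw [h1, Finset.card_univ, Fintype.card_fin] at h2
    rw [h1, show (Finset.univ.filter fun i : Fin (k + 1) => ¬ (i : ℕ) < l).card = k + 1 - l by omega]
  · simp [s]

end UStatistics

/-! ### Asymptotics of Von Mises functions on the scale `a`. -/

section VonMises

variable {ψ : ℝ → ℝ}

theorem IsVonMises.aFun_pos (hψ : IsVonMises ψ) {s : ℝ} (hs : 0 < s) : 0 < aFun ψ s :=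
  one_div_pos.2 (hψ.deriv_pos s hs)

theorem IsVonMises.differentiableAt (hψ : IsVonMises ψ) {s : ℝ} (hs : 0 < s) :
    DifferentiableAt ℝ ψ s :=
  (hψ.contDiffOn.differentiableOn (by norm_num)).differentiableAt (Ioi_mem_nhds hs)

theorem IsVonMises.differentiableAt_aFun (hψ : IsVonMises ψ) {s : ℝ} (hs : 0 < s) :
    DifferentiableAt ℝ (aFun ψ) s := by
  have h1 : ContDiffOn ℝ 1 (deriv ψ) (Set.Ioi 0) :=
    ((contDiffOn_succ_iff_deriv_of_isOpen (n := 1) isOpen_Ioi).1 hψ.contDiffOn).2.2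
  have h2 : DifferentiableAt ℝ (deriv ψ) s :=
    (h1.differentiableOn (by norm_num)).differentiableAt (Ioi_mem_nhds hs)
  exact (differentiableAt_const 1).div h2 (hψ.deriv_pos s hs).ne'

/-- `a` is asymptotically flat. -/
theorem IsVonMises.exists_abs_aFun_sub_le (hψ : IsVonMises ψ) {ε : ℝ} (hε : 0 < ε) :
    ∃ T : ℝ, 0 < T ∧ ∀ x y : ℝ, T ≤ x → x ≤ y → |aFun ψ y - aFun ψ x| ≤ ε * (y - x) := by
  have h1 : ∀ᶠ s in atTop, |deriv (aFun ψ) s| ≤ ε := by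
    have := (Metric.tendsto_nhds.1 hψ.tendsto_deriv) ε hε
    filter_upwards [this] with s hs
    rw [Real.dist_eq, sub_zero] at hs
    exact hs.le
  obtain ⟨T, hT⟩ := eventually_atTop.1 h1
  refine ⟨max T 1, by positivity, fun x y hx hxy => ?_⟩
  have := (convex_Ici (max T 1)).norm_image_sub_le_of_norm_deriv_le (f := aFun ψ) (C := ε)
    (fun z hz => hψ.differentiableAt_aFun
      (lt_of_lt_of_le one_pos ((le_max_right T 1).trans hz)))
    (fun z hz => hT z ((le_max_left T 1).trans hz)) (show x ∈ Set.Ici (max T 1) from hx)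
    (show y ∈ Set.Ici (max T 1) from hx.trans hxy)
  rwa [Real.norm_eq_abs, Real.norm_eq_abs, abs_of_nonneg (sub_nonneg.2 hxy)] at this

/-- Flatness with slope `1/p` gives `a(y) ≤ a(t) + (y - t)/p`, so `ψ' = 1/a` dominates the
derivative of `p log (a(t) + (y - t)/p)`. -/
theorem IsVonMises.exists_log_le (hψ : IsVonMises ψ) {p : ℝ} (hp : 0 < p) :
    ∃ T : ℝ, 0 < T ∧ ∀ t : ℝ, T ≤ t → ∀ s : ℝ, 0 ≤ s →
      p * Real.log (1 + s / p) ≤ ψ (t + aFun ψ t * s) - ψ t := by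
  obtain ⟨T, hT, h⟩ := hψ.exists_abs_aFun_sub_le (ε := 1 / p) (by positivity)
  refine ⟨T, hT, fun t ht s hs => ?_⟩
  have ht0 : 0 < t := hT.trans_le ht
  have ha := hψ.aFun_pos ht0
  have hpos : ∀ y ∈ Set.Ici t, 0 < aFun ψ t + (y - t) / p := fun y hy => by
    have : 0 ≤ (y - t) / p := div_nonneg (sub_nonneg.2 hy) hp.le
    linarith
  have hd : ∀ y ∈ Set.Ici t, HasDerivAt
      (fun y => ψ y - p * Real.log (aFun ψ t + (y - t) / p))
      (deriv ψ y - p * ((1 / p) / (aFun ψ t + (y - t) / p))) y := by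
    intro y hy
    have h1 := (hψ.differentiableAt (ht0.trans_le hy)).hasDerivAt
    have h2 : HasDerivAt (fun y => aFun ψ t + (y - t) / p) (1 / p) y :=
      (((hasDerivAt_id y).sub_const t).div_const p).const_add _
    exact h1.sub ((h2.log (hpos y hy).ne').const_mul p)
  have hmono : MonotoneOn (fun y => ψ y - p * Real.log (aFun ψ t + (y - t) / p)) (Set.Ici t) := by
    refine monotoneOn_of_deriv_nonneg (convex_Ici t)
      (fun y hy => (hd y hy).continuousAt.continuousWithinAt) ?_ ?_
    · intro y hy
      rw [interior_Ici] at hy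
      exact (hd y (Set.mem_Ici.2 (le_of_lt hy))).differentiableAt.differentiableWithinAt
    · intro y hy
      rw [interior_Ici] at hy
      rw [(hd y (Set.mem_Ici.2 (le_of_lt hy))).deriv]
      have hy0 : 0 < y := ht0.trans hy
      have h1 := (abs_le.1 (h t y ht hy.le)).2
      have h2 : aFun ψ y ≤ aFun ψ t + (y - t) / p := by
        have : 1 / p * (y - t) = (y - t) / p := by ring
        linarith
      have h3 : deriv ψ y = 1 / aFun ψ y := by rw [aFun, one_div_one_div]
      rw [h3, mul_div_assoc', mul_one_div_cancel hp.ne', sub_nonneg]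
      exact one_div_le_one_div_of_le (hψ.aFun_pos hy0) h2
  have hle : t ≤ t + aFun ψ t * s := by nlinarith
  have h1 := hmono (Set.mem_Ici.2 le_rfl) (Set.mem_Ici.2 hle) hle
  simp only [sub_self, zero_div, add_zero, add_sub_cancel_left] at h1
  have h2 : aFun ψ t + aFun ψ t * s / p = aFun ψ t * (1 + s / p) := by ring
  have h3 : 0 < 1 + s / p := by positivity
  rw [h2, Real.log_mul ha.ne' h3.ne'] at h1
  nlinarith

/-- By the mean value theorem the increment is `s a(t)/a(ξ)`, and flatness keeps the ratio within
`2εs` of `1`. -/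
theorem IsVonMises.exists_abs_sub_le (hψ : IsVonMises ψ) {ε : ℝ} (hε : 0 < ε) :
    ∃ T : ℝ, 0 < T ∧ ∀ t : ℝ, T ≤ t → ∀ s : ℝ, 0 ≤ s → ε * s ≤ 1 / 2 →
      |ψ (t + aFun ψ t * s) - ψ t - s| ≤ 2 * ε * s ^ 2 := by
  obtain ⟨T, hT, h⟩ := hψ.exists_abs_aFun_sub_le hε
  refine ⟨T, hT, fun t ht s hs hεs => ?_⟩
  rcases hs.eq_or_lt with rfl | hs
  · simp
  have ht0 : 0 < t := hT.trans_le ht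
  have ha := hψ.aFun_pos ht0
  have hlt : t < t + aFun ψ t * s := by nlinarith
  obtain ⟨ξ, ⟨hξ1, hξ2⟩, hξ⟩ := exists_deriv_eq_slope ψ hlt
    (fun y hy => (hψ.differentiableAt (ht0.trans_le hy.1)).continuousAt.continuousWithinAt)
    (fun y hy => (hψ.differentiableAt (ht0.trans hy.1)).differentiableWithinAt)
  have haξ := hψ.aFun_pos (ht0.trans hξ1)
  have h1 := h t ξ ht hξ1.le
  have h2 : |aFun ψ ξ - aFun ψ t| ≤ ε * s * aFun ψ t := by
    refine h1.trans ?_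
    have : ξ - t ≤ aFun ψ t * s := by linarith
    nlinarith
  have h3 : ψ (t + aFun ψ t * s) - ψ t = deriv ψ ξ * (aFun ψ t * s) := by
    rw [hξ, add_sub_cancel_left, div_mul_cancel₀]
    positivity
  have h4 : deriv ψ ξ = 1 / aFun ψ ξ := by rw [aFun, one_div_one_div]
  have h5 : ψ (t + aFun ψ t * s) - ψ t - s = s * ((aFun ψ t - aFun ψ ξ) / aFun ψ ξ) := by
    rw [h3, h4]; field_simp
  rw [h5, abs_mul, abs_div, abs_of_pos hs, abs_of_pos haξ, abs_sub_comm]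
  -- The condition `εs ≤ 1/2` prevents `a` from dropping below half of `a(t)`.
  have h6 : aFun ψ t ≤ 2 * aFun ψ ξ := by
    have := (abs_le.1 h2).1
    nlinarith
  have h7 : |aFun ψ ξ - aFun ψ t| / aFun ψ ξ ≤ 2 * ε * s := by
    rw [div_le_iff₀ haξ]
    refine h2.trans ?_
    have : 0 ≤ ε * s := by positivity
    nlinarith
  calc s * (|aFun ψ ξ - aFun ψ t| / aFun ψ ξ) ≤ s * (2 * ε * s) := by gcongr
    _ = 2 * ε * s ^ 2 := by ring

/-- The exponential approximation of Von Mises functions. -/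
theorem IsVonMises.tendsto_sub (hψ : IsVonMises ψ) {t : ℕ → ℝ} (ht : Tendsto t atTop atTop)
    {σ : ℕ → ℝ} {s : ℝ} (hσ : Tendsto σ atTop (𝓝 s)) (h0 : ∀ᶠ n in atTop, 0 ≤ σ n) :
    Tendsto (fun n => ψ (t n + aFun ψ (t n) * σ n) - ψ (t n)) atTop (𝓝 s) := by
  have hs0 : 0 ≤ s := ge_of_tendsto hσ h0
  have hdiff : Tendsto (fun n => ψ (t n + aFun ψ (t n) * σ n) - ψ (t n) - σ n) atTop (𝓝 0) := by
    rw [Metric.tendsto_nhds]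
    intro δ hδ
    -- Eventually `σ n ≤ s + 1`: the first bound yields `ε σ n ≤ 1/2`, the second an error of at
    -- most `δ/2`.
    let ε := min (1 / (2 * (s + 1))) (δ / (4 * (s + 1) ^ 2))
    have hε : 0 < ε := by positivity
    obtain ⟨T, -, hT⟩ := hψ.exists_abs_sub_le hε
    filter_upwards [ht.eventually_ge_atTop T, h0, hσ.eventually_le_const (lt_add_one s)]
      with n h1 h2 h3
    rw [Real.dist_eq, sub_zero]
    have h4 : ε * σ n ≤ 1 / 2 := by
      calc ε * σ n ≤ (1 / (2 * (s + 1))) * (s + 1) :=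
            mul_le_mul (min_le_left _ _) h3 h2 (by positivity)
        _ = 1 / 2 := by field_simp
    refine (hT (t n) h1 (σ n) h2 h4).trans_lt ?_
    calc 2 * ε * σ n ^ 2 ≤ 2 * (δ / (4 * (s + 1) ^ 2)) * (s + 1) ^ 2 := by
          gcongr
          exact min_le_right _ _
      _ = δ / 2 := by field_simp; norm_num
      _ < δ := by linarith
  simpa using hdiff.add hσ

/-- Polynomial domination of the density along the scale `a`. -/
theorem IsVonMises.eventually_exp_le (hψ : IsVonMises ψ) {p : ℕ} (hp : 0 < p) {c : ℝ} (hc : 0 < c) :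
    ∃ K : ℝ, 0 < K ∧ ∃ T : ℝ, 0 < T ∧ ∀ t : ℝ, T ≤ t → ∀ s w : ℝ, 0 ≤ s → 0 ≤ w →
      c * w - 1 / 2 ≤ s →
      Real.exp (-(ψ (t + aFun ψ t * s) - ψ t)) ≤ K * ((1 + w) ^ p)⁻¹ := by
  have hp' : (0 : ℝ) < p := by exact_mod_cast hp
  obtain ⟨T, hT, h⟩ := hψ.exists_log_le hp'
  -- `min (1/2) c · (1 + w) ≤ 1/2 + c w ≤ 1 + s`, and dividing by `p ≥ 1` gives `d (1 + w) ≤ 1 +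
  -- s/p`.
  let d := min (1 / 2) c / p
  have hd : 0 < d := by positivity
  refine ⟨(d ^ p)⁻¹, by positivity, T, hT, fun t ht s w hs hw hsw => ?_⟩
  have h1 : d * (1 + w) ≤ 1 + s / p := by
    have h2 : min (1 / 2) c * (1 + w) ≤ 1 + s := by
      have h3 := min_le_left (1 / 2) c
      have h4 := mul_le_mul_of_nonneg_right (min_le_right (1 / 2) c) hw
      linarith
    have h5 : (1 : ℝ) ≤ p := by exact_mod_cast hp
    calc d * (1 + w) = min (1 / 2) c * (1 + w) / p := by ring
      _ ≤ (1 + s) / p := by gcongr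
      _ = 1 / p + s / p := by ring
      _ ≤ 1 + s / p := by gcongr; exact div_le_one_of_le₀ h5 hp'.le
  have hpos : 0 < 1 + s / p := by positivity
  calc Real.exp (-(ψ (t + aFun ψ t * s) - ψ t)) ≤ Real.exp (-(p * Real.log (1 + s / p))) := by
        gcongr; exact h t ht s hs
    _ = ((1 + s / p) ^ p)⁻¹ := by
        rw [Real.exp_neg, ← Real.log_pow, Real.exp_log (by positivity)]
    _ ≤ ((d * (1 + w)) ^ p)⁻¹ := by gcongr
    _ = (d ^ p)⁻¹ * ((1 + w) ^ p)⁻¹ := by rw [mul_pow, mul_inv]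

end VonMises

/-! ### Horizontal and vertical coordinates. -/

section Coordinates

variable {m : ℕ}

@[simp]
theorem pt_last (u : HorSpace m) (v : ℝ) : pt u v (Fin.last m) = v := by
  simp [pt]

@[simp]
theorem pt_castSucc (u : HorSpace m) (v : ℝ) (i : Fin m) : pt u v i.castSucc = u i := by
  simp [pt]

theorem pt_add (u u' : HorSpace m) (v v' : ℝ) : pt u v + pt u' v' = pt (u + u') (v + v') := by
  ext i
  refine Fin.lastCases ?_ (fun i => ?_) i <;> simp

theorem smul_pt (c : ℝ) (u : HorSpace m) (v : ℝ) : c • pt u v = pt (c • u) (c * v) := by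
  ext i
  refine Fin.lastCases ?_ (fun i => ?_) i <;> simp

/-- The horizontal part of a point. -/
def horPart (x : ESpace m) : HorSpace m := WithLp.toLp 2 fun i => x i.castSucc

theorem pt_horPart (x : ESpace m) : pt (horPart x) (x (Fin.last m)) = x := by
  ext i
  refine Fin.lastCases ?_ (fun i => ?_) i <;> simp [horPart]

/-- The identification of `ℝ^{d-1} × ℝ` with `ℝ^d`. -/
def ptEquiv (m : ℕ) : (HorSpace m × ℝ) ≃ₗ[ℝ] ESpace m where
  toFun p := pt p.1 p.2
  invFun x := (horPart x, x (Fin.last m))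
  map_add' p q := (pt_add _ _ _ _).symm
  map_smul' c p := (smul_pt _ _ _).symm
  left_inv p := by
    refine Prod.ext ?_ (pt_last _ _)
    ext i
    simp [horPart]
  right_inv x := pt_horPart x

theorem continuous_pt : Continuous fun p : HorSpace m × ℝ => pt p.1 p.2 :=
  (ptEquiv m).toLinearMap.continuous_of_finiteDimensional

theorem Continuous.pt {X : Type*} [TopologicalSpace X] {f : X → HorSpace m} {g : X → ℝ}
    (hf : Continuous f) (hg : Continuous g) : Continuous fun x => _root_.pt (f x) (g x) :=
  continuous_pt.comp (hf.prodMk hg)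

theorem LinearEquiv.continuous_eSpace (A : ESpace m ≃ₗ[ℝ] ESpace m) : Continuous A :=
  A.toLinearMap.continuous_of_finiteDimensional

end Coordinates

/-! ### Support halfspaces of rotund sets and growth of the gauge over them. -/

section Rotund

variable {m : ℕ} {D : Set (ESpace m)} {θ : ESpace m}

namespace IsRotund

variable (hD : IsRotund D)
include hD

theorem mem_nhds : D ∈ 𝓝 (0 : ESpace m) := hD.isOpen.mem_nhds hD.zero_mem

theorem absorbent : Absorbent ℝ D := absorbent_nhds_zero hD.mem_nhds

theorem continuous_gauge : Continuous (gauge D) := _root_.continuous_gauge hD.convex hD.mem_nhds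

theorem isCompact_closure : IsCompact (closure D) :=
  Metric.isCompact_of_isClosed_isBounded isClosed_closure hD.isBounded.closure

theorem bddAbove_inner (u : ESpace m) : BddAbove ((fun x => inner ℝ x u) '' D) := by
  obtain ⟨R, hR⟩ := hD.isBounded.exists_norm_le
  refine ⟨R * ‖u‖, ?_⟩
  rintro _ ⟨x, hx, rfl⟩
  exact (real_inner_le_norm x u).trans (by gcongr; exact hR x hx)

theorem inner_le_of_mem {x : ESpace m} (hx : x ∈ D) (u : ESpace m) :
    inner ℝ u x ≤ supportFunction D u := by
  rw [real_inner_comm]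
  exact le_csSup (hD.bddAbove_inner u) ⟨x, hx, rfl⟩

theorem inner_le_of_mem_closure {x : ESpace m} (hx : x ∈ closure D) (u : ESpace m) :
    inner ℝ u x ≤ supportFunction D u := by
  have hc : IsClosed {x : ESpace m | inner ℝ u x ≤ supportFunction D u} :=
    isClosed_le (by fun_prop) continuous_const
  exact closure_minimal (fun y hy => hD.inner_le_of_mem hy u) hc hx

theorem exists_isMax (u : ESpace m) : ∃ p ∈ closure D, inner ℝ u p = supportFunction D u := by
  obtain ⟨p, hp, hmax⟩ := hD.isCompact_closure.exists_isMaxOn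
    ⟨0, subset_closure hD.zero_mem⟩ (f := fun x => inner ℝ u x) (by fun_prop)
  refine ⟨p, hp, le_antisymm (hD.inner_le_of_mem_closure hp u) ?_⟩
  refine csSup_le ⟨_, 0, hD.zero_mem, rfl⟩ ?_
  rintro _ ⟨x, hx, rfl⟩
  dsimp only
  rw [real_inner_comm]
  exact hmax (subset_closure hx)

theorem inner_lt_of_mem {x : ESpace m} (hx : x ∈ D) (hθ : ‖θ‖ = 1) :
    inner ℝ θ x < supportFunction D θ := by
  have hcont : Tendsto (fun ε : ℝ => x + ε • θ) (𝓝[>] 0) (𝓝 x) := by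
    have : Continuous fun ε : ℝ => x + ε • θ := by fun_prop
    simpa using (this.tendsto 0).mono_left nhdsWithin_le_nhds
  obtain ⟨ε, hε, hε0⟩ := ((hcont.eventually (hD.isOpen.mem_nhds hx)).and
    self_mem_nhdsWithin).exists
  have h1 := hD.inner_le_of_mem hε θ
  rw [inner_add_right, inner_smul_right, real_inner_self_eq_norm_sq, hθ] at h1
  have : (0 : ℝ) < ε := hε0
  linarith

theorem supportFunction_pos (hθ : ‖θ‖ = 1) : 0 < supportFunction D θ := by
  simpa using hD.inner_lt_of_mem hD.zero_mem hθ

theorem inner_le_mul_gauge (hθ : ‖θ‖ = 1) (x : ESpace m) :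
    inner ℝ θ x ≤ supportFunction D θ * gauge D x := by
  have hζ := hD.supportFunction_pos hθ
  refine le_of_forall_gt_imp_ge_of_dense fun c hc => ?_
  have hc' : gauge D x < c / supportFunction D θ := by rwa [lt_div_iff₀' hζ]
  obtain ⟨b, hb0, hb, hx⟩ := exists_lt_of_gauge_lt hD.absorbent hc'
  obtain ⟨y, hy, rfl⟩ := hx
  have h1 := hD.inner_le_of_mem hy θ
  simp only [inner_smul_right]
  calc b * inner ℝ θ y ≤ b * supportFunction D θ := by gcongr
    _ ≤ c / supportFunction D θ * supportFunction D θ := by gcongr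
    _ = c := by field_simp

theorem one_le_gauge_of_mem_supportHalfspace (hθ : ‖θ‖ = 1) {x : ESpace m}
    (hx : x ∈ supportHalfspace D θ) : 1 ≤ gauge D x := by
  have h1 := hD.inner_le_mul_gauge hθ x
  have h2 : supportFunction D θ ≤ inner ℝ θ x := hx
  have h3 := hD.supportFunction_pos hθ
  by_contra! h
  nlinarith

theorem gauge_le_one_of_mem_closure {x : ESpace m} (hx : x ∈ closure D) : gauge D x ≤ 1 :=
  (gauge_le_one_iff_mem_closure hD.convex hD.mem_nhds).2 hx

theorem gauge_eq_one_of_isMax (hθ : ‖θ‖ = 1) {p : ESpace m} (hp : p ∈ closure D)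
    (h : inner ℝ θ p = supportFunction D θ) : gauge D p = 1 :=
  le_antisymm (hD.gauge_le_one_of_mem_closure hp)
    (hD.one_le_gauge_of_mem_supportHalfspace hθ h.ge)

theorem gauge_smul_of_nonneg {c : ℝ} (hc : 0 ≤ c) (x : ESpace m) :
    gauge D (c • x) = c * gauge D x := by
  rw [_root_.gauge_smul_of_nonneg hc, smul_eq_mul]

theorem gauge_add_le (x y : ESpace m) : gauge D (x + y) ≤ gauge D x + gauge D y :=
  _root_.gauge_add_le hD.convex hD.absorbent x y

/-- A point of differentiability of the gauge has a unique outer unit normal. -/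
theorem eq_of_isMax {θ₁ θ₂ p : ESpace m} (h₁ : ‖θ₁‖ = 1) (h₂ : ‖θ₂‖ = 1) (hp : gauge D p = 1)
    (hp₁ : inner ℝ θ₁ p = supportFunction D θ₁) (hp₂ : inner ℝ θ₂ p = supportFunction D θ₂) :
    θ₁ = θ₂ := by
  have hp0 : p ≠ 0 := by rintro rfl; simp at hp
  have hdiff : DifferentiableAt ℝ (gauge D) p :=
    (hD.contDiffOn_gauge.differentiableOn (by norm_num)).differentiableAt
      (isOpen_compl_singleton.mem_nhds hp0)
  have key : ∀ θ : ESpace m, ‖θ‖ = 1 → inner ℝ θ p = supportFunction D θ →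
      fderiv ℝ (gauge D) p = (supportFunction D θ)⁻¹ • innerSL ℝ θ := by
    intro θ hθ hpθ
    have hζ := hD.supportFunction_pos hθ
    -- `γ - ⟨θ, ·⟩/ζ(θ)` is nonnegative and vanishes at `p`, so `∇γ(p) = θ/ζ(θ)`; this gradient
    -- determines the unit vector `θ`.
    have hmin : IsLocalMin (fun x => gauge D x - ((supportFunction D θ)⁻¹ • innerSL ℝ θ) x) p := by
      refine Eventually.of_forall fun x => ?_
      have h1 := hD.inner_le_mul_gauge hθ x
      simp only [_root_.smul_apply, innerSL_apply_apply, smul_eq_mul, hpθ, hp]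
      rw [inv_mul_cancel₀ hζ.ne', sub_self, sub_nonneg, inv_mul_le_iff₀ hζ]
      exact h1
    have h2 := hmin.hasFDerivAt_eq_zero
      (hdiff.hasFDerivAt.sub ((supportFunction D θ)⁻¹ • innerSL ℝ θ).hasFDerivAt)
    exact sub_eq_zero.1 h2
  have e := (key θ₁ h₁ hp₁).symm.trans (key θ₂ h₂ hp₂)
  have hζ₁ := hD.supportFunction_pos h₁
  have hζ₂ := hD.supportFunction_pos h₂
  have e' : (supportFunction D θ₁)⁻¹ • θ₁ = (supportFunction D θ₂)⁻¹ • θ₂ := by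
    refine ext_inner_right ℝ fun x => ?_
    have := congrArg (fun L : ESpace m →L[ℝ] ℝ => L x) e
    simpa [inner_smul_left] using this
  have en := congrArg norm e'
  rw [norm_smul, norm_smul, h₁, h₂, mul_one, mul_one, Real.norm_of_nonneg (by positivity),
    Real.norm_of_nonneg (by positivity)] at en
  rw [en] at e'
  exact smul_right_injective _ (inv_pos.2 hζ₂).ne' e'

end IsRotund

theorem mem_smul_supportHalfspace {t : ℝ} (ht : 0 < t) {x : ESpace m} :
    x ∈ t • supportHalfspace D θ ↔ t * supportFunction D θ ≤ inner ℝ θ x := by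
  rw [Set.mem_smul_set_iff_inv_smul_mem₀ ht.ne', supportHalfspace, Set.mem_ofPred_eq,
    inner_smul_right, le_inv_mul_iff₀ ht]

theorem measurableSet_supportHalfspace : MeasurableSet (supportHalfspace D θ) :=
  (isClosed_le continuous_const (by fun_prop)).measurableSet

theorem measurableSet_smul_supportHalfspace (t : ℝ) :
    MeasurableSet (t • supportHalfspace D θ) := by
  rcases eq_or_ne t 0 with rfl | ht
  · exact (Set.subsingleton_zero_smul_set _).measurableSet
  · exact measurableSet_supportHalfspace.const_smul₀ t

/-- Linear maps in initial position, up to the normalization of the curvature. -/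
structure IsAdapted (D : Set (ESpace m)) (θ : ESpace m) (A : ESpace m ≃ₗ[ℝ] ESpace m) : Prop where
  gauge_apex : gauge D (A (pt 0 1)) = 1
  inner_apex : inner ℝ θ (A (pt 0 1)) = supportFunction D θ
  image_halfspace : A '' {x | 1 ≤ x (Fin.last m)} = supportHalfspace D θ
  growth : ∃ c : ℝ, 0 < c ∧ ∃ δ : ℝ, 0 < δ ∧ ∀ u : HorSpace m, ‖u‖ ≤ δ →
    c * ‖u‖ ^ 2 ≤ gauge D (A (pt u 1)) - 1

theorem IsInitialTransformation.isAdapted (hD : IsRotund D) (hθ : ‖θ‖ = 1)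
    {A : ESpace m ≃ₗ[ℝ] ESpace m} (hA : IsInitialTransformation D θ A) : IsAdapted D θ A := by
  obtain ⟨p, hp, hpθ⟩ := hD.exists_isMax θ
  have hAp : A (pt 0 1) = p := by
    have hgrad := hA.gradient.hasFDerivAt
    -- `ζ_D(y) ≥ ⟨p, y⟩` with equality at `θ`, so the gradient of `ζ_D` at `θ` is the contact point
    -- `p`.
    have hmin : IsLocalMin (fun y => supportFunction D y - innerSL ℝ p y) θ := by
      refine Eventually.of_forall fun y => ?_
      have h1 := hD.inner_le_of_mem_closure hp y
      simp only [innerSL_apply_apply]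
      rw [real_inner_comm θ p, real_inner_comm y p, hpθ, sub_self]
      linarith
    have h2 := hmin.hasFDerivAt_eq_zero (hgrad.sub (innerSL ℝ p).hasFDerivAt)
    refine ext_inner_right ℝ fun x => ?_
    have := congrArg (fun L : ESpace m →L[ℝ] ℝ => L x) (sub_eq_zero.1 h2)
    simpa using this
  have hg : gauge D (A (pt 0 1)) = 1 := by rw [hAp]; exact hD.gauge_eq_one_of_isMax hθ hp hpθ
  -- Near `0` the excess is `‖u‖²/2` up to a relative error of at most `1/2`, which leaves `‖u‖²/4`.
  refine ⟨hg, hAp ▸ hpθ, hA.image_halfspace, 1 / 4, by norm_num, ?_⟩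
  have h := hA.correct_position.isLittleO.def (c := 1 / 2) (by norm_num)
  obtain ⟨δ, hδ, hball⟩ := Metric.eventually_nhds_iff.1 h
  refine ⟨δ / 2, by positivity, fun u hu => ?_⟩
  have h1 := hball (show dist u 0 < δ by rw [dist_zero_right]; linarith)
  rw [hg] at h1
  simp only [Pi.sub_apply, Real.norm_eq_abs] at h1
  rw [abs_of_nonneg (show 0 ≤ ‖u‖ ^ 2 / 2 by positivity)] at h1
  have := (abs_le.1 h1).1
  linarith

namespace IsAdapted

variable {A : ESpace m ≃ₗ[ℝ] ESpace m}

theorem mem_supportHalfspace_iff (hA : IsAdapted D θ A) {x : ESpace m} :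
    A x ∈ supportHalfspace D θ ↔ 1 ≤ x (Fin.last m) := by
  rw [← hA.image_halfspace, A.injective.mem_set_image, Set.mem_ofPred_eq]

theorem mem_smul_iff (hA : IsAdapted D θ A) {t : ℝ} (ht : 0 < t) {x : ESpace m} :
    A x ∈ t • supportHalfspace D θ ↔ t ≤ x (Fin.last m) := by
  rw [Set.mem_smul_set_iff_inv_smul_mem₀ ht.ne', ← map_smul, hA.mem_supportHalfspace_iff]
  rw [PiLp.smul_apply, smul_eq_mul, le_inv_mul_iff₀ ht, mul_one]

theorem le_gauge (hA : IsAdapted D θ A) (hD : IsRotund D) (hθ : ‖θ‖ = 1) (u : HorSpace m) {w : ℝ}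
    (hw : 0 < w) : w ≤ gauge D (A (pt u w)) := by
  have h1 : pt u w = w • pt (w⁻¹ • u) 1 := by
    rw [smul_pt, smul_inv_smul₀ hw.ne', mul_one]
  rw [h1, map_smul, hD.gauge_smul_of_nonneg hw.le]
  have h2 := hD.one_le_gauge_of_mem_supportHalfspace hθ
    ((hA.mem_supportHalfspace_iff (x := pt (w⁻¹ • u) 1)).2 (by simp))
  nlinarith

/-- Quadratic growth near the apex and linear growth away from it. -/
theorem exists_min_le (hA : IsAdapted D θ A) (hD : IsRotund D) :
    ∃ c : ℝ, 0 < c ∧ c ≤ 1 / 2 ∧ ∃ δ : ℝ, 0 < δ ∧ ∀ u : HorSpace m,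
      c * min (‖u‖ ^ 2) (δ * ‖u‖) ≤ gauge D (A (pt u 1)) - 1 := by
  obtain ⟨c, hc, δ, hδ, h⟩ := hA.growth
  refine ⟨min c (1 / 2), by positivity, min_le_right _ _, δ, hδ, fun u => ?_⟩
  rcases le_total ‖u‖ δ with hu | hu
  · refine le_trans ?_ (h u hu)
    gcongr
    · exact min_le_left _ _
    · exact min_le_left _ _
  · have hu0 : 0 < ‖u‖ := hδ.trans_le hu
    -- A far point is contracted towards the apex to norm `δ`, where the quadratic bound holds;
    -- convexity turns it into linear growth along the ray.
    let s := δ / ‖u‖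
    have hs0 : 0 < s := by positivity
    have hs1 : s ≤ 1 := div_le_one_of_le₀ hu hu0.le
    have hsu : ‖s • u‖ = δ := by
      rw [norm_smul, Real.norm_of_nonneg hs0.le, div_mul_cancel₀ _ hu0.ne']
    have h1 := h (s • u) hsu.le
    rw [hsu] at h1
    have h2 : A (pt (s • u) 1) = s • A (pt u 1) + (1 - s) • A (pt 0 1) := by
      rw [← map_smul, ← map_smul, ← map_add, smul_pt, smul_pt, pt_add]
      simp
    have h3 : gauge D (A (pt (s • u) 1)) ≤ s * gauge D (A (pt u 1)) + (1 - s) * 1 := by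
      rw [h2]
      refine (hD.gauge_add_le _ _).trans_eq ?_
      rw [hD.gauge_smul_of_nonneg hs0.le, hD.gauge_smul_of_nonneg (by linarith), hA.gauge_apex]
    have h4 : c * δ ^ 2 ≤ s * (gauge D (A (pt u 1)) - 1) := by linarith
    have h5 : c * (δ * ‖u‖) ≤ gauge D (A (pt u 1)) - 1 := by
      have h6 : s * (c * (δ * ‖u‖)) = c * δ ^ 2 := by
        simp only [s]; field_simp
      rw [← h6] at h4
      exact le_of_mul_le_mul_left h4 hs0
    refine le_trans ?_ h5
    gcongr
    · exact min_le_left _ _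
    · exact min_le_right _ _

/-- Linear lower bound of the gauge in the rescaled coordinates. -/
theorem exists_linear_le (hA : IsAdapted D θ A) (hD : IsRotund D) :
    ∃ c : ℝ, 0 < c ∧ ∀ (a t b : ℝ), 0 < a → a ≤ t → 0 ≤ b → b ^ 2 = a * t →
      ∀ (u : HorSpace m) (v : ℝ), 0 ≤ v →
        c * (‖u‖ + v) - 1 / 2 ≤ (gauge D (A (pt (b • u) (t + a * v))) - t) / a := by
  obtain ⟨c, hc, hc2, δ, hδ, h⟩ := hA.exists_min_le hD
  -- `1/2` serves the `v`-term, `2c` the quadratic range of `u` and `c δ` the linear range.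
  refine ⟨min (min (1 / 2) (2 * c)) (c * δ), by positivity, ?_⟩
  intro a t b ha hat hb hbt u v hv
  have ht : 0 < t := ha.trans_le hat
  set w := t + a * v with hw
  have hw0 : 0 < w := by positivity
  have h1 : pt (b • u) w = w • pt ((b / w) • u) 1 := by
    rw [smul_pt, smul_smul, mul_div_cancel₀ _ hw0.ne', mul_one]
  rw [h1, map_smul, hD.gauge_smul_of_nonneg hw0.le]
  have h2 := h ((b / w) • u)
  rw [norm_smul, Real.norm_of_nonneg (by positivity)] at h2
  set G := gauge D (A (pt ((b / w) • u) 1))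
  have h3 : (w * G - t) / a = v + w / a * (G - 1) := by
    rw [hw]; field_simp; ring
  rw [h3]
  have h4 : w / a * (c * min ((b / w * ‖u‖) ^ 2) (δ * (b / w * ‖u‖))) ≤ w / a * (G - 1) := by
    gcongr
  have hab : a ≤ b := by nlinarith
  -- Since `b² = a t`, the right side is `‖u‖² t/w`, and `a ≤ t` gives `w ≤ t (1 + v)`.
  have h5 : ‖u‖ ^ 2 / (1 + v) ≤ w / a * (b / w * ‖u‖) ^ 2 := by
    have : w / a * (b / w * ‖u‖) ^ 2 = ‖u‖ ^ 2 * (t / w) := by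
      have : w / a * (b / w * ‖u‖) ^ 2 = b ^ 2 * ‖u‖ ^ 2 / (a * w) := by field_simp
      rw [this, hbt]; field_simp
    rw [this, div_eq_mul_inv]
    gcongr
    rw [inv_le_comm₀ (by positivity) (by positivity), inv_div, div_le_iff₀ ht]
    nlinarith
  have h6 : δ * ‖u‖ ≤ w / a * (δ * (b / w * ‖u‖)) := by
    have : w / a * (δ * (b / w * ‖u‖)) = δ * ‖u‖ * (b / a) := by field_simp
    rw [this]
    have h7 : 1 ≤ b / a := by rwa [one_le_div ha]
    have h8 : 0 ≤ δ * ‖u‖ := by positivity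
    nlinarith
  have h9 : c * min (‖u‖ ^ 2 / (1 + v)) (δ * ‖u‖) ≤ w / a * (G - 1) := by
    refine le_trans ?_ h4
    rw [← mul_assoc, mul_comm (w / a) c, mul_assoc, mul_min_of_nonneg _ _ (by positivity : 0 ≤ w / a)]
    gcongr
  refine le_trans ?_ (add_le_add_right h9 v)
  set κ := min (min (1 / 2) (2 * c)) (c * δ)
  have k1 : κ ≤ 1 / 2 := (min_le_left _ _).trans (min_le_left _ _)
  have k2 : κ ≤ 2 * c := (min_le_left _ _).trans (min_le_right _ _)
  have k3 : κ ≤ c * δ := min_le_right _ _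
  have hu := norm_nonneg u
  rcases min_cases (‖u‖ ^ 2 / (1 + v)) (δ * ‖u‖) with ⟨e, -⟩ | ⟨e, -⟩
  · rw [e]
    -- This is `(‖u‖ - (1 + v))² ≥ 0`. Multiplied by `c ≤ 1/2` it costs at most `1/2 + v/2`, whence
    -- the `-1/2` in the statement.
    have : 2 * ‖u‖ - (1 + v) ≤ ‖u‖ ^ 2 / (1 + v) := by
      rw [le_div_iff₀ (by positivity)]
      nlinarith [sq_nonneg (‖u‖ - (1 + v))]
    nlinarith
  · rw [e]
    nlinarith

end IsAdapted

end Rotund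

/-! ### The gauge near the contact point and existence of adapted maps. -/

section Adapted

variable {m : ℕ} {D : Set (ESpace m)} {θ : ESpace m}

/-- With `w = t + a v`, homogeneity gives `(γ - t)/a = v + (w/a)(γ(A((b/w) u, 1)) - 1)`. Correct
initial position makes the last term equivalent to `(w/a)(b/w)²‖u‖²/2 = (t/w)‖u‖²/2`, and `t/w → 1`
because `a = b²/t → 0`. -/
theorem IsInitialTransformation.tendsto_gauge {A : ESpace m ≃ₗ[ℝ] ESpace m}
    (hA : IsInitialTransformation D θ A) (hA1 : gauge D (A (pt 0 1)) = 1)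
    (hD : IsRotund D) {a b t : ℕ → ℝ} {β : ℝ} (ht : Tendsto t atTop atTop)
    (ha : ∀ᶠ n in atTop, 0 < a n)
    (hbt : ∀ᶠ n in atTop, b n ^ 2 = a n * t n)
    (hb : Tendsto b atTop (𝓝 β)) (u : HorSpace m) {v : ℝ} (hv : 0 ≤ v) :
    Tendsto (fun n => (gauge D (A (pt (b n • u) (t n + a n * v))) - t n) / a n) atTop
      (𝓝 (v + ‖u‖ ^ 2 / 2)) := by
  have htpos := ht.eventually_gt_atTop 0
  have ha0 : Tendsto a atTop (𝓝 0) := by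
    have h1 : Tendsto (fun n => b n ^ 2 / t n) atTop (𝓝 0) := (hb.pow 2).div_atTop ht
    refine h1.congr' ?_
    filter_upwards [htpos, hbt] with n h2 h3
    rw [h3, mul_div_cancel_right₀ _ h2.ne']
  have hwt : Tendsto (fun n => t n + a n * v) atTop atTop := by
    refine tendsto_atTop_mono' _ ?_ ht
    filter_upwards [ha] with n h1
    have := mul_nonneg h1.le hv
    linarith
  have hwpos := hwt.eventually_gt_atTop 0
  have hy : Tendsto (fun n => (b n / (t n + a n * v)) • u) atTop (𝓝 0) := by
    simpa using (hb.div_atTop hwt).smul_const u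
  have htw : Tendsto (fun n => t n / (t n + a n * v)) atTop (𝓝 1) := by
    have h1 : Tendsto (fun n => 1 + a n * v / t n) atTop (𝓝 1) := by
      simpa using ((ha0.mul_const v).div_atTop ht).const_add 1
    have h2 := h1.inv₀ one_ne_zero
    rw [inv_one] at h2
    refine h2.congr' ?_
    filter_upwards [htpos, hwpos] with n h3 h4
    rw [eq_div_iff h4.ne', inv_mul_eq_iff_eq_mul₀]
    · field_simp
    · have : 1 + a n * v / t n = (t n + a n * v) / t n := by field_simp
      rw [this]
      positivity
  have hequiv := (Asymptotics.IsEquivalent.refl (u := fun n => (t n + a n * v) / a n)).mul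
    (hA.correct_position.comp_tendsto hy)
  have hlim : Tendsto (fun n => t n / (t n + a n * v) * (‖u‖ ^ 2 / 2)) atTop
      (𝓝 (‖u‖ ^ 2 / 2)) := by
    simpa using htw.mul_const (‖u‖ ^ 2 / 2)
  have hlim2 := hequiv.symm.tendsto_nhds (hlim.congr' (by
    filter_upwards [ha, htpos, hwpos, hbt] with n h1 h2 h3 h4
    simp only [Pi.mul_apply, Function.comp_apply]
    rw [norm_smul, mul_pow, Real.norm_eq_abs, sq_abs, div_pow, h4]
    field_simp))
  refine (hlim2.const_add v).congr' ?_
  filter_upwards [ha, htpos, hwpos] with n h1 h2 h3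
  have h4 : pt (b n • u) (t n + a n * v) =
      (t n + a n * v) • pt ((b n / (t n + a n * v)) • u) 1 := by
    rw [smul_pt, smul_smul, mul_div_cancel₀ _ h3.ne', mul_one]
  simp only [Pi.mul_apply, Function.comp_apply]
  rw [h4, map_smul, hD.gauge_smul_of_nonneg h3.le, hA1]
  field_simp
  ring

/-- Along a line touching the level set `{γ = 1}` at `p`, the function `γ²` has zero slope at `p`
and second derivative bounded below by the Hessian; continuity of the second derivative is not
needed, only the first-order expansion of the derivative at `p`. -/
theorem IsRotund.exists_sq_growth (hD : IsRotund D) {p : ESpace m} (hp : gauge D p = 1) :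
    ∃ c : ℝ, 0 < c ∧ ∃ δ : ℝ, 0 < δ ∧ ∀ q : ESpace m, ‖q‖ ≤ δ →
      (∀ s : ℝ, 1 ≤ gauge D (p + s • q)) → c * ‖q‖ ^ 2 ≤ gauge D (p + q) - 1 := by
  have hp0 : p ≠ 0 := by rintro rfl; simp at hp
  let G : ESpace m → ℝ := fun y => gauge D y ^ 2
  have hG : ContDiffOn ℝ 2 G {0}ᶜ := hD.contDiffOn_gauge.pow 2
  have hGd : ∀ x : ESpace m, x ≠ 0 → HasFDerivAt G (fderiv ℝ G x) x := fun x hx =>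
    ((hG.differentiableOn (by norm_num)).differentiableAt
      (isOpen_compl_singleton.mem_nhds hx)).hasFDerivAt
  have hG1 : ContDiffOn ℝ 1 (fderiv ℝ G) {0}ᶜ :=
    hG.fderiv_of_isOpen isOpen_compl_singleton (by norm_num)
  have hG2 : HasFDerivAt (fderiv ℝ G) (fderiv ℝ (fderiv ℝ G) p) p :=
    ((hG1.differentiableOn (by norm_num)).differentiableAt
      (isOpen_compl_singleton.mem_nhds hp0)).hasFDerivAt
  set H := fderiv ℝ (fderiv ℝ G) p
  have hHpos : ∀ w : ESpace m, w ≠ 0 → 0 < H w w := fun w hw => by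
    have := hD.hessian_pos p hp0 w hw
    rwa [iteratedFDeriv_two_apply] at this
  obtain ⟨c, hc, hcH⟩ : ∃ c : ℝ, 0 < c ∧ ∀ w : ESpace m, c * ‖w‖ ^ 2 ≤ H w w := by
    obtain ⟨w0, hw0, hmin⟩ := (isCompact_sphere (0 : ESpace m) 1).exists_isMinOn
      (NormedSpace.sphere_nonempty.2 zero_le_one) (f := fun w => H w w) (by fun_prop)
    have hw0' : w0 ≠ 0 := by
      rintro rfl; simp at hw0
    refine ⟨H w0 w0, hHpos w0 hw0', fun w => ?_⟩
    rcases eq_or_ne w 0 with rfl | hw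
    · simp
    have hn : 0 < ‖w‖ := norm_pos_iff.2 hw
    have h1 : H w0 w0 ≤ H (‖w‖⁻¹ • w) (‖w‖⁻¹ • w) := hmin (by
      rw [mem_sphere_zero_iff_norm, norm_smul, norm_inv, norm_norm, inv_mul_cancel₀ hn.ne'])
    have h2 : H (‖w‖⁻¹ • w) (‖w‖⁻¹ • w) = H w w / ‖w‖ ^ 2 := by
      simp only [map_smul, _root_.smul_apply, smul_eq_mul]
      field_simp
    rw [h2, le_div_iff₀ (by positivity)] at h1
    exact h1
  have ho := hG2.isLittleO.def (c := c / 2) (by positivity)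
  obtain ⟨δ, hδ, hball⟩ := Metric.eventually_nhds_iff.1 ho
  obtain ⟨δ', hδ', hcont⟩ := Metric.eventually_nhds_iff.1
    ((hD.continuous_gauge.tendsto p).eventually (gt_mem_nhds (show gauge D p < 2 by linarith)))
  have hnp : 0 < ‖p‖ := norm_pos_iff.2 hp0
  -- The bound on `γ² - 1` is `(c/4)‖q‖²`, and `γ < 2` gives `γ² - 1 ≤ 3(γ - 1)`, hence `c/12`. The
  -- three radii keep the expansion at `p` valid, `γ` below `2`, and the segment away from the
  -- origin.
  refine ⟨c / 12, by positivity, min (min (δ / 2) (δ' / 2)) (‖p‖ / 2), by positivity, ?_⟩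
  intro q hq hmin
  have hq1 : ‖q‖ ≤ δ / 2 := hq.trans ((min_le_left _ _).trans (min_le_left _ _))
  have hq2 : ‖q‖ ≤ δ' / 2 := hq.trans ((min_le_left _ _).trans (min_le_right _ _))
  have hq3 : ‖q‖ ≤ ‖p‖ / 2 := hq.trans (min_le_right _ _)
  have hne : ∀ s ∈ Set.Icc (0 : ℝ) 1, p + s • q ≠ 0 := by
    intro s hs h0
    have h1 : ‖p‖ = ‖s • q‖ := by rw [eq_neg_of_add_eq_zero_left h0, norm_neg]
    rw [norm_smul, Real.norm_of_nonneg hs.1] at h1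
    nlinarith [hs.2, norm_nonneg q]
  have hφ : ∀ s ∈ Set.Icc (0 : ℝ) 1, HasDerivAt (fun s : ℝ => G (p + s • q))
      (fderiv ℝ G (p + s • q) q) s := by
    intro s hs
    have h1 : HasDerivAt (fun s : ℝ => p + s • q) q s := by
      simpa using ((hasDerivAt_id s).smul_const q).const_add p
    exact (hGd _ (hne s hs)).comp_hasDerivAt s h1
  -- On the line through `p` in direction `q` the gauge is at least `1`, with equality at `p`.
  have h0 : fderiv ℝ G p q = 0 := by
    have h1 := hφ 0 ⟨le_rfl, zero_le_one⟩
    simp only [zero_smul, add_zero] at h1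
    refine IsLocalMin.hasDerivAt_eq_zero (Eventually.of_forall fun s => ?_) h1
    simp only [G, zero_smul, add_zero, hp]
    have := hmin s
    nlinarith
  have hder : ∀ s ∈ Set.Icc (0 : ℝ) 1, c / 2 * ‖q‖ ^ 2 * s ≤ fderiv ℝ G (p + s • q) q := by
    intro s hs
    have h1 := hball (y := p + s • q) (by
      rw [dist_eq_norm, add_sub_cancel_left, norm_smul, Real.norm_of_nonneg hs.1]
      nlinarith [hs.2, norm_nonneg q])
    rw [add_sub_cancel_left] at h1
    have h2 := (ContinuousLinearMap.le_opNorm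
      (fderiv ℝ G (p + s • q) - fderiv ℝ G p - H (s • q)) q).trans
      (mul_le_mul_of_nonneg_right h1 (norm_nonneg q))
    simp only [_root_.sub_apply, h0, map_smul, _root_.smul_apply, smul_eq_mul, sub_zero,
      norm_smul, Real.norm_of_nonneg hs.1] at h2
    have h3 := (abs_le.1 h2).1
    have h4 := mul_le_mul_of_nonneg_left (hcH q) hs.1
    nlinarith
  have hmono : MonotoneOn (fun s : ℝ => G (p + s • q) - c / 4 * ‖q‖ ^ 2 * s ^ 2)
      (Set.Icc 0 1) := by
    have hd : ∀ s ∈ Set.Icc (0 : ℝ) 1, HasDerivAt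
        (fun s : ℝ => G (p + s • q) - c / 4 * ‖q‖ ^ 2 * s ^ 2)
        (fderiv ℝ G (p + s • q) q - c / 4 * ‖q‖ ^ 2 * (2 * s)) s := by
      intro s hs
      have h1 : HasDerivAt (fun s : ℝ => c / 4 * ‖q‖ ^ 2 * s ^ 2) (c / 4 * ‖q‖ ^ 2 * (2 * s)) s := by
        simpa using (hasDerivAt_pow 2 s).const_mul (c / 4 * ‖q‖ ^ 2)
      exact (hφ s hs).sub h1
    refine monotoneOn_of_deriv_nonneg (convex_Icc 0 1)
      (fun s hs => (hd s hs).continuousAt.continuousWithinAt)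
      (fun s hs => (hd s (interior_subset hs)).differentiableAt.differentiableWithinAt) ?_
    intro s hs
    rw [(hd s (interior_subset hs)).deriv]
    have := hder s (interior_subset hs)
    linarith
  have h1 := hmono (Set.left_mem_Icc.2 zero_le_one) (Set.right_mem_Icc.2 zero_le_one) zero_le_one
  simp only [G, zero_smul, add_zero, hp, one_smul] at h1
  have h2 : gauge D (p + q) < 2 := hcont (by
    rw [dist_eq_norm, add_sub_cancel_left]; linarith)
  have h3 : 1 ≤ gauge D (p + q) := by simpa using hmin 1
  nlinarith

/-- Every angle admits an adapted linear map. -/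
theorem IsRotund.exists_isAdapted (hD : IsRotund D) (hθ : ‖θ‖ = 1) :
    ∃ A : ESpace m ≃ₗ[ℝ] ESpace m, IsAdapted D θ A := by
  obtain ⟨p, hp, hpθ⟩ := hD.exists_isMax θ
  have hζ := hD.supportFunction_pos hθ
  have hgp := hD.gauge_eq_one_of_isMax hθ hp hpθ
  let e : ESpace m := pt 0 1
  have he : ∀ x : ESpace m, inner ℝ e x = x (Fin.last m) := by
    intro x
    rw [PiLp.inner_apply, Fin.sum_univ_castSucc]
    simp [e]
  have hen : ‖e‖ = 1 := by
    have h := he e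
    rw [real_inner_self_eq_norm_sq, pt_last] at h
    nlinarith [norm_nonneg e]
  -- This reflection exchanges the unit vectors `e` and `θ`. The map `f` below agrees with it on
  -- horizontal vectors and sends `e` to the contact point `p`, so `⟨θ, f x⟩` is the last coordinate
  -- of `x` times `ζ_D(θ)`.
  let R := (ℝ ∙ (e - θ))ᗮ.reflection
  have hR : R e = θ := Submodule.reflection_sub (by rw [hen, hθ])
  let f : ESpace m →ₗ[ℝ] ESpace m :=
    { toFun := fun x => R (x - x (Fin.last m) • e) + x (Fin.last m) • p
      map_add' := by
        intro x y
        simp only [PiLp.add_apply, map_sub, map_add, map_smul, add_smul]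
        abel
      map_smul' := by
        intro c x
        simp only [PiLp.smul_apply, map_sub, map_smul, smul_eq_mul, mul_smul, smul_add, smul_sub,
          RingHom.id_apply] }
  have hf : ∀ x, f x = R (x - x (Fin.last m) • e) + x (Fin.last m) • p := fun x => rfl
  have hinner : ∀ x, inner ℝ θ (f x) = x (Fin.last m) * supportFunction D θ := by
    intro x
    rw [hf, inner_add_right, ← hR, LinearIsometryEquiv.inner_map_map, inner_sub_right, he,
      inner_smul_right, inner_smul_right, hR, hpθ, he]
    simp [e]
  have hinj : Function.Injective f := by
    rw [injective_iff_map_eq_zero]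
    intro x hx
    have h1 := hinner x
    rw [hx, inner_zero_right] at h1
    have h2 : x (Fin.last m) = 0 := by
      rcases mul_eq_zero.1 h1.symm with h | h
      · exact h
      · exact absurd h hζ.ne'
    rw [hf, h2, zero_smul, zero_smul, sub_zero, add_zero] at hx
    exact (map_eq_zero_iff R R.injective).1 hx
  let A := LinearEquiv.ofInjectiveEndo f hinj
  have hA : ∀ x, A x = f x := fun x => rfl
  have hA1 : ∀ u : HorSpace m, A (pt u 1) = p + R (pt u 0) := by
    intro u
    rw [hA, hf, pt_last, one_smul, one_smul, add_comm]
    congr 2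
    rw [sub_eq_iff_eq_add, pt_add]
    simp
  have hA0 : A (pt 0 1) = p := by
    rw [hA1]
    have : (pt 0 0 : ESpace m) = 0 := (ptEquiv m).map_zero
    rw [this, map_zero, add_zero]
  have himage : A '' {x | 1 ≤ x (Fin.last m)} = supportHalfspace D θ := by
    ext y
    obtain ⟨x, rfl⟩ := A.surjective y
    rw [A.injective.mem_set_image, supportHalfspace, Set.mem_ofPred_eq, Set.mem_ofPred_eq, hA,
      hinner]
    exact (le_mul_iff_one_le_left hζ).symm
  refine ⟨A, by rw [hA0, hgp], by rw [hA0, hpθ], himage, ?_⟩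
  obtain ⟨c, hc, δ, hδ, h⟩ := hD.exists_sq_growth hgp
  have hnorm : ∀ u : HorSpace m, ‖R (pt u 0)‖ = ‖u‖ := by
    intro u
    rw [LinearIsometryEquiv.norm_map, EuclideanSpace.norm_eq, EuclideanSpace.norm_eq,
      Fin.sum_univ_castSucc]
    simp
  refine ⟨c, hc, δ, hδ, fun u hu => ?_⟩
  have := h (R (pt u 0)) (by rwa [hnorm]) fun s => by
    rw [← map_smul, smul_pt, mul_zero, ← hA1]
    refine hD.one_le_gauge_of_mem_supportHalfspace hθ ?_
    rw [← himage]
    exact ⟨_, by simp, rfl⟩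
  rw [hnorm] at this
  rwa [hA1]

/-- The contact point for `θ₁` has a unique outer unit normal, so it cannot also lie on the support
hyperplane for `θ₂`. -/
theorem IsAdapted.inner_lt {A : ESpace m ≃ₗ[ℝ] ESpace m} {θ₁ θ₂ : ESpace m}
    (hA : IsAdapted D θ₁ A) (hD : IsRotund D) (h₁ : ‖θ₁‖ = 1) (h₂ : ‖θ₂‖ = 1) (hne : θ₁ ≠ θ₂) :
    inner ℝ θ₂ (A (pt 0 1)) < supportFunction D θ₂ := by
  refine lt_of_le_of_ne ?_ fun h => hne (hD.eq_of_isMax h₁ h₂ hA.gauge_apex hA.inner_apex h)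
  have := hD.inner_le_mul_gauge h₂ (A (pt 0 1))
  rwa [hA.gauge_apex, mul_one] at this

end Adapted

/-! ### Rescaling near the apex, limit and domination of the density. -/

section ChangeOfVariables

variable {m : ℕ}

theorem measurePreserving_ptEquiv :
    MeasurePreserving (ptEquiv m) (volume : Measure (HorSpace m × ℝ)) volume := by
  have h1 : MeasurePreserving (Prod.map (@WithLp.ofLp 2 (Fin m → ℝ)) id)
      (volume : Measure (HorSpace m × ℝ)) (volume : Measure ((Fin m → ℝ) × ℝ)) :=
    (PiLp.volume_preserving_ofLp (Fin m)).prod (MeasurePreserving.id volume)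
  have h2 : MeasurePreserving (Prod.swap : (Fin m → ℝ) × ℝ → ℝ × (Fin m → ℝ)) volume volume :=
    Measure.measurePreserving_swap
  have h3 := (volume_preserving_piFinSuccAbove (fun _ : Fin (m + 1) => ℝ) (Fin.last m)).symm
  have h4 := ((PiLp.volume_preserving_toLp (Fin (m + 1))).comp h3).comp (h2.comp h1)
  have heq : (ptEquiv m : HorSpace m × ℝ → ESpace m) = (@WithLp.toLp 2 (Fin (m + 1) → ℝ) ∘
      (MeasurableEquiv.piFinSuccAbove (fun _ : Fin (m + 1) => ℝ) (Fin.last m)).symm) ∘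
      Prod.swap ∘ Prod.map (@WithLp.ofLp 2 (Fin m → ℝ)) id := by
    funext p
    ext i
    refine Fin.lastCases ?_ (fun i => ?_) i
    · simp [ptEquiv, MeasurableEquiv.piFinSuccAbove]
    · simp [ptEquiv, MeasurableEquiv.piFinSuccAbove]
  rw [heq]
  exact h4

theorem map_smul_prod (a b : ℝ) (ha : 0 < a) (hb : 0 < b) :
    (volume : Measure (HorSpace m × ℝ)).map (fun y => (b • y.1, a * y.2)) =
      ENNReal.ofReal ((b ^ m * a)⁻¹) • volume := by
  have h1 : (volume : Measure (HorSpace m)).map (b • ·) = ENNReal.ofReal ((b ^ m)⁻¹) • volume := by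
    rw [Measure.map_addHaar_smul _ hb.ne', finrank_euclideanSpace_fin, abs_of_pos (by positivity)]
  have h2 : (volume : Measure ℝ).map (a • ·) = ENNReal.ofReal (a⁻¹) • volume := by
    rw [Measure.map_addHaar_smul _ ha.ne', Module.finrank_self, pow_one, abs_of_pos (by positivity)]
  have h3 := Measure.map_prod_map (volume : Measure (HorSpace m)) (volume : Measure ℝ)
    (measurable_const_smul b) (measurable_const_smul a)
  have h4 : (volume : Measure (HorSpace m × ℝ)).map (Prod.map (b • ·) (a • ·)) =
      ENNReal.ofReal ((b ^ m * a)⁻¹) • volume := by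
    rw [Measure.volume_eq_prod, ← h3, h1, h2, Measure.prod_smul_left, Measure.prod_smul_right,
      smul_smul, ← ENNReal.ofReal_mul (by positivity), mul_inv]
  exact h4

/-- Affine coordinates near the apex of a dilated halfspace. -/
def rescale (A : ESpace m ≃ₗ[ℝ] ESpace m) (a b t : ℝ) (y : HorSpace m × ℝ) : ESpace m :=
  A (pt (b • y.1) (t + a * y.2))

theorem continuous_rescale (A : ESpace m ≃ₗ[ℝ] ESpace m) (a b t : ℝ) :
    Continuous (rescale A a b t) :=
  A.continuous_eSpace.comp (Continuous.pt (by fun_prop) (by fun_prop))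

theorem zConst_pos (A : ESpace m ≃ₗ[ℝ] ESpace m) : 0 < zConst A :=
  abs_pos.2 (LinearEquiv.isUnit_det' A).ne_zero

theorem map_rescale (A : ESpace m ≃ₗ[ℝ] ESpace m) {a b : ℝ} (ha : 0 < a) (hb : 0 < b) (t : ℝ) :
    (volume : Measure (HorSpace m × ℝ)).map (rescale A a b t) =
      ENNReal.ofReal ((b ^ m * a * zConst A)⁻¹) • volume := by
  have h1 : rescale A a b t = A ∘ (fun x => pt 0 t + x) ∘ ptEquiv m ∘
      fun y : HorSpace m × ℝ => (b • y.1, a * y.2) := by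
    ext1 y
    simp [rescale, ptEquiv, pt_add]
  have hA : Measurable A := A.continuous_eSpace.measurable
  have hp : Measurable (ptEquiv m) := (measurePreserving_ptEquiv (m := m)).measurable
  have hdet : LinearMap.det (A : ESpace m →ₗ[ℝ] ESpace m) ≠ 0 :=
    (LinearEquiv.isUnit_det' A).ne_zero
  have h2 := Measure.map_linearMap_addHaar_eq_smul_addHaar (volume : Measure (ESpace m)) hdet
  rw [h1, ← Measure.map_map hA (by fun_prop), ← Measure.map_map (by fun_prop) (by fun_prop),
    ← Measure.map_map hp (by fun_prop), map_smul_prod a b ha hb, Measure.map_smul,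
    (measurePreserving_ptEquiv (m := m)).map_eq, Measure.map_smul, Measure.map_smul,
    map_add_left_eq_self]
  change _ • Measure.map (A : ESpace m →ₗ[ℝ] ESpace m) volume = _
  rw [h2, smul_smul, ← ENNReal.ofReal_mul (by positivity), mul_inv (b ^ m * a), zConst, abs_inv]

/-- The halfspace `{v ≥ 0}` in the coordinates `(u, v)`. -/
def upperHalf (m : ℕ) : Set (HorSpace m × ℝ) := {y | 0 ≤ y.2}

theorem measurableSet_upperHalf : MeasurableSet (upperHalf m) :=
  measurableSet_le measurable_const measurable_snd

variable {D : Set (ESpace m)} {θ : ESpace m} {A : ESpace m ≃ₗ[ℝ] ESpace m}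

theorem IsAdapted.restrict_eq_map (hA : IsAdapted D θ A) {a b t : ℝ} (ha : 0 < a) (hb : 0 < b)
    (ht : 0 < t) :
    (volume : Measure (ESpace m)).restrict (t • supportHalfspace D θ) =
      ENNReal.ofReal (b ^ m * a * zConst A) •
        ((volume : Measure (HorSpace m × ℝ)).restrict (upperHalf m)).map (rescale A a b t) := by
  have hz := zConst_pos A
  have hpre : upperHalf m = rescale A a b t ⁻¹' (t • supportHalfspace D θ) := by
    ext y
    rw [Set.mem_preimage, rescale, hA.mem_smul_iff ht, pt_last, upperHalf, Set.mem_ofPred_eq]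
    constructor
    · intro h; have := mul_nonneg ha.le h; linarith
    · intro h; exact nonneg_of_mul_nonneg_right (by linarith) ha
  have hT := (continuous_rescale A a b t).measurable
  rw [hpre, ← Measure.restrict_map hT (measurableSet_smul_supportHalfspace t),
    map_rescale A ha hb, Measure.restrict_smul, smul_smul, ← ENNReal.ofReal_mul (by positivity),
    mul_inv_cancel₀ (by positivity), ENNReal.ofReal_one, one_smul]

/-- The density in the coordinates `(u, v)`, relative to its value at level `t`. -/
noncomputable def profile (D : Set (ESpace m)) (ψ : ℝ → ℝ) (A : ESpace m ≃ₗ[ℝ] ESpace m) (t : ℝ)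
    (y : HorSpace m × ℝ) : ℝ :=
  Real.exp (-(ψ (gauge D (rescale A (aFun ψ t) (bFun ψ t) t y)) - ψ t))

variable {ψ : ℝ → ℝ}

theorem IsRotund.continuous_comp_gauge (hD : IsRotund D) (hψ : IsVonMises ψ) :
    Continuous fun x => ψ (gauge D x) :=
  hψ.continuousOn.comp_continuous hD.continuous_gauge fun x => gauge_nonneg x

theorem continuous_profile (hD : IsRotund D) (hψ : IsVonMises ψ) (A : ESpace m ≃ₗ[ℝ] ESpace m)
    (t : ℝ) : Continuous (profile D ψ A t) := by
  have := (hD.continuous_comp_gauge hψ).comp (continuous_rescale A (aFun ψ t) (bFun ψ t) t)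
  exact Real.continuous_exp.comp (this.sub continuous_const).neg

theorem IsVonMises.bFun_sq (hψ : IsVonMises ψ) {t : ℝ} (ht : 0 < t) :
    bFun ψ t ^ 2 = aFun ψ t * t :=
  Real.sq_sqrt (mul_pos (hψ.aFun_pos ht) ht).le

theorem IsVonMises.bFun_pos (hψ : IsVonMises ψ) {t : ℝ} (ht : 0 < t) : 0 < bFun ψ t :=
  Real.sqrt_pos.2 (mul_pos (hψ.aFun_pos ht) ht)

theorem IsVonMises.qFun_eq (hψ : IsVonMises ψ) {t : ℝ} (ht : 0 < t) (m : ℕ) :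
    qFun m ψ t = bFun ψ t ^ m * aFun ψ t := by
  have h := (mul_pos (hψ.aFun_pos ht) ht).le
  rw [qFun, bFun, Real.sqrt_eq_rpow, ← Real.rpow_natCast, ← Real.rpow_mul h]
  congr 2
  ring

/-- The rate `n g(t) q(t)` at level `t`. -/
noncomputable def rateAt (m : ℕ) (C : ℝ) (ψ : ℝ → ℝ) (n : ℕ) (t : ℝ) : ℝ :=
  n * generator C ψ t * qFun m ψ t

theorem IsVonMises.rateAt_nonneg (hψ : IsVonMises ψ) {C : ℝ} (hC : 0 < C) (n : ℕ) {t : ℝ}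
    (ht : 0 < t) : 0 ≤ rateAt m C ψ n t := by
  have h1 := hψ.aFun_pos ht
  have h2 := hψ.bFun_pos ht
  rw [rateAt, hψ.qFun_eq ht, generator]
  positivity

/-- The Jacobian `b^m a |det A|` equals `q(t) z`; taking out the density `n g(t)` at level `t`
explains the rate `n g(t) q(t)`. -/
theorem IsAdapted.intensity_restrict (hA : IsAdapted D θ A) (hD : IsRotund D) (hψ : IsVonMises ψ)
    {C : ℝ} (hC : 0 < C) (n : ℕ) {t : ℝ} (ht : 0 < t) :
    (intensity D C ψ n).restrict (t • supportHalfspace D θ) =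
      ENNReal.ofReal (rateAt m C ψ n t * zConst A) •
        ((volume.restrict (upperHalf m)).withDensity
          fun y => ENNReal.ofReal (profile D ψ A t y)).map
            (rescale A (aFun ψ t) (bFun ψ t) t) := by
  have ha := hψ.aFun_pos ht
  have hb := hψ.bFun_pos ht
  have hz := zConst_pos A
  have hT := (continuous_rescale A (aFun ψ t) (bFun ψ t) t).measurable
  have hcont := hD.continuous_comp_gauge hψ
  have hfm : Measurable fun x => ENNReal.ofReal (n * density D C ψ x) := by
    have : Continuous fun x => (n : ℝ) * (C * Real.exp (-ψ (gauge D x))) :=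
      continuous_const.mul (continuous_const.mul (Real.continuous_exp.comp hcont.neg))
    exact this.measurable.ennreal_ofReal
  have hpm := (continuous_profile hD hψ A t).measurable.ennreal_ofReal
  rw [intensity, restrict_withDensity (measurableSet_smul_supportHalfspace t),
    hA.restrict_eq_map ha hb ht]
  ext S hS
  have hfT : Measurable fun y => S.indicator (fun x => ENNReal.ofReal (n * density D C ψ x))
      (rescale A (aFun ψ t) (bFun ψ t) t y) := (hfm.indicator hS).comp hT
  rw [withDensity_apply _ hS, Measure.smul_apply, Measure.map_apply hT hS,
    withDensity_apply _ (hT hS), Measure.restrict_smul, lintegral_smul_measure,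
    ← lintegral_indicator hS, lintegral_map (hfm.indicator hS) hT, smul_eq_mul, smul_eq_mul,
    ← lintegral_const_mul _ hfT, ← lintegral_indicator (hT hS),
    ← lintegral_const_mul _ (hpm.indicator (hT hS))]
  refine lintegral_congr fun y => ?_
  by_cases hy : rescale A (aFun ψ t) (bFun ψ t) t y ∈ S
  · rw [Set.indicator_of_mem hy, Set.indicator_of_mem (Set.mem_preimage.2 hy),
      ← ENNReal.ofReal_mul (by positivity), ← ENNReal.ofReal_mul
        (mul_nonneg (hψ.rateAt_nonneg hC n ht) hz.le)]
    congr 1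
    rw [rateAt, hψ.qFun_eq ht, profile, density, generator, generator, neg_sub, sub_eq_add_neg,
      Real.exp_add]
    have : Real.exp (-ψ t) * Real.exp (ψ t) = 1 := by rw [← Real.exp_add]; simp
    linear_combination -(n : ℝ) * C * bFun ψ t ^ m * aFun ψ t * zConst A *
      Real.exp (-ψ (gauge D (rescale A (aFun ψ t) (bFun ψ t) t y))) * this
  · rw [Set.indicator_of_notMem hy, Set.indicator_of_notMem
      (show y ∉ rescale A (aFun ψ t) (bFun ψ t) t ⁻¹' S from hy), mul_zero, mul_zero]

theorem IsVonMises.eventually_aFun_le (hψ : IsVonMises ψ) : ∀ᶠ t in atTop, aFun ψ t ≤ t := by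
  obtain ⟨T, hT, h⟩ := hψ.exists_abs_aFun_sub_le (ε := 1 / 2) (by norm_num)
  -- Flatness with slope `1/2` gives `a(t) ≤ a(T) + (t - T)/2`, and `a(T) ≤ t/2`.
  filter_upwards [eventually_ge_atTop (max T (2 * aFun ψ T))] with t ht
  have h1 := (abs_le.1 (h T t le_rfl ((le_max_left _ _).trans ht))).2
  have h2 := (le_max_right _ _).trans ht
  linarith

/-- Integrable domination of the rescaled densities. -/
theorem IsAdapted.exists_profile_le (hA : IsAdapted D θ A) (hD : IsRotund D) (hψ : IsVonMises ψ)
    (hθ : ‖θ‖ = 1) :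
    ∃ K : ℝ, 0 < K ∧ ∀ᶠ t in atTop, ∀ y ∈ upperHalf m,
      profile D ψ A t y ≤ K * ((1 + ‖y‖) ^ (m + 2))⁻¹ := by
  obtain ⟨c, hc, h⟩ := hA.exists_linear_le hD
  -- The exponent `m + 2` exceeds the dimension `m + 1`, so the bound is integrable.
  obtain ⟨K, hK, T, hT, hexp⟩ := hψ.eventually_exp_le (p := m + 2) (by omega) hc
  refine ⟨K, hK, ?_⟩
  filter_upwards [eventually_ge_atTop T, hψ.eventually_aFun_le] with t ht hat y hy
  have ht0 := hT.trans_le ht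
  have ha := hψ.aFun_pos ht0
  have hy0 : 0 ≤ y.2 := hy
  have h1 := h (aFun ψ t) t (bFun ψ t) ha hat (hψ.bFun_pos ht0).le (hψ.bFun_sq ht0) y.1 y.2 hy0
  set G := gauge D (A (pt (bFun ψ t • y.1) (t + aFun ψ t * y.2)))
  have hG : t ≤ G := by
    have h2 : t + aFun ψ t * y.2 ≤ G := hA.le_gauge hD hθ _ (by positivity)
    have := mul_nonneg ha.le hy0
    linarith
  have h3 := hexp t ht ((G - t) / aFun ψ t) (‖y.1‖ + y.2)
    (div_nonneg (sub_nonneg.2 hG) ha.le) (by positivity) h1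
  rw [mul_div_cancel₀ _ ha.ne', add_sub_cancel] at h3
  refine h3.trans ?_
  have hn : ‖y‖ ≤ ‖y.1‖ + y.2 := by
    rw [Prod.norm_def]
    refine max_le (by linarith) ?_
    rw [Real.norm_of_nonneg hy0]
    linarith [norm_nonneg y.1]
  gcongr

theorem integrable_inv_one_add_norm_pow :
    Integrable (fun y : HorSpace m × ℝ => ((1 + ‖y‖) ^ (m + 2))⁻¹) := by
  have := integrable_one_add_norm (E := HorSpace m × ℝ)
    (μ := (volume : Measure (HorSpace m)).prod volume) (r := (m + 2 : ℕ)) (by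
    rw [Module.finrank_prod, finrank_euclideanSpace_fin, Module.finrank_self]
    push_cast; linarith)
  refine this.congr (Eventually.of_forall fun y => ?_)
  dsimp only
  rw [Real.rpow_neg (by positivity), Real.rpow_natCast]

/-- The gauge is `t + a σ_n` with `σ_n → v + ‖u‖²/2`, to which the exponential approximation of `ψ`
applies. -/
theorem IsInitialTransformation.tendsto_profile (hA : IsInitialTransformation D θ A)
    (hD : IsRotund D) (hψ : IsVonMises ψ) (hθ : ‖θ‖ = 1) {t : ℕ → ℝ} (ht : Tendsto t atTop atTop)
    {β : ℝ} (hb : Tendsto (fun n => bFun ψ (t n)) atTop (𝓝 β)) {y : HorSpace m × ℝ}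
    (hy : y ∈ upperHalf m) :
    Tendsto (fun n => profile D ψ A (t n) y) atTop
      (𝓝 (Real.exp (-‖y.1‖ ^ 2 / 2) * Real.exp (-y.2))) := by
  have hA' := hA.isAdapted hD hθ
  have hpos := ht.eventually_gt_atTop 0
  have ha : ∀ᶠ n in atTop, 0 < aFun ψ (t n) := hpos.mono fun n h => hψ.aFun_pos h
  have h1 := hA.tendsto_gauge hA'.gauge_apex hD ht ha (hpos.mono fun n h => hψ.bFun_sq h) hb y.1 hy
  have h2 := hψ.tendsto_sub ht h1 (by
    filter_upwards [hpos, ha] with n h3 h4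
    have h5 := mul_nonneg h4.le hy
    have h6 := hA'.le_gauge hD hθ (bFun ψ (t n) • y.1) (w := t n + aFun ψ (t n) * y.2)
      (by linarith)
    exact div_nonneg (by linarith) h4.le)
  have h3 := (Real.continuous_exp.tendsto _).comp h2.neg
  rw [← Real.exp_add]
  have e : -‖y.1‖ ^ 2 / 2 + -y.2 = -(y.2 + ‖y.1‖ ^ 2 / 2) := by ring
  rw [e]
  refine h3.congr' ?_
  filter_upwards [ha] with n h4
  simp only [Function.comp_apply, profile, rescale]
  rw [mul_div_cancel₀ _ h4.ne', add_sub_cancel]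

end ChangeOfVariables

/-! ### Product measures over the upper halfspace. -/

section ProductMeasures

theorem pi_withDensity_ofReal {ι X : Type*} [Fintype ι] [MeasurableSpace X] (ν : Measure X)
    [SigmaFinite ν] {g : X → ℝ} (hg : Integrable g ν) (h0 : ∀ x, 0 ≤ g x) :
    (Measure.pi fun _ : ι => ν.withDensity fun x => ENNReal.ofReal (g x)) =
      (Measure.pi fun _ : ι => ν).withDensity fun z => ENNReal.ofReal (∏ i, g (z i)) := by
  have := isFiniteMeasure_withDensity_ofReal hg.2
  refine Measure.pi_eq fun s hs => ?_
  rw [withDensity_apply _ (MeasurableSet.univ_pi hs), Measure.restrict_pi_pi,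
    ← ofReal_integral_eq_lintegral_ofReal,
    integral_fintype_prod_eq_prod (μ := fun i => ν.restrict (s i)) (fun (_ : ι) x => g x),
    ENNReal.ofReal_prod_of_nonneg fun i _ => integral_nonneg fun x => h0 x]
  · refine Finset.prod_congr rfl fun i _ => ?_
    rw [withDensity_apply _ (hs i), ofReal_integral_eq_lintegral_ofReal hg.restrict
      (Eventually.of_forall h0)]
  · exact Integrable.fintype_prod (f := fun (_ : ι) x => g x) fun i => hg.restrict
  · exact Eventually.of_forall fun z => Finset.prod_nonneg fun i _ => h0 _

/-- Selecting coordinates keeps null sets null under preimages. It carries almost-everywhere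
continuity of the kernel over to each of the two overlapping argument tuples. -/
theorem quasiMeasurePreserving_comp_injective {ι κ X : Type*} [Fintype ι] [Fintype κ]
    [MeasurableSpace X] (ν : Measure X) [SigmaFinite ν] {τ : ι → κ} (hτ : Function.Injective τ) :
    Measure.QuasiMeasurePreserving (fun z : κ → X => z ∘ τ) (Measure.pi fun _ => ν)
      (Measure.pi fun _ => ν) := by
  classical
  have h1 := (measurePreserving_piEquivPiSubtypeProd (fun _ : κ => ν)
    (fun j => j ∈ Set.range τ)).quasiMeasurePreserving
  have h2 := Measure.quasiMeasurePreserving_fst.comp h1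
  have h3 := (measurePreserving_piCongrLeft (fun _ : ι => ν)
    (Equiv.ofInjective τ hτ).symm).quasiMeasurePreserving
  have h5 := h3.comp (by convert h2)
  convert h5 using 1
  funext z
  funext i
  simp [MeasurableEquiv.piCongrLeft, Equiv.piCongrLeft, Equiv.piCongrLeft',
    MeasurableEquiv.piEquivPiSubtypeProd, Equiv.piEquivPiSubtypeProd]

variable {ι : Type*} [Fintype ι] {m : ℕ}

/-- Lebesgue measure on the halfspace `{v ≥ 0}`. -/
noncomputable def upperVolume (m : ℕ) : Measure (HorSpace m × ℝ) :=
  volume.restrict (upperHalf m)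

instance : SigmaFinite (upperVolume m) := by unfold upperVolume; infer_instance

theorem upperVolume_eq_prod :
    upperVolume m = (volume : Measure (HorSpace m)).prod (volume.restrict (Set.Ici 0)) := by
  have : upperHalf m = Set.univ ×ˢ Set.Ici 0 := by ext; simp [upperHalf]
  rw [upperVolume, this, Measure.volume_eq_prod, ← Measure.prod_restrict, Measure.restrict_univ]

theorem measurePreserving_arrowProd :
    MeasurePreserving (MeasurableEquiv.arrowProdEquivProdArrow (HorSpace m) ℝ ι)
      (Measure.pi fun _ => upperVolume m)
      ((Measure.pi fun _ : ι => (volume : Measure (HorSpace m))).prod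
        (Measure.pi fun _ : ι => (volume : Measure ℝ).restrict (Set.Ici 0))) := by
  rw [upperVolume_eq_prod]
  exact measurePreserving_arrowProdEquivProdArrow (HorSpace m) ℝ ι (fun _ => volume)
    (fun _ => volume.restrict (Set.Ici 0))

theorem quasiMeasurePreserving_fst_pi :
    Measure.QuasiMeasurePreserving (fun (y : ι → HorSpace m × ℝ) i => (y i).1)
      (Measure.pi fun _ => upperVolume m) volume :=
  Measure.quasiMeasurePreserving_fst.comp
    (measurePreserving_arrowProd (ι := ι) (m := m)).quasiMeasurePreserving

/-- The limit kernel ignores the vertical coordinates, and each of them contributes `∫₀^∞ e^(-v) dv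
= 1`. -/
theorem integral_pi_upperVolume (G : (ι → HorSpace m) → ℝ) :
    ∫ y, G (fun i => (y i).1) * ∏ i, (Real.exp (-‖(y i).1‖ ^ 2 / 2) * Real.exp (-(y i).2))
      ∂(Measure.pi fun _ => upperVolume m) =
    ∫ u, G u * ∏ i, Real.exp (-‖u i‖ ^ 2 / 2) := by
  have h1 := (measurePreserving_arrowProd (ι := ι) (m := m)).integral_comp
    (MeasurableEquiv.measurableEmbedding _)
    (fun p => (G p.1 * ∏ i, Real.exp (-‖p.1 i‖ ^ 2 / 2)) * ∏ i, Real.exp (-(p.2 i)))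
  have h2 : ∫ v : ℝ in Set.Ici 0, Real.exp (-v) = 1 := by
    rw [integral_Ici_eq_integral_Ioi, integral_exp_neg_Ioi_zero]
  rw [integral_prod_mul (fun u : ι → HorSpace m => G u * ∏ i, Real.exp (-‖u i‖ ^ 2 / 2))
    (fun v : ι → ℝ => ∏ i, Real.exp (-(v i))),
    integral_fintype_prod_eq_prod (fun (_ : ι) v => Real.exp (-v)), h2, Finset.prod_const_one,
    mul_one] at h1
  rw [volume_pi, ← h1]
  refine integral_congr_ae (Eventually.of_forall fun y => ?_)
  simp only [Finset.prod_mul_distrib]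
  rw [← mul_assoc]
  rfl

end ProductMeasures

/-! ### Limits of integrals over powers of a dilated halfspace. -/

section Limits

variable {ι : Type*} [Fintype ι] {m : ℕ} {D : Set (ESpace m)} {θ : ESpace m}
  {A : ESpace m ≃ₗ[ℝ] ESpace m} {ψ : ℝ → ℝ} {C : ℝ}

theorem isFiniteMeasure_intensity (hf : ∫⁻ x, ENNReal.ofReal (density D C ψ x) = 1) (n : ℕ) :
    IsFiniteMeasure (intensity D C ψ n) := by
  refine ⟨?_⟩
  rw [intensity, withDensity_apply _ MeasurableSet.univ, Measure.restrict_univ]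
  simp_rw [ENNReal.ofReal_mul (Nat.cast_nonneg n)]
  rw [lintegral_const_mul' _ _ ENNReal.ofReal_ne_top, hf, mul_one]
  exact ENNReal.ofReal_lt_top

instance (n : ℕ) : NullSingletonClass (intensity D C ψ n) := by
  unfold intensity; infer_instance

theorem profile_nonneg (t : ℝ) (y : HorSpace m × ℝ) : 0 ≤ profile D ψ A t y := (Real.exp_pos _).le

theorem IsAdapted.eventually_integrable_profile (hA : IsAdapted D θ A) (hD : IsRotund D)
    (hψ : IsVonMises ψ) (hθ : ‖θ‖ = 1) :
    ∀ᶠ t in atTop, Integrable (profile D ψ A t) (upperVolume m) := by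
  obtain ⟨K, hK, h⟩ := hA.exists_profile_le hD hψ hθ
  filter_upwards [h] with t ht
  refine Integrable.mono' ((integrable_inv_one_add_norm_pow (m := m)).restrict.const_mul K)
    (continuous_profile hD hψ A t).aestronglyMeasurable ?_
  refine (ae_restrict_iff' measurableSet_upperHalf).2 (Eventually.of_forall fun y hy => ?_)
  rw [Real.norm_of_nonneg (profile_nonneg t y)]
  exact ht y hy

theorem IsAdapted.integral_pi_intensity (hA : IsAdapted D θ A) (hD : IsRotund D)
    (hψ : IsVonMises ψ) (hC : 0 < C) (hf : ∫⁻ x, ENNReal.ofReal (density D C ψ x) = 1)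
    (n : ℕ) {t : ℝ} (ht : 0 < t) (hint : Integrable (profile D ψ A t) (upperVolume m))
    {F : (ι → ESpace m) → ℝ} (hF : Measurable F) :
    ∫ z, F z ∂(Measure.pi fun _ => (intensity D C ψ n).restrict (t • supportHalfspace D θ)) =
      (rateAt m C ψ n t * zConst A) ^ Fintype.card ι *
        ∫ y, F (fun i => rescale A (aFun ψ t) (bFun ψ t) t (y i)) * ∏ i, profile D ψ A t (y i)
          ∂(Measure.pi fun _ => upperVolume m) := by
  have := isFiniteMeasure_intensity (m := m) hf n
  have hz := zConst_pos A
  have hr := hψ.rateAt_nonneg (m := m) hC n ht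
  let T := rescale A (aFun ψ t) (bFun ψ t) t
  have hT : Measurable T := (continuous_rescale A (aFun ψ t) (bFun ψ t) t).measurable
  let ρ := (upperVolume m).withDensity fun y => ENNReal.ofReal (profile D ψ A t y)
  have : IsFiniteMeasure ρ := isFiniteMeasure_withDensity_ofReal hint.2
  have hTpi : Measurable fun (y : ι → HorSpace m × ℝ) i => T (y i) := by fun_prop
  have h1 : (Measure.pi fun _ : ι => (intensity D C ψ n).restrict (t • supportHalfspace D θ)) =
      ENNReal.ofReal (rateAt m C ψ n t * zConst A) ^ Fintype.card ι •
        (Measure.pi fun _ : ι => ρ).map fun y i => T (y i) := by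
    refine Measure.pi_eq fun s hs => ?_
    rw [hA.intensity_restrict hD hψ hC n ht, Measure.smul_apply,
      Measure.map_apply hTpi (MeasurableSet.univ_pi hs)]
    have h2 : (fun (y : ι → HorSpace m × ℝ) i => T (y i)) ⁻¹' Set.univ.pi s =
        Set.univ.pi fun i => T ⁻¹' (s i) := by ext; simp
    rw [h2, Measure.pi_pi, smul_eq_mul]
    simp_rw [Measure.smul_apply, smul_eq_mul]
    rw [Finset.prod_mul_distrib, Finset.prod_const, Finset.card_univ]
    congr 1
    refine Finset.prod_congr rfl fun i _ => ?_
    rw [Measure.map_apply hT (hs i)]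
    rfl
  have hpm : Measurable fun y : ι → HorSpace m × ℝ =>
      (∏ i, profile D ψ A t (y i)).toNNReal := by
    have := (continuous_profile hD hψ A t).measurable
    fun_prop
  rw [h1, integral_smul_measure, integral_map hTpi.aemeasurable hF.aestronglyMeasurable,
    pi_withDensity_ofReal _ hint fun y => profile_nonneg t y]
  rw [ENNReal.toReal_pow, ENNReal.toReal_ofReal (by positivity), smul_eq_mul]
  congr 1
  change ∫ y, _ ∂((Measure.pi fun _ => upperVolume m).withDensity
    fun y => ((∏ i, profile D ψ A t (y i)).toNNReal : ℝ≥0∞)) = _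
  rw [integral_withDensity_eq_integral_smul hpm]
  refine integral_congr_ae (Eventually.of_forall fun y => ?_)
  dsimp only
  rw [NNReal.smul_def, smul_eq_mul, Real.coe_toNNReal _
    (Finset.prod_nonneg fun i _ => profile_nonneg t _), mul_comm]

/-- Each variable contributes one factor `λ_n z` under the change of variables; the remaining
integrals converge by dominated convergence with the product of the polynomial bounds. The index
type is left free to serve both the mean and the overlap integrals. -/
theorem IsInitialTransformation.tendsto_integral_pi (hA : IsInitialTransformation D θ A)
    (hD : IsRotund D) (hψ : IsVonMises ψ) (hθ : ‖θ‖ = 1) (hC : 0 < C)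
    (hf : ∫⁻ x, ENNReal.ofReal (density D C ψ x) = 1)
    {t : ℕ → ℝ} (ht : Tendsto t atTop atTop) {β : ℝ}
    (hb : Tendsto (fun n => bFun ψ (t n)) atTop (𝓝 β))
    {F : ℕ → (ι → ESpace m) → ℝ} (hF : ∀ n, Measurable (F n)) {M : ℝ} (hM : ∀ n z, ‖F n z‖ ≤ M)
    {G : (ι → HorSpace m) → ℝ}
    (hlim : ∀ᵐ y ∂(Measure.pi fun _ : ι => upperVolume m),
      Tendsto (fun n => F n fun i => rescale A (aFun ψ (t n)) (bFun ψ (t n)) (t n) (y i)) atTop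
        (𝓝 (G fun i => (y i).1))) :
    Tendsto (fun n => (∫ z, F n z ∂(Measure.pi fun _ =>
      (intensity D C ψ n).restrict (t n • supportHalfspace D θ))) /
        rate m C ψ t n ^ Fintype.card ι) atTop
      (𝓝 (zConst A ^ Fintype.card ι * ∫ u, G u * ∏ i, Real.exp (-‖u i‖ ^ 2 / 2))) := by
  have hA' := hA.isAdapted hD hθ
  obtain ⟨K, hK, hdom⟩ := hA'.exists_profile_le hD hψ hθ
  let κ : HorSpace m × ℝ → ℝ := fun y => K * ((1 + ‖y‖) ^ (m + 2))⁻¹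
  have hκ : Integrable κ (upperVolume m) :=
    (integrable_inv_one_add_norm_pow (m := m)).restrict.const_mul K
  have hae : ∀ᵐ y ∂(Measure.pi fun _ : ι => upperVolume m), ∀ i, y i ∈ upperHalf m := by
    have h1 : ∀ᵐ y ∂(upperVolume m), y ∈ upperHalf m := ae_restrict_mem measurableSet_upperHalf
    rw [ae_all_iff]
    intro i
    exact (Measure.quasiMeasurePreserving_eval (μ := fun _ : ι => upperVolume m) i).ae h1
  have hDCT : Tendsto (fun n => ∫ y, F n (fun i => rescale A (aFun ψ (t n)) (bFun ψ (t n)) (t n)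
      (y i)) * ∏ i, profile D ψ A (t n) (y i) ∂(Measure.pi fun _ => upperVolume m)) atTop
      (𝓝 (∫ y, G (fun i => (y i).1) *
        ∏ i, (Real.exp (-‖(y i).1‖ ^ 2 / 2) * Real.exp (-(y i).2))
          ∂(Measure.pi fun _ => upperVolume m))) := by
    refine tendsto_integral_filter_of_dominated_convergence
      (fun y => M * ∏ i, κ (y i)) ?_ ?_ ?_ ?_
    · refine Eventually.of_forall fun n => ?_
      have h1 := (continuous_profile hD hψ A (t n)).measurable
      have h2 := (continuous_rescale A (aFun ψ (t n)) (bFun ψ (t n)) (t n)).measurable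
      have h3 : Measurable fun y : ι → HorSpace m × ℝ =>
          F n (fun i => rescale A (aFun ψ (t n)) (bFun ψ (t n)) (t n) (y i)) :=
        (hF n).comp (by fun_prop)
      exact (h3.mul (by fun_prop)).aestronglyMeasurable
    · filter_upwards [ht.eventually hdom] with n hn
      filter_upwards [hae] with y hy
      rw [norm_mul]
      gcongr
      · exact (norm_nonneg _).trans (hM n fun _ => 0)
      · exact hM n _
      · rw [Real.norm_of_nonneg (Finset.prod_nonneg fun i _ => profile_nonneg _ _)]
        exact Finset.prod_le_prod (fun i _ => profile_nonneg _ _) fun i _ => hn _ (hy i)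
    · exact (Integrable.fintype_prod (f := fun (_ : ι) y => κ y) fun _ => hκ).const_mul M
    · filter_upwards [hae, hlim] with y hy hy2
      exact hy2.mul (tendsto_finsetProd _ fun i _ =>
        hA.tendsto_profile hD hψ hθ ht hb (hy i))
  rw [integral_pi_upperVolume] at hDCT
  refine (hDCT.const_mul _).congr' ?_
  filter_upwards [ht.eventually (hA'.eventually_integrable_profile hD hψ hθ),
    ht.eventually_gt_atTop 0, eventually_gt_atTop 0] with n h1 h2 h3
  have hrate : rateAt m C ψ n (t n) = rate m C ψ t n := rfl
  have hpos : 0 < rate m C ψ t n := by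
    have h4 := hψ.aFun_pos h2
    have h5 := hψ.bFun_pos h2
    rw [rate, hψ.qFun_eq h2, generator]
    positivity
  rw [hA'.integral_pi_intensity hD hψ hC hf n h2 h1 (hF n), hrate, mul_pow]
  field_simp

end Limits

/-! ### Intersections of two dilated halfspaces. -/

section Intersections

variable {m : ℕ} {D : Set (ESpace m)} {θ θ₁ θ₂ : ESpace m} {A : ESpace m ≃ₗ[ℝ] ESpace m}
  {ψ : ℝ → ℝ} {C : ℝ}

theorem IsVonMises.tendsto_aFun (hψ : IsVonMises ψ) {t : ℕ → ℝ} (ht : Tendsto t atTop atTop)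
    {β : ℝ} (hb : Tendsto (fun n => bFun ψ (t n)) atTop (𝓝 β)) :
    Tendsto (fun n => aFun ψ (t n)) atTop (𝓝 0) := by
  refine ((hb.pow 2).div_atTop ht).congr' ?_
  filter_upwards [ht.eventually_gt_atTop 0] with n hn
  rw [hψ.bFun_sq hn, mul_div_cancel_right₀ _ hn.ne']

theorem IsAdapted.eventually_measure_le (hA : IsAdapted D θ A) (hD : IsRotund D)
    (hψ : IsVonMises ψ) (hθ : ‖θ‖ = 1) (hC : 0 < C) {t : ℕ → ℝ} (ht : Tendsto t atTop atTop) :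
    ∃ K : ℝ≥0∞, K ≠ ∞ ∧ ∀ᶠ n in atTop, intensity D C ψ n (t n • supportHalfspace D θ) ≤
      ENNReal.ofReal (rate m C ψ t n) * K := by
  obtain ⟨K, hK, hdom⟩ := hA.exists_profile_le hD hψ hθ
  let κ : HorSpace m × ℝ → ℝ := fun y => K * ((1 + ‖y‖) ^ (m + 2))⁻¹
  have hκ : Integrable κ (upperVolume m) :=
    (integrable_inv_one_add_norm_pow (m := m)).restrict.const_mul K
  have hκ0 : ∀ y, 0 ≤ κ y := fun y => by positivity
  have hz := zConst_pos A
  refine ⟨ENNReal.ofReal (zConst A) * ∫⁻ y, ENNReal.ofReal (κ y) ∂(upperVolume m), ?_, ?_⟩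
  · refine ENNReal.mul_ne_top ENNReal.ofReal_ne_top ?_
    exact ((hasFiniteIntegral_iff_ofReal (Eventually.of_forall hκ0)).1 hκ.2).ne
  · filter_upwards [ht.eventually hdom, ht.eventually_gt_atTop 0] with n h1 h2
    have hT := (continuous_rescale A (aFun ψ (t n)) (bFun ψ (t n)) (t n)).measurable
    have h3 := congrArg (fun μ : Measure (ESpace m) => μ Set.univ)
      (hA.intensity_restrict hD hψ hC n h2)
    simp only [Measure.restrict_apply_univ, Measure.smul_apply, smul_eq_mul,
      Measure.map_apply hT MeasurableSet.univ, Set.preimage_univ,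
      withDensity_apply _ MeasurableSet.univ, Measure.restrict_univ] at h3
    have hrate : rateAt m C ψ n (t n) = rate m C ψ t n := rfl
    rw [h3, hrate, ENNReal.ofReal_mul' hz.le, mul_assoc]
    refine mul_le_mul' le_rfl (mul_le_mul' le_rfl (lintegral_mono_ae ?_))
    filter_upwards [ae_restrict_mem measurableSet_upperHalf] with y hy
    exact ENNReal.ofReal_le_ofReal (h1 y hy)

/-- Divided by `t_n`, the rescaled point tends to the contact point for `θ₁`, which lies strictly on
the inner side of the support hyperplane for `θ₂`. -/
theorem IsAdapted.eventually_notMem (hA : IsAdapted D θ₁ A) (hD : IsRotund D)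
    (hψ : IsVonMises ψ) (h₁ : ‖θ₁‖ = 1) (h₂ : ‖θ₂‖ = 1) (hne : θ₁ ≠ θ₂)
    {t : ℕ → ℝ} (ht : Tendsto t atTop atTop)
    {β : ℝ} (hb : Tendsto (fun n => bFun ψ (t n)) atTop (𝓝 β)) (y : HorSpace m × ℝ) :
    ∀ᶠ n in atTop, rescale A (aFun ψ (t n)) (bFun ψ (t n)) (t n) y ∉
      t n • supportHalfspace D θ₂ := by
  have ha := hψ.tendsto_aFun ht hb
  have hcont : Continuous fun p : HorSpace m × ℝ => inner ℝ θ₂ (A (pt p.1 p.2)) :=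
    continuous_const.inner (A.continuous_eSpace.comp continuous_pt)
  have h1 : Tendsto (fun n => ((bFun ψ (t n) / t n) • y.1, 1 + aFun ψ (t n) * y.2 / t n)) atTop
      (𝓝 ((0 : HorSpace m), (1 : ℝ))) := by
    refine Tendsto.prodMk_nhds ?_ ?_
    · simpa using (hb.div_atTop ht).smul_const y.1
    · simpa using ((ha.mul_const y.2).div_atTop ht).const_add 1
  have h2 := ((hcont.tendsto _).comp h1).eventually_lt_const (hA.inner_lt hD h₁ h₂ hne)
  filter_upwards [h2, ht.eventually_gt_atTop 0] with n h3 h4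
  rw [mem_smul_supportHalfspace h4, not_le]
  have h5 : rescale A (aFun ψ (t n)) (bFun ψ (t n)) (t n) y =
      t n • A (pt ((bFun ψ (t n) / t n) • y.1) (1 + aFun ψ (t n) * y.2 / t n)) := by
    rw [← map_smul, smul_pt, smul_smul, rescale]
    congr 3
    · field_simp
    · field_simp
  rw [h5, inner_smul_right]
  exact mul_lt_mul_of_pos_left h3 h4

/-- In rescaled coordinates the indicator of the second halfspace tends to zero pointwise, and the
profile stays dominated. -/
theorem IsAdapted.exists_measure_inter_eq (hA : IsAdapted D θ₁ A) (hD : IsRotund D)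
    (hψ : IsVonMises ψ) (h₁ : ‖θ₁‖ = 1) (h₂ : ‖θ₂‖ = 1) (hne : θ₁ ≠ θ₂) (hC : 0 < C)
    {t : ℕ → ℝ} (ht : Tendsto t atTop atTop)
    {β : ℝ} (hb : Tendsto (fun n => bFun ψ (t n)) atTop (𝓝 β)) :
    ∃ J : ℕ → ℝ≥0∞, Tendsto J atTop (𝓝 0) ∧ ∀ᶠ n in atTop,
      intensity D C ψ n (t n • supportHalfspace D θ₁ ∩ t n • supportHalfspace D θ₂) =
        ENNReal.ofReal (rate m C ψ t n) * J n := by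
  obtain ⟨K, hK, hdom⟩ := hA.exists_profile_le hD hψ h₁
  let κ : HorSpace m × ℝ → ℝ := fun y => K * ((1 + ‖y‖) ^ (m + 2))⁻¹
  have hκ : Integrable κ (upperVolume m) :=
    (integrable_inv_one_add_norm_pow (m := m)).restrict.const_mul K
  have hκ0 : ∀ y, 0 ≤ κ y := fun y => by positivity
  have hz := zConst_pos A
  let T := fun n => rescale A (aFun ψ (t n)) (bFun ψ (t n)) (t n)
  have hT : ∀ n, Measurable (T n) := fun n => (continuous_rescale A _ _ _).measurable
  let f : ℕ → HorSpace m × ℝ → ℝ≥0∞ := fun n =>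
    (T n ⁻¹' (t n • supportHalfspace D θ₂)).indicator fun y => ENNReal.ofReal (profile D ψ A (t n) y)
  have hf : Tendsto (fun n => ∫⁻ y, f n y ∂(upperVolume m)) atTop (𝓝 0) := by
    have := tendsto_lintegral_filter_of_dominated_convergence (μ := upperVolume m) (F := f)
      (f := fun _ => 0) (l := atTop) (fun y => ENNReal.ofReal (κ y)) ?_ ?_ ?_ ?_
    · simpa using this
    · exact Eventually.of_forall fun n =>
        (continuous_profile hD hψ A (t n)).measurable.ennreal_ofReal.indicator
          (hT n (measurableSet_smul_supportHalfspace _))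
    · filter_upwards [ht.eventually hdom] with n h3
      filter_upwards [ae_restrict_mem measurableSet_upperHalf] with y hy
      exact (Set.indicator_le_self _ _ y).trans (ENNReal.ofReal_le_ofReal (h3 y hy))
    · exact ((hasFiniteIntegral_iff_ofReal (Eventually.of_forall hκ0)).1 hκ.2).ne
    · refine Eventually.of_forall fun y => ?_
      refine tendsto_const_nhds.congr' ?_
      filter_upwards [hA.eventually_notMem hD hψ h₁ h₂ hne ht hb y] with n hn
      exact (Set.indicator_of_notMem (show y ∉ T n ⁻¹' _ from hn) _).symm
  refine ⟨fun n => ENNReal.ofReal (zConst A) * ∫⁻ y, f n y ∂(upperVolume m), ?_, ?_⟩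
  · simpa using ENNReal.Tendsto.const_mul hf (Or.inr ENNReal.ofReal_ne_top)
  · filter_upwards [ht.eventually_gt_atTop 0] with n h2
    have hB := measurableSet_smul_supportHalfspace (D := D) (θ := θ₂) (t n)
    have h3 := congrArg (fun μ : Measure (ESpace m) => μ (t n • supportHalfspace D θ₂))
      (hA.intensity_restrict hD hψ hC n h2)
    have hrate : rateAt m C ψ n (t n) = rate m C ψ t n := rfl
    simp only [Measure.restrict_apply hB, Measure.smul_apply, smul_eq_mul] at h3
    rw [Measure.map_apply (hT n) hB, withDensity_apply _ (hT n hB),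
      ← lintegral_indicator (hT n hB)] at h3
    rw [Set.inter_comm, h3, hrate, ENNReal.ofReal_mul' hz.le, mul_assoc]
    rfl

end Intersections

/-! ### Sparse, intermediate and dense regimes. -/

section Regimes

/-- The three regimes of a sum of competing powers. -/
theorem tendsto_regimes {k : ℕ} {V lam : ℕ → ℝ} {c L : ℕ → ℝ} {X : ℕ → ℕ → ℝ}
    (hpos : ∀ᶠ n in atTop, 0 < lam n)
    (hV : ∀ᶠ n in atTop, V n = ∑ l ∈ Finset.Icc 1 (k + 1), c l * (lam n ^ (2 * k + 2 - l) * X l n))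
    (hX : ∀ l ∈ Finset.Icc 1 (k + 1), Tendsto (X l) atTop (𝓝 (L l))) :
    (Tendsto lam atTop (𝓝 0) →
      Tendsto (fun n => V n / lam n ^ (k + 1)) atTop (𝓝 (c (k + 1) * L (k + 1)))) ∧
    (∀ χ : ℝ, Tendsto lam atTop (𝓝 χ) → Tendsto V atTop
      (𝓝 (∑ l ∈ Finset.Icc 1 (k + 1), c l * (χ ^ (2 * k + 2 - l) * L l)))) ∧
    (Tendsto lam atTop atTop →
      Tendsto (fun n => V n / lam n ^ (2 * k + 1)) atTop (𝓝 (c 1 * L 1))) := by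
  refine ⟨fun hlam => ?_, fun χ hlam => ?_, fun hlam => ?_⟩
  -- After division by `λ^(k+1)` the exponent is `k + 1 - l`, zero only at full overlap.
  · have h1 : Tendsto (fun n => ∑ l ∈ Finset.Icc 1 (k + 1),
        c l * (lam n ^ (k + 1 - l) * X l n)) atTop
        (𝓝 (∑ l ∈ Finset.Icc 1 (k + 1), c l * ((0 : ℝ) ^ (k + 1 - l) * L l))) :=
      tendsto_finsetSum _ fun l hl => ((hlam.pow _).mul (hX l hl)).const_mul _
    have h2 : ∑ l ∈ Finset.Icc 1 (k + 1), c l * ((0 : ℝ) ^ (k + 1 - l) * L l) =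
        c (k + 1) * L (k + 1) := by
      rw [Finset.sum_eq_single (k + 1)]
      · simp
      · intro l hl hne
        rw [Finset.mem_Icc] at hl
        rw [zero_pow (by omega)]; ring
      · intro h; simp at h
    rw [h2] at h1
    refine h1.congr' ?_
    filter_upwards [hpos, hV] with n h3 h4
    rw [h4, Finset.sum_div]
    refine Finset.sum_congr rfl fun l hl => ?_
    rw [Finset.mem_Icc] at hl
    rw [show 2 * k + 2 - l = (k + 1 - l) + (k + 1) by omega, pow_add]
    field_simp
  · refine Tendsto.congr' (hV.mono fun n h => h.symm) ?_
    exact tendsto_finsetSum _ fun l hl => ((hlam.pow _).mul (hX l hl)).const_mul _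
  -- After division by `λ^(2k+1)` the term `l` carries `λ^(-(l-1))`, so only `l = 1` survives.
  · have h1 : Tendsto (fun n => ∑ l ∈ Finset.Icc 1 (k + 1),
        c l * ((lam n)⁻¹ ^ (l - 1) * X l n)) atTop
        (𝓝 (∑ l ∈ Finset.Icc 1 (k + 1), c l * ((0 : ℝ) ^ (l - 1) * L l))) :=
      tendsto_finsetSum _ fun l hl =>
        ((hlam.inv_tendsto_atTop.pow _).mul (hX l hl)).const_mul _
    have h2 : ∑ l ∈ Finset.Icc 1 (k + 1), c l * ((0 : ℝ) ^ (l - 1) * L l) = c 1 * L 1 := by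
      rw [Finset.sum_eq_single 1]
      · simp
      · intro l hl hne
        rw [Finset.mem_Icc] at hl
        rw [zero_pow (by omega)]; ring
      · intro h; simp at h
    rw [h2] at h1
    refine h1.congr' ?_
    filter_upwards [hpos, hV] with n h3 h4
    rw [h4, Finset.sum_div]
    refine Finset.sum_congr rfl fun l hl => ?_
    rw [Finset.mem_Icc] at hl
    rw [show 2 * k + 1 = (2 * k + 2 - l) + (l - 1) by omega, pow_add, inv_pow]
    field_simp

end Regimes

/-! ### Scaling, translation and convergence of kernels. -/

section KernelFamilies

variable {m k : ℕ} {h : ℝ → (Fin (k + 1) → ESpace m) → ℝ}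

theorem IsKernelFamily.eq_scale (hh : IsKernelFamily k h) {r s : ℝ} (hr : 0 < r) (hs : 0 < s)
    (x : Fin (k + 1) → ESpace m) : h s x = h r fun i => (r / s) • x i := by
  rw [hh.scaling r hr.le (r / s) (by positivity), div_div_cancel₀ hr.ne']

/-- Scaling expresses every `h_s` with `s > 0` through `h_1`, so one bound works for all radii. -/
theorem IsKernelFamily.exists_isBoundedKernel (hh : IsKernelFamily k h) :
    ∃ M : ℝ, ∀ s : ℝ, 0 < s → IsBoundedKernel (h s) M := by
  obtain ⟨M, hM⟩ := hh.bounded 1 zero_le_one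
  refine ⟨M, fun s hs => ⟨hh.measurable s hs.le, hh.nonneg s hs.le, hh.symmetric s hs.le, ?_⟩⟩
  intro x
  rw [hh.eq_scale one_pos hs]
  exact hM _

/-- Translation invariance removes the diverging vertical shift, and scaling replaces the radius
`r_n` by `r` at the price of a factor `r/r_n → 1`; continuity is then needed at the limit point
only. -/
theorem IsKernelFamily.tendsto_rescale (hh : IsKernelFamily k h) {rs : ℕ → ℝ}
    (hrs : ∀ n, 0 < rs n) {r : ℝ} (hr : 0 < r) (hrlim : Tendsto rs atTop (𝓝 r))
    (A : ESpace m ≃ₗ[ℝ] ESpace m) {a b t : ℕ → ℝ} {β : ℝ} (ha : Tendsto a atTop (𝓝 0))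
    (hb : Tendsto b atTop (𝓝 β)) {y : Fin (k + 1) → HorSpace m × ℝ}
    (hc : ContinuousAt (h r) fun i => A (pt (β • (y i).1) 0)) :
    Tendsto (fun n => h (rs n) fun i => rescale A (a n) (b n) (t n) (y i)) atTop
      (𝓝 (h r fun i => A (pt (β • (y i).1) 0))) := by
  have h1 : ∀ n, (h (rs n) fun i => rescale A (a n) (b n) (t n) (y i)) =
      h r fun i => (r / rs n) • A (pt (b n • (y i).1) (a n * (y i).2)) := by
    intro n
    have h0 : (fun i => rescale A (a n) (b n) (t n) (y i)) =
        fun i => A (pt (b n • (y i).1) (a n * (y i).2)) + A (pt 0 (t n)) := by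
      funext i
      rw [rescale, ← map_add, pt_add, add_zero, add_comm (t n)]
    rw [h0, hh.translation (rs n) (hrs n).le, ← hh.eq_scale hr (hrs n)]
  simp_rw [h1]
  refine hc.tendsto.comp ?_
  rw [tendsto_pi_nhds]
  intro i
  have h2 : Tendsto (fun n => r / rs n) atTop (𝓝 1) := by
    have := (tendsto_const_nhds (x := r)).div hrlim hr.ne'
    rwa [div_self hr.ne'] at this
  have h3 : Tendsto (fun n => (b n • (y i).1, a n * (y i).2)) atTop (𝓝 (β • (y i).1, 0)) := by
    refine (hb.smul_const _).prodMk_nhds ?_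
    simpa using ha.mul_const (y i).2
  have h4 := ((A.continuous_eSpace.comp continuous_pt).tendsto _).comp h3
  simpa using h2.smul h4

/-- Splicing the two inclusions themselves gives the index map; spliced tuples are then coordinate
selections of the joint tuple. -/
theorem exists_splice_eq_comp (k l : ℕ) :
    ∃ τ : Fin (k + 1) → Fin (k + 1) ⊕ Fin (k + 1 - l), Function.Injective τ ∧
      ∀ {V : Type} (z : Fin (k + 1) ⊕ Fin (k + 1 - l) → V),
        splice k l (z ∘ Sum.inl) (z ∘ Sum.inr) = z ∘ τ := by
  refine ⟨splice k l Sum.inl Sum.inr, fun i j hij => ?_, fun z => ?_⟩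
  · unfold splice at hij
    split_ifs at hij
    · exact Sum.inl_injective hij
    · exact Fin.ext (by have := congrArg Fin.val (Sum.inr_injective hij); simp at this; omega)
  · funext i
    simp only [splice, Function.comp_apply]
    split_ifs <;> rfl

end KernelFamilies

/-! ### Asymptotics of the moment integrals and the proposition. -/

section Main

variable {m k : ℕ} {D : Set (ESpace m)} {ψ : ℝ → ℝ} {C : ℝ}
  {h : ℝ → (Fin (k + 1) → ESpace m) → ℝ} {rs : ℕ → ℝ} {r : ℝ} {t : ℕ → ℝ} {β : ℝ}

theorem eventually_rate_pos (hψ : IsVonMises ψ) (hC : 0 < C) (ht : Tendsto t atTop atTop) :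
    ∀ᶠ n in atTop, 0 < rate m C ψ t n := by
  filter_upwards [ht.eventually_gt_atTop 0, eventually_gt_atTop 0] with n h2 h3
  have h4 := hψ.aFun_pos h2
  have h5 := hψ.bFun_pos h2
  rw [rate, hψ.qFun_eq h2, generator]
  positivity

section Initial

variable {θ : ESpace m} {A : ESpace m ≃ₗ[ℝ] ESpace m}

/-- Convergence of the rescaled first moment integrals. -/
theorem IsInitialTransformation.tendsto_meanIntegral (hA : IsInitialTransformation D θ A)
    (hD : IsRotund D) (hψ : IsVonMises ψ) (hθ : ‖θ‖ = 1) (hC : 0 < C)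
    (hf : ∫⁻ x, ENNReal.ofReal (density D C ψ x) = 1) (hh : IsKernelFamily k h)
    (hrs : ∀ n, 0 < rs n) (hr : 0 < r) (hrlim : Tendsto rs atTop (𝓝 r))
    (ht : Tendsto t atTop atTop) (hb : Tendsto (fun n => bFun ψ (t n)) atTop (𝓝 β))
    (hc : ∀ᵐ u : Fin (k + 1) → HorSpace m, ContinuousAt (h r) (fun i => A (pt (β • u i) 0))) :
    Tendsto (fun n => (∫ x, h (rs n) x ∂(Measure.pi fun _ =>
      (intensity D C ψ n).restrict (t n • supportHalfspace D θ))) / rate m C ψ t n ^ (k + 1)) atTop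
      (𝓝 (zConst A ^ (k + 1) * meanIntegral k (h r) A β)) := by
  obtain ⟨M, hM⟩ := hh.exists_isBoundedKernel
  have := hA.tendsto_integral_pi hD hψ hθ hC hf ht hb (F := fun n => h (rs n)) (M := M)
    (G := fun u => h r fun i => A (pt (β • u i) 0))
    (fun n => (hM _ (hrs n)).measurable)
    (fun n z => by
      rw [Real.norm_of_nonneg ((hM _ (hrs n)).nonneg z)]
      exact (hM _ (hrs n)).le z)
    (by
      filter_upwards [(quasiMeasurePreserving_fst_pi (ι := Fin (k + 1)) (m := m)).ae hc] with y hy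
      exact hh.tendsto_rescale hrs hr hrlim A (hψ.tendsto_aFun ht hb) hb hy)
  rwa [Fintype.card_fin] at this

/-- Convergence of the rescaled second moment integrals. -/
theorem IsInitialTransformation.tendsto_pairIntegral (hA : IsInitialTransformation D θ A)
    (hD : IsRotund D) (hψ : IsVonMises ψ) (hθ : ‖θ‖ = 1) (hC : 0 < C)
    (hf : ∫⁻ x, ENNReal.ofReal (density D C ψ x) = 1) (hh : IsKernelFamily k h)
    (hrs : ∀ n, 0 < rs n) (hr : 0 < r) (hrlim : Tendsto rs atTop (𝓝 r))
    (ht : Tendsto t atTop atTop) (hb : Tendsto (fun n => bFun ψ (t n)) atTop (𝓝 β))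
    (hc : ∀ᵐ u : Fin (k + 1) → HorSpace m, ContinuousAt (h r) (fun i => A (pt (β • u i) 0)))
    {l : ℕ} (hl : l ≤ k + 1) :
    Tendsto (fun n => (pairIntegral (intensity D C ψ n)
      (restrictedKernel (h (rs n)) (t n • supportHalfspace D θ))
      (restrictedKernel (h (rs n)) (t n • supportHalfspace D θ)) l).toReal /
        rate m C ψ t n ^ (2 * k + 2 - l)) atTop (𝓝 (varIntegral k (h r) A β l)) := by
  obtain ⟨M, hM⟩ := hh.exists_isBoundedKernel
  obtain ⟨τ, hτ, hsplice⟩ := exists_splice_eq_comp k l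
  have hM0 : 0 ≤ M := ((hM r hr).nonneg fun _ => 0).trans ((hM r hr).le _)
  have hcard : Fintype.card (Fin (k + 1) ⊕ Fin (k + 1 - l)) = 2 * k + 2 - l := by
    rw [Fintype.card_sum, Fintype.card_fin, Fintype.card_fin]
    omega
  have hcomp : ∀ (V : Type) [MeasurableSpace V] {f : Fin (k + 1) → Fin (k + 1) ⊕ Fin (k + 1 - l)},
      Measurable fun z : Fin (k + 1) ⊕ Fin (k + 1 - l) → V => z ∘ f := fun V _ f =>
    measurable_pi_lambda _ fun i => measurable_pi_apply _
  have hq := quasiMeasurePreserving_fst_pi (ι := Fin (k + 1) ⊕ Fin (k + 1 - l)) (m := m)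
  have hc1 := ((quasiMeasurePreserving_comp_injective (volume : Measure (HorSpace m))
    (Sum.inl_injective (α := Fin (k + 1)) (β := Fin (k + 1 - l)))).comp hq).ae hc
  have hc2 := ((quasiMeasurePreserving_comp_injective (volume : Measure (HorSpace m)) hτ).comp
    hq).ae hc
  have key := hA.tendsto_integral_pi hD hψ hθ hC hf ht hb (ι := Fin (k + 1) ⊕ Fin (k + 1 - l)) (M := M * M)
    (F := fun n z => h (rs n) (z ∘ Sum.inl) * h (rs n) (z ∘ τ))
    (G := fun u => h r (fun i => A (pt (β • u (Sum.inl i)) 0)) *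
      h r (fun i => A (pt (β • u (τ i)) 0)))
    (fun n => ((hM _ (hrs n)).measurable.comp (hcomp _)).mul
      ((hM _ (hrs n)).measurable.comp (hcomp _)))
    (fun n z => by
      have hk := hM _ (hrs n)
      rw [norm_mul, Real.norm_of_nonneg (hk.nonneg _), Real.norm_of_nonneg (hk.nonneg _)]
      exact mul_le_mul (hk.le _) (hk.le _) (hk.nonneg _) hM0)
    (by
      filter_upwards [hc1, hc2] with y hy1 hy2
      exact (hh.tendsto_rescale hrs hr hrlim A (hψ.tendsto_aFun ht hb) hb
        (y := fun i => y (Sum.inl i)) hy1).mul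
        (hh.tendsto_rescale hrs hr hrlim A (hψ.tendsto_aFun ht hb) hb
        (y := fun i => y (τ i)) hy2))
  rw [hcard] at key
  have hlim : ∫ u : Fin (k + 1) ⊕ Fin (k + 1 - l) → HorSpace m, (h r (fun i => A (pt (β • u (Sum.inl i)) 0)) *
      h r (fun i => A (pt (β • u (τ i)) 0))) * ∏ i, Real.exp (-‖u i‖ ^ 2 / 2) =
      ∫ p : (Fin (k + 1) → HorSpace m) × (Fin (k + 1 - l) → HorSpace m),
      h r (fun i => A (pt (β • p.1 i) 0)) *
        h r (fun i => A (pt (β • splice k l p.1 p.2 i) 0)) *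
        ((∏ i, Real.exp (-‖p.1 i‖ ^ 2 / 2)) * ∏ j, Real.exp (-‖p.2 j‖ ^ 2 / 2)) := by
    rw [← (volume_measurePreserving_sumPiEquivProdPi
      (fun _ : Fin (k + 1) ⊕ Fin (k + 1 - l) => HorSpace m)).integral_comp (MeasurableEquiv.measurableEmbedding _)]
    refine integral_congr_ae (Eventually.of_forall fun u => ?_)
    have h1 : ∀ i, splice k l (u ∘ Sum.inl) (u ∘ Sum.inr) i = u (τ i) := fun i =>
      congrFun (hsplice u) i
    simp only [Fintype.prod_sum_type]
    simp_rw [← h1]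
    rfl
  rw [hlim] at key
  refine key.congr fun n => ?_
  have := isFiniteMeasure_intensity (m := m) hf n
  rw [toReal_pairIntegral_self (hM _ (hrs n)) (measurableSet_smul_supportHalfspace _) hl]
  simp_rw [hsplice]

end Initial

theorem meanIntegral_zero (g : (Fin (k + 1) → ESpace m) → ℝ) (A : ESpace m ≃ₗ[ℝ] ESpace m) :
    meanIntegral k g A 0 = g (fun _ => 0) * ((2 * Real.pi) ^ ((m : ℝ) / 2)) ^ (k + 1) := by
  have h0 : A (pt 0 0) = 0 := by
    have : (pt 0 0 : ESpace m) = 0 := (ptEquiv m).map_zero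
    rw [this, map_zero]
  have h1 : ∫ u : HorSpace m, Real.exp (-‖u‖ ^ 2 / 2) = (2 * Real.pi) ^ ((m : ℝ) / 2) := by
    have := GaussianFourier.integral_rexp_neg_mul_sq_norm (V := HorSpace m) (b := 1 / 2)
      (by norm_num)
    rw [finrank_euclideanSpace_fin] at this
    rw [show 2 * Real.pi = Real.pi / (1 / 2) by ring, ← this]
    congr 1
    funext u
    congr 1
    ring
  simp only [meanIntegral, zero_smul, h0]
  rw [integral_const_mul, integral_fintype_prod_volume_eq_prod
    (f := fun (_ : Fin (k + 1)) (u : HorSpace m) => Real.exp (-‖u‖ ^ 2 / 2)), h1,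
    Finset.prod_const, Finset.card_univ, Fintype.card_fin]

/-- The second moment integrals at two different angles are of smaller order. -/
theorem tendsto_pairIntegral_zero (hD : IsRotund D) (hψ : IsVonMises ψ) (hC : 0 < C)
    (hf : ∫⁻ x, ENNReal.ofReal (density D C ψ x) = 1) (hh : IsKernelFamily k h)
    (hrs : ∀ n, 0 < rs n) (ht : Tendsto t atTop atTop)
    (hb : Tendsto (fun n => bFun ψ (t n)) atTop (𝓝 β)) {θ₁ θ₂ : ESpace m}
    (h₁ : ‖θ₁‖ = 1) (h₂ : ‖θ₂‖ = 1) (hne : θ₁ ≠ θ₂) {l : ℕ} (hl0 : 1 ≤ l) (hl : l ≤ k + 1) :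
    Tendsto (fun n => (pairIntegral (intensity D C ψ n)
      (restrictedKernel (h (rs n)) (t n • supportHalfspace D θ₁))
      (restrictedKernel (h (rs n)) (t n • supportHalfspace D θ₂)) l).toReal /
        rate m C ψ t n ^ (2 * k + 2 - l)) atTop (𝓝 0) := by
  obtain ⟨M, hM⟩ := hh.exists_isBoundedKernel
  obtain ⟨A₁, hA₁⟩ := hD.exists_isAdapted h₁
  obtain ⟨A₂, hA₂⟩ := hD.exists_isAdapted h₂
  obtain ⟨K₁, hK₁, hμ₁⟩ := hA₁.eventually_measure_le hD hψ h₁ hC ht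
  obtain ⟨K₂, hK₂, hμ₂⟩ := hA₂.eventually_measure_le hD hψ h₂ hC ht
  obtain ⟨J, hJ, hμJ⟩ := hA₁.exists_measure_inter_eq hD hψ h₁ h₂ hne hC ht hb
  let B : ℕ → ℝ≥0∞ := fun n =>
    ENNReal.ofReal M ^ 2 * (J n ^ l * K₁ ^ (k + 1 - l) * K₂ ^ (k + 1 - l))
  have hB : Tendsto B atTop (𝓝 0) := by
    -- At least one common argument (`l ≥ 1`) is what makes the bound vanish.
    have h1 : Tendsto (fun n => J n ^ l) atTop (𝓝 0) := by
      have := hJ.ennrpow_const (l : ℝ)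
      simpa [ENNReal.rpow_natCast, zero_pow (show l ≠ 0 by omega)] using this
    have h2 := ENNReal.Tendsto.mul_const (b := K₁ ^ (k + 1 - l)) h1
      (Or.inr (ENNReal.pow_ne_top hK₁))
    have h3 := ENNReal.Tendsto.mul_const (b := K₂ ^ (k + 1 - l)) h2
      (Or.inr (ENNReal.pow_ne_top hK₂))
    have h4 := ENNReal.Tendsto.const_mul (a := ENNReal.ofReal M ^ 2) h3
      (Or.inr (ENNReal.pow_ne_top ENNReal.ofReal_ne_top))
    simpa using h4
  have hBr : Tendsto (fun n => (B n).toReal) atTop (𝓝 0) := by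
    have h5 := (ENNReal.tendsto_toReal ENNReal.zero_ne_top).comp hB
    rwa [ENNReal.toReal_zero] at h5
  refine squeeze_zero' ?_ ?_ hBr
  · filter_upwards [eventually_rate_pos (m := m) hψ hC ht] with n hn
    positivity
  · filter_upwards [hμ₁, hμ₂, hμJ, eventually_rate_pos (m := m) hψ hC ht,
      hB.eventually_lt_const ENNReal.zero_lt_top] with n e1 e2 e3 hn hBn
    rw [div_le_iff₀ (by positivity)]
    have := isFiniteMeasure_intensity (m := m) hf n
    have h1 := pairIntegral_le (μ := intensity D C ψ n) (hM _ (hrs n)).le hl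
      (measurableSet_smul_supportHalfspace (D := D) (θ := θ₁) (t n))
      (measurableSet_smul_supportHalfspace (D := D) (θ := θ₂) (t n))
    set lam := ENNReal.ofReal (rate m C ψ t n)
    have h2 : pairIntegral (intensity D C ψ n)
        (restrictedKernel (h (rs n)) (t n • supportHalfspace D θ₁))
        (restrictedKernel (h (rs n)) (t n • supportHalfspace D θ₂)) l ≤
        B n * lam ^ (2 * k + 2 - l) := by
      refine h1.trans ?_
      rw [e3]
      calc _ ≤ ENNReal.ofReal M ^ 2 *
            ((lam * J n) ^ l * (lam * K₁) ^ (k + 1 - l) * (lam * K₂) ^ (k + 1 - l)) := by gcongr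
        _ = B n * lam ^ (2 * k + 2 - l) := by
            rw [show 2 * k + 2 - l = l + (k + 1 - l) + (k + 1 - l) by omega]
            simp only [B, mul_pow, pow_add]
            ring
    have h3 := ENNReal.toReal_mono
      (ENNReal.mul_ne_top hBn.ne (ENNReal.pow_ne_top ENNReal.ofReal_ne_top)) h2
    rwa [ENNReal.toReal_mul, ENNReal.toReal_pow, ENNReal.toReal_ofReal hn.le] at h3

/-- Both support values are positive because `0` is interior to `D`, so no point satisfies both
inequalities. Arbitrary `s` is allowed since early levels need not be positive; for `s = 0` the
intersection has at most one point. -/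
theorem IsRotund.measure_inter_opposite (hD : IsRotund D) {θ : ESpace m} (hθ : ‖θ‖ = 1)
    (s : ℝ) (μ : Measure (ESpace m)) [NullSingletonClass μ] :
    μ (s • supportHalfspace D (-θ) ∩ s • supportHalfspace D θ) = 0 := by
  rcases eq_or_ne s 0 with rfl | hs
  · exact ((Set.subsingleton_zero_smul_set _).anti Set.inter_subset_left).measure_zero μ
  · rw [← Set.smul_set_inter₀ hs]
    have : supportHalfspace D (-θ) ∩ supportHalfspace D θ = ∅ := by
      refine Set.eq_empty_of_forall_notMem fun x hx => ?_
      have h1 : supportFunction D (-θ) ≤ inner ℝ (-θ) x := hx.1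
      have h2 : supportFunction D θ ≤ inner ℝ θ x := hx.2
      have h3 := hD.supportFunction_pos hθ
      have h4 := hD.supportFunction_pos (θ := -θ) (by rwa [norm_neg])
      rw [inner_neg_left] at h1
      linarith
    rw [this, Set.smul_set_empty, measure_empty]

end Main

theorem propositionp {m k : ℕ}
    -- a homothetic density with exponentially decaying tail and rotund level sets
    (D : Set (ESpace m)) (hD : IsRotund D)
    (ψ : ℝ → ℝ) (hψ : IsVonMises ψ) (C : ℝ) (hC : 0 < C)
    (hf : ∫⁻ x, ENNReal.ofReal (density D C ψ x) = 1)
    -- the kernels, the radii and the levels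
    (h : ℝ → (Fin (k + 1) → ESpace m) → ℝ) (hh : IsKernelFamily k h)
    (rs : ℕ → ℝ) (hrs : ∀ n, 0 < rs n) (r : ℝ) (hr : 0 < r) (hrlim : Tendsto rs atTop (𝓝 r))
    (t : ℕ → ℝ) (ht : Tendsto t atTop atTop)
    (β : ℝ) (hβ : 0 ≤ β) (hb : Tendsto (fun n => bFun ψ (t n)) atTop (𝓝 β))
    -- the Poisson processes
    {Ω : Type*} [MeasurableSpace Ω] (P : Measure Ω) [IsProbabilityMeasure P]
    (N : ℕ → Ω → Set (ESpace m)) (hN : ∀ n, IsPoissonProcess (intensity D C ψ n) P (N n)) :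
    -- second moments exist
    (∀ n (θ : ESpace m), ‖θ‖ = 1 → MemLp (SStat k h D N t rs n θ) 2 P) ∧
    -- expectation and variance
    (∀ (θ : ESpace m) (A : ESpace m ≃ₗ[ℝ] ESpace m), ‖θ‖ = 1 → IsInitialTransformation D θ A →
      (∀ᵐ u : Fin (k + 1) → HorSpace m, ContinuousAt (h r) (fun i => A (pt (β • u i) 0))) →
      (0 < β →
        Tendsto (fun n => (∫ ω, SStat k h D N t rs n θ ω ∂P) / rate m C ψ t n ^ (k + 1)) atTop
          (𝓝 (zConst A ^ (k + 1) / ((k + 1).factorial : ℝ) * meanIntegral k (h r) A β))) ∧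
      (β = 0 →
        Tendsto (fun n => (∫ ω, SStat k h D N t rs n θ ω ∂P) / rate m C ψ t n ^ (k + 1)) atTop
          (𝓝 (h 1 (fun _ => 0) * (zConst A * (2 * Real.pi) ^ ((m : ℝ) / 2)) ^ (k + 1) /
            ((k + 1).factorial : ℝ)))) ∧
      (Tendsto (rate m C ψ t) atTop (𝓝 0) →
        Tendsto (fun n => variance (SStat k h D N t rs n θ) P / rate m C ψ t n ^ (k + 1)) atTop
          (𝓝 (varIntegral k (h r) A β (k + 1) / ((k + 1).factorial : ℝ)))) ∧
      (∀ χ : ℝ, 0 < χ → Tendsto (rate m C ψ t) atTop (𝓝 χ) →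
        Tendsto (fun n => variance (SStat k h D N t rs n θ) P) atTop
          (𝓝 (∑ l ∈ Finset.Icc 1 (k + 1), χ ^ (2 * k + 2 - l) * varIntegral k (h r) A β l /
            ((l.factorial : ℝ) * ((k + 1 - l).factorial : ℝ) ^ 2)))) ∧
      (Tendsto (rate m C ψ t) atTop atTop →
        Tendsto (fun n => variance (SStat k h D N t rs n θ) P / rate m C ψ t n ^ (2 * k + 1)) atTop
          (𝓝 (varIntegral k (h r) A β 1 / (k.factorial : ℝ) ^ 2)))) ∧
    -- covariance at angles that are neither equal nor opposite
    (∀ θ₁ θ₂ : ESpace m, ‖θ₁‖ = 1 → ‖θ₂‖ = 1 → θ₁ ≠ θ₂ → θ₁ ≠ -θ₂ →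
      (Tendsto (rate m C ψ t) atTop (𝓝 0) →
        Tendsto (fun n => covariance (SStat k h D N t rs n θ₁) (SStat k h D N t rs n θ₂) P /
          rate m C ψ t n ^ (k + 1)) atTop (𝓝 0)) ∧
      (∀ χ : ℝ, 0 < χ → Tendsto (rate m C ψ t) atTop (𝓝 χ) →
        Tendsto (fun n => covariance (SStat k h D N t rs n θ₁) (SStat k h D N t rs n θ₂) P) atTop
          (𝓝 0)) ∧
      (Tendsto (rate m C ψ t) atTop atTop →
        Tendsto (fun n => covariance (SStat k h D N t rs n θ₁) (SStat k h D N t rs n θ₂) P /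
          rate m C ψ t n ^ (2 * k + 1)) atTop (𝓝 0))) ∧
    -- covariance at opposite angles
    (∀ θ₁ θ₂ : ESpace m, ‖θ₁‖ = 1 → ‖θ₂‖ = 1 → θ₁ = -θ₂ → ∀ n,
      covariance (SStat k h D N t rs n θ₁) (SStat k h D N t rs n θ₂) P = 0) := by
  obtain ⟨M, hM⟩ := hh.exists_isBoundedKernel
  have hfin := fun n => isFiniteMeasure_intensity (m := m) hf n
  have hB : ∀ n θ, MeasurableSet (t n • supportHalfspace D θ) := fun n θ =>
    measurableSet_smul_supportHalfspace (t n)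
  have hpos := eventually_rate_pos (m := m) hψ hC ht
  have hmem : ∀ n θ, MemLp (SStat k h D N t rs n θ) 2 P := fun n θ =>
    (hN n).memLp_uStat (hM _ (hrs n)) (hB n θ)
  have hcov : ∀ n θ₁ θ₂, covariance (SStat k h D N t rs n θ₁) (SStat k h D N t rs n θ₂) P =
      ∑ l ∈ Finset.Icc 1 (k + 1), overlapConst k l *
        (pairIntegral (intensity D C ψ n) (restrictedKernel (h (rs n)) (t n • supportHalfspace D θ₁))
          (restrictedKernel (h (rs n)) (t n • supportHalfspace D θ₂)) l).toReal :=
    fun n θ₁ θ₂ => (hN n).covariance_uStat (hM _ (hrs n)) (hB n θ₁) (hB n θ₂)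
  -- Dividing by powers of the rate requires it to be nonzero, which is known only for large `n`.
  have hcov' : ∀ θ₁ θ₂, ∀ᶠ n in atTop,
      covariance (SStat k h D N t rs n θ₁) (SStat k h D N t rs n θ₂) P =
      ∑ l ∈ Finset.Icc 1 (k + 1), overlapConst k l * (rate m C ψ t n ^ (2 * k + 2 - l) *
        ((pairIntegral (intensity D C ψ n)
          (restrictedKernel (h (rs n)) (t n • supportHalfspace D θ₁))
          (restrictedKernel (h (rs n)) (t n • supportHalfspace D θ₂)) l).toReal /
            rate m C ψ t n ^ (2 * k + 2 - l))) := by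
    intro θ₁ θ₂
    filter_upwards [hpos] with n hn
    rw [hcov]
    refine Finset.sum_congr rfl fun l _ => ?_
    rw [mul_div_cancel₀ _ (by positivity)]
  refine ⟨fun n θ _ => hmem n θ, ?_, ?_, ?_⟩
  · intro θ A hθ hA hc
    have hmean : Tendsto (fun n => (∫ ω, SStat k h D N t rs n θ ω ∂P) / rate m C ψ t n ^ (k + 1))
        atTop (𝓝 (zConst A ^ (k + 1) / ((k + 1).factorial : ℝ) * meanIntegral k (h r) A β)) := by
      have h1 := (hA.tendsto_meanIntegral hD hψ hθ hC hf hh hrs hr hrlim ht hb hc).const_mul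
        (1 / ((k + 1).factorial : ℝ))
      rw [show zConst A ^ (k + 1) / ((k + 1).factorial : ℝ) * meanIntegral k (h r) A β =
        1 / ((k + 1).factorial : ℝ) * (zConst A ^ (k + 1) * meanIntegral k (h r) A β) by ring]
      refine h1.congr fun n => ?_
      rw [← mul_div_assoc, ← (hN n).integral_uStat (hM _ (hrs n)) (hB n θ)]
      rfl
    have hvar : ∀ n, variance (SStat k h D N t rs n θ) P =
        covariance (SStat k h D N t rs n θ) (SStat k h D N t rs n θ) P := fun n =>
      (covariance_self (hmem n θ).aestronglyMeasurable.aemeasurable).symm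
    obtain ⟨r1, r2, r3⟩ := tendsto_regimes hpos (hcov' θ θ) fun l hl =>
      hA.tendsto_pairIntegral hD hψ hθ hC hf hh hrs hr hrlim ht hb hc (Finset.mem_Icc.1 hl).2
    simp_rw [hvar]
    refine ⟨fun _ => hmean, fun hβ0 => ?_, fun hlam => ?_, fun χ _ hlam => ?_, fun hlam => ?_⟩
    -- The origin is fixed by scaling, so the value there does not depend on the radius.
    · have h0 : h r (fun _ => 0) = h 1 fun _ => 0 := by
        rw [hh.eq_scale one_pos hr]
        simp
      rw [hβ0, meanIntegral_zero, h0] at hmean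
      convert hmean using 2
      rw [mul_pow]
      ring
    · convert r1 hlam using 2
      simp [overlapConst]
      ring
    · convert r2 χ hlam using 2
      refine Finset.sum_congr rfl fun l _ => ?_
      rw [overlapConst]
      ring
    · convert r3 hlam using 2
      simp [overlapConst]
      ring
  · intro θ₁ θ₂ h₁ h₂ hne _
    obtain ⟨r1, r2, r3⟩ := tendsto_regimes (L := fun _ => 0) hpos (hcov' θ₁ θ₂) fun l hl =>
      tendsto_pairIntegral_zero hD hψ hC hf hh hrs ht hb h₁ h₂ hne (Finset.mem_Icc.1 hl).1
        (Finset.mem_Icc.1 hl).2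
    refine ⟨fun hlam => ?_, fun χ _ hlam => ?_, fun hlam => ?_⟩
    · simpa using r1 hlam
    · simpa using r2 χ hlam
    · simpa using r3 hlam
  · intro θ₁ θ₂ h₁ h₂ hopp n
    rw [hcov]
    refine Finset.sum_eq_zero fun l hl => ?_
    rw [Finset.mem_Icc] at hl
    -- Every covariance term has `l ≥ 1` and is killed by the null intersection, for each `n`
    -- separately.
    have h1 := pairIntegral_le (μ := intensity D C ψ n) (hM _ (hrs n)).le hl.2 (hB n θ₁) (hB n θ₂)
    have h2 : intensity D C ψ n (t n • supportHalfspace D θ₁ ∩ t n • supportHalfspace D θ₂) = 0 := by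
      rw [hopp]
      exact hD.measure_inter_opposite h₂ (t n) _
    rw [h2, zero_pow (by omega), zero_mul, zero_mul, mul_zero, nonpos_iff_eq_zero] at h1
    rw [h1, ENNReal.toReal_zero, mul_zero]
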